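/- Let $G$ be a connected, simply connected, non-abelian nilpotent Lie group of dimension $n$ with Lie algebra $\mathfrak g$, let $\Gamma$ be a discrete uniform (cocompact) subgroup, and let $\mathfrak m$ be a rational abelian ideal of $\mathfrak g$ of codimension one, $M=\exp\mathfrak m$. Let $(X_1,\dots,X_n)$ be a strong Malcev basis of $\mathfrak g$ (that is, $\mathrm{span}(X_1,\dots,X_k)$ is an ideal for each $k$) which is strongly based on $\Gamma$, i.e. $\Gamma=\exp(\mathbb Z X_1)\cdots\exp(\mathbb Z X_n)$, and which passes through $[\mathfrak g,\mathfrak g]=\mathrm{span}(X_1,\dots,X_p)$ and $\mathfrak m=\mathrm{span}(X_1,\dots,X_{n-1})$. Let $(X_i^*)$ be the dual basis, $\chi_l(\exp X)=e^{2\pi i\langle l,X\rangle}$, and $$\Lambda=\mathbb Z X_{p+1}^*+\dots+\mathbb Z X_n^*,\qquad \mathcal V=\{l\in\mathbb Z X_1^*+\dots+\mathbb Z X_{n-1}^*:\ l|_{[\mathfrak g,\mathfrak g]}\neq 0\}.$$ The group $\Gamma$ acts on $\mathcal V$ by $l\mapsto(\mathrm{Ad}^*(\gamma)l)|_{\mathfrak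 m}$, where $\mathfrak m^*$ is identified with the functionals that vanish on $X_n$; let $\Sigma\subset\mathcal V$ contain exactly one element of each orbit. Equip $G/\Gamma$ and $M/(M\cap\Gamma)$ with the images of Lebesgue measure on $[0,1)^n$, resp. $[0,1)^{n-1}$, under $(t_1,\dots,t_k)\mapsto\exp(t_kX_k)\cdots\exp(t_1X_1)$ with $k=n$, resp. $k=n-1$, and $G/M$ with the image of Lebesgue measure on $\mathbb R$ under $t\mapsto\exp(tX_n)M$; these are the $G$-invariant, resp. $M$-invariant, probability measures, and a $G$-invariant measure that is finite on compact sets. For $l\in\Sigma$ let $H_l$ be the Hilbert space of the induced representation $\mathrm{ind}_M^G\chi_l$: (classes of) measurable functions $F$ on $G$ with $F(gm)=\chi_l(m)^{-1}F(g)$ for $m\in M$ and $\int_{G/M}|F|^2<\infty$. For $l\in\Lambda$ let $H_l$ be the one-dimensional space of functions $F$ on $G$ with $F(gh)=\chi_l(h)^{-1}F(g)$ for $g,h\in G$, with norm $|F(1)|$. Let $\mathcal H_\rho=\bigoplus_{l\in\Sigma}H_l\oplus\bigoplus_{l\in\Lambda}H_l$ (Hilbert sum), and let $\mathcal H_\rho^0\subset\mathcal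 H_\rho$ be the space of families $K$, only finitely many of whose members $K(l)$ are nonzero functions, such that for $l\in\Sigma$ the function $K(l)\in H_l$ is continuous with compact support modulo $M$, and $K(l)\in H_l$ for $l\in\Lambda$. For $\xi\in C(G/\Gamma)$ put $$U(\xi)(l)(g)=\int_{M/M\cap\Gamma}\xi(gm)\chi_l(m)\,d\dot m\ \ (l\in\Sigma),\qquad U(\xi)(l)(g)=\int_{G/\Gamma}\xi(gm)\chi_l(m)\,d\dot m\ \ (l\in\Lambda),$$ and for $K\in\mathcal H_\rho^0$ put $$V(K)(g)=\sum_{l\in\Sigma}\ \sum_{\gamma\in\Gamma/\Gamma\cap M}K(l)(g\gamma)+\sum_{l\in\Lambda}K(l)(g).$$ Then: (1) $\mathcal H_\rho^0$ is dense in $\mathcal H_\rho$; for $K\in\mathcal H_\rho^0$ and $g\in G$ the terms of the sum $V(K)(g)$ do not depend on the choice of coset representatives, and only finitely many of them are nonzero. (2) For $K\in\mathcal H_\rho^0$, the function $V(K)$ belongs to $C(G/\Gamma)$, and $U(V(K))(l)(g)=K(l)(g)$ for all $l\in\Sigma\cup\Lambda$ and $g\in G$. (3) For $\xi\in C(G/\Gamma)$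 one has $U(\xi)\in\mathcal H_\rho$; the operator $U$ has dense range and extends, uniquely as a bounded operator, to a unitary isomorphism $U:L^2(G/\Gamma)\to\mathcal H_\rho$. (4) If $f\in L^2(G/\Gamma)$ and $U(f)=K\in\mathcal H_\rho^0$, then $V(U(f))=V(K)=f$ almost everywhere. -/

import Mathlib

open scoped Manifold ContDiff Topology ENNReal
open MeasureTheory

noncomputable section

namespace Nilmanifold

/-! ### Induced representation spaces

For a subgroup `M` of `G`, a unitary character `χ` of `M` (the values of `χ` outside `M` are never
used) and a measure `μ` on `G ⧸ M`, the Hilbert space `L²(G/M, χ)`. -/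

section Induced

variable {G : Type*} [Group G]

/-- The covariance relation `F (g m) = χ(m)⁻¹ F(g)`. -/
def Covariant (M : Subgroup G) (χ : G → Circle) (F : G → ℂ) : Prop :=
  ∀ g : G, ∀ m ∈ M, F (g * m) = ((χ m)⁻¹ : Circle) * F g

theorem Covariant.norm_out {M : Subgroup G} {χ : G → Circle} {F : G → ℂ}
    (h : Covariant M χ F) (g : G) : ‖F (g : G ⧸ M).out‖ = ‖F g‖ := by
  obtain ⟨m, hm⟩ := QuotientGroup.mk_out_eq_mul M g
  rw [hm, h g m m.2, norm_mul, Circle.norm_coe, one_mul]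

theorem Covariant.conj_mul_out {M : Subgroup G} {χ : G → Circle} {F F' : G → ℂ}
    (h : Covariant M χ F) (h' : Covariant M χ F') (g : G) :
    starRingEnd ℂ (F (g : G ⧸ M).out) * F' (g : G ⧸ M).out = starRingEnd ℂ (F g) * F' g := by
  obtain ⟨m, hm⟩ := QuotientGroup.mk_out_eq_mul M g
  rw [hm, h g m m.2, h' g m m.2, map_mul]
  have : starRingEnd ℂ (((χ m)⁻¹ : Circle) : ℂ) * (((χ m)⁻¹ : Circle) : ℂ) = 1 := by
    rw [← Complex.normSq_eq_conj_mul_self, Circle.normSq_coe]; simp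
  linear_combination (starRingEnd ℂ (F g) * F' g) * this

variable [MeasurableSpace G]

theorem Covariant.measurable_norm {M : Subgroup G} {χ : G → Circle} {F : G → ℂ}
    (h : Covariant M χ F) (hF : Measurable F) :
    Measurable fun q : G ⧸ M => ‖F q.out‖ := by
  refine measurable_from_quotient.2 ?_
  have : (fun g : G => ‖F g‖) =
      (fun q : G ⧸ M => ‖F q.out‖) ∘ (Quotient.mk'' : G → G ⧸ M) := by
    funext g; exact (h.norm_out g).symm
  rw [← this]
  exact hF.norm

theorem Covariant.measurable_conj_mul {M : Subgroup G} {χ : G → Circle} {F F' : G → ℂ}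
    (h : Covariant M χ F) (h' : Covariant M χ F') (hF : Measurable F) (hF' : Measurable F') :
    Measurable fun q : G ⧸ M => starRingEnd ℂ (F q.out) * F' q.out := by
  refine measurable_from_quotient.2 ?_
  have : (fun g : G => starRingEnd ℂ (F g) * F' g) =
      (fun q : G ⧸ M => starRingEnd ℂ (F q.out) * F' q.out) ∘
        (Quotient.mk'' : G → G ⧸ M) := by
    funext g; exact (h.conj_mul_out h' g).symm
  rw [← this]
  exact (Complex.continuous_conj.measurable.comp hF).mul hF'

/-- The measurable functions `F` on `G` that satisfy the covariance relation and
`∫_{G/M} |F|² dμ < ∞`. As `|F|²` is right `M`-invariant, its value at a coset is the value at any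
representative. -/
def l2Sections (M : Subgroup G) (χ : G → Circle) (μ : Measure (G ⧸ M)) :
    Submodule ℂ (G → ℂ) where
  carrier := {F | Measurable F ∧ Covariant M χ F ∧ Integrable (fun q : G ⧸ M => ‖F q.out‖ ^ 2) μ}
  zero_mem' := ⟨measurable_const, fun _ _ _ => by simp, by simp⟩
  add_mem' := by
    rintro F F' ⟨hF, hc, hi⟩ ⟨hF', hc', hi'⟩
    have hcc : Covariant M χ (F + F') := fun g m hm => by
      simp only [Pi.add_apply, hc g m hm, hc' g m hm]; ring
    refine ⟨hF.add hF', hcc, ?_⟩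
    refine ((hi.add hi').const_mul 2).mono'
      ((hcc.measurable_norm (hF.add hF')).pow_const 2).aestronglyMeasurable
      (Filter.Eventually.of_forall fun q => ?_)
    have h1 := norm_add_le (F q.out) (F' q.out)
    have h2 := norm_nonneg (F q.out + F' q.out)
    simp only [Pi.add_apply, norm_pow, norm_norm]
    nlinarith [sq_nonneg (‖F q.out‖ - ‖F' q.out‖)]
  smul_mem' := by
    rintro c F ⟨hF, hc, hi⟩
    refine ⟨hF.const_smul c, fun g m hm => ?_, ?_⟩
    · simp only [Pi.smul_apply, smul_eq_mul, hc g m hm]; ring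
    · simpa [mul_pow] using hi.const_mul (‖c‖ ^ 2)

/-- `l2Sections M χ μ` as a pre-Hilbert space (functions that vanish almost everywhere have
norm `0`). -/
def PreInd (M : Subgroup G) (χ : G → Circle) (μ : Measure (G ⧸ M)) : Type _ :=
  l2Sections M χ μ

instance (M : Subgroup G) (χ : G → Circle) (μ : Measure (G ⧸ M)) :
    AddCommGroup (PreInd M χ μ) :=
  inferInstanceAs (AddCommGroup (l2Sections M χ μ))

instance (M : Subgroup G) (χ : G → Circle) (μ : Measure (G ⧸ M)) :
    Module ℂ (PreInd M χ μ) :=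
  inferInstanceAs (Module ℂ (l2Sections M χ μ))

theorem l2Sections.integrable {M : Subgroup G} {χ : G → Circle} {μ : Measure (G ⧸ M)}
    {F F' : G → ℂ} (hF : F ∈ l2Sections M χ μ) (hF' : F' ∈ l2Sections M χ μ) :
    Integrable (fun q : G ⧸ M => starRingEnd ℂ (F q.out) * F' q.out) μ := by
  refine (hF.2.2.add hF'.2.2).mono'
    (hF.2.1.measurable_conj_mul hF'.2.1 hF.1 hF'.1).aestronglyMeasurable
    (Filter.Eventually.of_forall fun q => ?_)
  simp only [Pi.add_apply, norm_mul, RCLike.norm_conj]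
  nlinarith [sq_nonneg (‖F q.out‖ - ‖F' q.out‖), norm_nonneg (F q.out), norm_nonneg (F' q.out)]

/-- The inner product `⟪F, F'⟫ = ∫_{G/M} conj(F) F' dμ`. -/
abbrev preIndCore (M : Subgroup G) (χ : G → Circle) (μ : Measure (G ⧸ M)) :
    PreInnerProductSpace.Core ℂ (PreInd M χ μ) where
  inner F F' := ∫ q : G ⧸ M, starRingEnd ℂ (F.1 q.out) * F'.1 q.out ∂μ
  conj_inner_symm F F' := by
    rw [← integral_conj]
    congr 1; funext q
    simp [mul_comm]
  re_inner_nonneg F := by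
    have : (fun q : G ⧸ M => starRingEnd ℂ (F.1 q.out) * F.1 q.out) =
        fun q => ((‖F.1 q.out‖ ^ 2 : ℝ) : ℂ) := by
      funext q; rw [← Complex.normSq_eq_conj_mul_self, Complex.normSq_eq_norm_sq]
    rw [this, integral_complex_ofReal]
    simpa using integral_nonneg (μ := μ) fun q : G ⧸ M => sq_nonneg ‖F.1 q.out‖
  add_left F₁ F₂ F' := by
    rw [← integral_add (l2Sections.integrable F₁.2 F'.2) (l2Sections.integrable F₂.2 F'.2)]
    congr 1; funext q
    have : (F₁ + F₂).1 q.out = F₁.1 q.out + F₂.1 q.out := rfl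
    rw [this, map_add, add_mul]
  smul_left F F' c := by
    rw [← integral_const_mul]
    congr 1; funext q
    have : (c • F).1 q.out = c * F.1 q.out := rfl
    rw [this, map_mul, mul_assoc]

instance (M : Subgroup G) (χ : G → Circle) (μ : Measure (G ⧸ M)) :
    SeminormedAddCommGroup (PreInd M χ μ) :=
  @InnerProductSpace.Core.toSeminormedAddCommGroup ℂ _ _ _ _ (preIndCore M χ μ)

instance (M : Subgroup G) (χ : G → Circle) (μ : Measure (G ⧸ M)) :
    InnerProductSpace ℂ (PreInd M χ μ) :=
  InnerProductSpace.ofCore (preIndCore M χ μ)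

/-- The Hilbert space of the induced representation `ind_M^G χ`: the completion of the pre-Hilbert
space of square integrable sections. For the quotients considered below, the continuous sections
with compact support modulo `M` are dense in it, so that it is also the completion of these. -/
abbrev IndSpace (M : Subgroup G) (χ : G → Circle) (μ : Measure (G ⧸ M)) : Type _ :=
  UniformSpace.Completion (PreInd M χ μ)

/-- The class of a function in the induced representation space. -/
def toInd {M : Subgroup G} {χ : G → Circle} {μ : Measure (G ⧸ M)} (F : G → ℂ)
    (hF : F ∈ l2Sections M χ μ) : IndSpace M χ μ :=
  UniformSpace.Completion.coe' (show PreInd M χ μ from ⟨F, hF⟩)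

/-- `C_c(G/M, χ)`: the continuous functions on `G` that satisfy the covariance relation and have
compact support modulo `M`. -/
def IsCcSection [TopologicalSpace G] (M : Subgroup G) (χ : G → Circle) (F : G → ℂ) : Prop :=
  Continuous F ∧ Covariant M χ F ∧
    ∃ C : Set (G ⧸ M), IsCompact C ∧ ∀ g : G, (g : G ⧸ M) ∉ C → F g = 0

end Induced

/-! ### Lie groups -/

instance : ENat.LEInfty (minSmoothness ℝ 3) :=
  ⟨by rw [minSmoothness_of_isRCLikeNormedField]; exact ENat.LEInfty.out⟩

section Lie

variable {n : ℕ} {G : Type*} [TopologicalSpace G] [ChartedSpace (EuclideanSpace ℝ (Fin n)) G]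
  [Group G] [LieGroup (𝓡 n) ∞ G]

/-- The exponential map: `exp X = c(1)`, where `c` is the integral curve through `1` of the
left-invariant vector field with value `X` at `1`. -/
def lieExp (X : GroupLieAlgebra (𝓡 n) G) : G :=
  Classical.epsilon fun g : G => ∃ c : ℝ → G,
    c 0 = 1 ∧ IsMIntegralCurve (I := 𝓡 n) c (mulInvariantVectorField X) ∧ c 1 = g

/-- The inverse of the exponential map (when the latter is a bijection). -/
def lieLog (g : G) : GroupLieAlgebra (𝓡 n) G := Function.invFun lieExp g

/-- The adjoint representation: the derivative at `1` of the conjugation by `g`. -/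
def lieAd (g : G) (Y : GroupLieAlgebra (𝓡 n) G) : GroupLieAlgebra (𝓡 n) G :=
  mfderiv (𝓡 n) (𝓡 n) (fun x : G => g * x * g⁻¹) 1 Y

/-- `χ_l (exp X) = e^{2πi ⟨l, X⟩}`. -/
def chi (l : Module.Dual ℝ (GroupLieAlgebra (𝓡 n) G)) (g : G) : Circle :=
  Circle.exp (2 * Real.pi * l (lieLog g))

/-- The connected subgroup of `G` with Lie algebra `W`. -/
def expSubgroup (W : Submodule ℝ (GroupLieAlgebra (𝓡 n) G)) : Subgroup G :=
  Subgroup.closure (lieExp '' (W : Set (GroupLieAlgebra (𝓡 n) G)))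

end Lie

/-! ### The data -/

/-- In a Lie group `G` of dimension `d + 1`: a discrete uniform subgroup `Γ`, an abelian ideal `m`
of codimension one, and a strong Malcev basis `X` of the Lie algebra, strongly based on `Γ`, which
passes through the derived ideal (spanned by the first `p` vectors) and through `m` (spanned by
the first `d` vectors). -/
structure Data (d : ℕ) (G : Type*) [TopologicalSpace G]
    [ChartedSpace (EuclideanSpace ℝ (Fin (d + 1))) G] [Group G]
    [LieGroup (𝓡 (d + 1)) ∞ G] where
  Γ : Subgroup G
  discrete : DiscreteTopology Γ
  uniform : CompactSpace (G ⧸ Γ)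
  m : LieIdeal ℝ (GroupLieAlgebra (𝓡 (d + 1)) G)
  abelian : IsLieAbelian m
  X : Module.Basis (Fin (d + 1)) ℝ (GroupLieAlgebra (𝓡 (d + 1)) G)
  malcev : ∀ k : Fin (d + 1), ∃ J : LieIdeal ℝ (GroupLieAlgebra (𝓡 (d + 1)) G),
    J.toSubmodule = Submodule.span ℝ (X '' {i | i ≤ k})
  based : (Γ : Set G) =
    Set.range fun t : Fin (d + 1) → ℤ => (List.ofFn fun i => lieExp ((t i : ℝ) • X i)).prod
  p : ℕ
  span_derived : Submodule.span ℝ (X '' {i | (i : ℕ) < p}) =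
    (⁅(⊤ : LieIdeal ℝ (GroupLieAlgebra (𝓡 (d + 1)) G)),
      (⊤ : LieIdeal ℝ (GroupLieAlgebra (𝓡 (d + 1)) G))⁆).toSubmodule
  span_m : Submodule.span ℝ (X '' {i | (i : ℕ) < d}) = m.toSubmodule

namespace Data

variable {d : ℕ} {G : Type*} [TopologicalSpace G]
    [ChartedSpace (EuclideanSpace ℝ (Fin (d + 1))) G] [Group G]
    [LieGroup (𝓡 (d + 1)) ∞ G] (D : Data d G)

/-- `M = exp m`. -/
def M : Subgroup G := expSubgroup D.m.toSubmodule

theorem exp_mem (i : Fin d) (t : ℝ) : lieExp (t • D.X i.castSucc) ∈ D.M := by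
  refine Subgroup.subset_closure ⟨_, ?_, rfl⟩
  refine Submodule.smul_mem _ t ?_
  rw [← D.span_m]
  exact Submodule.subset_span ⟨i.castSucc, by simp, rfl⟩

/-- `ℤ X_{p+1}^* + ⋯ + ℤ X_n^*` (the set `Λ`), for `n = d + 1`. -/
def Lam : Set (Module.Dual ℝ (GroupLieAlgebra (𝓡 (d + 1)) G)) :=
  Submodule.span ℤ (D.X.coord '' {i | D.p ≤ (i : ℕ)})

/-- The elements of `ℤ X_1^* + ⋯ + ℤ X_{n-1}^*`, for `n = d + 1`, that do not vanish on the derived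
ideal. -/
def gen : Set (Module.Dual ℝ (GroupLieAlgebra (𝓡 (d + 1)) G)) :=
  {l | l ∈ Submodule.span ℤ (D.X.coord '' {i | (i : ℕ) < d}) ∧
    ∃ Y ∈ ⁅(⊤ : LieIdeal ℝ (GroupLieAlgebra (𝓡 (d + 1)) G)),
      (⊤ : LieIdeal ℝ (GroupLieAlgebra (𝓡 (d + 1)) G))⁆, l Y ≠ 0}

/-- `l' = (Ad^*(g) l)|_m` on `m`. -/
def AdRel (g : G) (l l' : Module.Dual ℝ (GroupLieAlgebra (𝓡 (d + 1)) G)) : Prop :=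
  ∀ Y ∈ D.m, l' Y = l (lieAd g⁻¹ Y)

/-- `S` contains exactly one element of each `Γ`-orbit in `gen`. -/
def IsCrossSection (S : Set (Module.Dual ℝ (GroupLieAlgebra (𝓡 (d + 1)) G))) : Prop :=
  S ⊆ D.gen ∧ ∀ l ∈ D.gen, ∃! s, s ∈ S ∧ ∃ γ ∈ D.Γ, D.AdRel γ s l

/-! #### Measures -/

/-- The map `(t_1, …, t_n) ↦ exp(t_n X_n) ⋯ exp(t_1 X_1)`. -/
def coordMap (t : Fin (d + 1) → ℝ) : G :=
  (List.ofFn fun i : Fin (d + 1) => lieExp (t i.rev • D.X i.rev)).prod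

/-- The map `(x_1, …, x_{n-1}) ↦ exp(x_{n-1} X_{n-1}) ⋯ exp(x_1 X_1)` with values in `M`. -/
def coordMapM (x : Fin d → ℝ) : D.M :=
  (List.ofFn fun i : Fin d =>
    (⟨lieExp (x i.rev • D.X i.rev.castSucc), D.exp_mem i.rev (x i.rev)⟩ : D.M)).prod

variable [MeasurableSpace G]

/-- The `G`-invariant probability measure on `G/Γ`: the image of the Lebesgue measure on
`[0, 1)^n`. -/
def nu : Measure (G ⧸ D.Γ) :=
  Measure.map (fun t => (D.coordMap t : G ⧸ D.Γ))
    (volume.restrict (Set.pi Set.univ fun _ : Fin (d + 1) => Set.Ico (0 : ℝ) 1))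

/-- The `M`-invariant probability measure on `M/(M ∩ Γ)`: the image of the Lebesgue measure on
`[0, 1)^{n-1}`. -/
def nuM : Measure (D.M ⧸ D.Γ.subgroupOf D.M) :=
  Measure.map (fun x => (D.coordMapM x : D.M ⧸ D.Γ.subgroupOf D.M))
    (volume.restrict (Set.pi Set.univ fun _ : Fin d => Set.Ico (0 : ℝ) 1))

/-- The `G`-invariant measure on `G/M`: the image of the Lebesgue measure under
`t ↦ exp(t X_n) M`. -/
def muGM : Measure (G ⧸ D.M) :=
  Measure.map (fun t : ℝ => ((lieExp (t • D.X (Fin.last d)) : G) : G ⧸ D.M)) volume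

/-! #### The Hilbert space of `ρ` -/

variable (S : Set (Module.Dual ℝ (GroupLieAlgebra (𝓡 (d + 1)) G)))

/-- The functional `l` of an index `l ∈ Σ ⊔ Λ`. -/
def fnl : S ⊕ D.Lam → Module.Dual ℝ (GroupLieAlgebra (𝓡 (d + 1)) G)
  | Sum.inl l => l
  | Sum.inr l => l

/-- `M(l) = M` for `l ∈ Σ` and `M(l) = G` for `l ∈ Λ`. -/
def subgp : S ⊕ D.Lam → Subgroup G
  | Sum.inl _ => D.M
  | Sum.inr _ => ⊤

/-- The invariant measure on `G/M(l)`; for `l ∈ Λ` it is the unit mass on the one-point space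
`G/G`. -/
def meas : (i : S ⊕ D.Lam) → Measure (G ⧸ D.subgp S i)
  | Sum.inl _ => D.muGM
  | Sum.inr _ => Measure.dirac ((1 : G) : G ⧸ (⊤ : Subgroup G))

/-- The space `H_ρ = ⊕_{l ∈ Σ} ind_M^G χ_l ⊕ ⊕_{l ∈ Λ} χ_l` (Hilbert sum), where the space of `χ_l`,
`l ∈ Λ`, consists of the functions `F` on `G` with `F (g h) = χ_l(h)⁻¹ F(g)`, and has the norm
`|F(1)|`. -/
abbrev HRho : Type _ :=
  lp (fun i : S ⊕ D.Lam => IndSpace (D.subgp S i) (chi (D.fnl S i)) (D.meas S i)) 2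

/-- The element `h` of `H_ρ` is the family of functions `K(l)`, `l ∈ Σ ⊔ Λ`. -/
def Represents (h : D.HRho S) (K : S ⊕ D.Lam → G → ℂ) : Prop :=
  ∀ i, ∃ hK : K i ∈ l2Sections (D.subgp S i) (chi (D.fnl S i)) (D.meas S i),
    h i = toInd (K i) hK

/-- `H_ρ^0`: the families `K` with `K(l) ∈ C_c(G/M(l), χ_l)` for all `l`, of which only finitely
many are nonzero functions. -/
def IsH0 (K : S ⊕ D.Lam → G → ℂ) : Prop :=
  (∀ i, IsCcSection (D.subgp S i) (chi (D.fnl S i)) (K i)) ∧ {i | K i ≠ 0}.Finite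

/-! #### The operators -/

/-- `U(ξ)(l)(g) = ∫_{M(l)/M(l) ∩ Γ} ξ(g m) χ_l(m) dm`. The integrand is right `Γ ∩ M(l)`-invariant,
so its value at a coset is the value at any representative. -/
def opU (ξ : G ⧸ D.Γ → ℂ) : S ⊕ D.Lam → G → ℂ
  | Sum.inl l => fun g =>
      ∫ q : D.M ⧸ D.Γ.subgroupOf D.M,
        ξ ((g * (q.out : D.M) : G) : G ⧸ D.Γ) * (chi (n := d + 1) l.1 ((q.out : D.M) : G) : ℂ)
          ∂D.nuM
  | Sum.inr l => fun g =>
      ∫ q : G ⧸ D.Γ,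
        ξ ((g * q.out : G) : G ⧸ D.Γ) * (chi (n := d + 1) l.1 q.out : ℂ) ∂D.nu

/-- `V(K)(g) = ∑_{l ∈ Σ} ∑_{γ ∈ Γ/Γ ∩ M} K(l)(g γ) + ∑_{l ∈ Λ} K(l)(g)`. -/
def opV (K : S ⊕ D.Lam → G → ℂ) (g : G) : ℂ :=
  (∑ᶠ l : S, ∑ᶠ q : D.Γ ⧸ D.M.subgroupOf D.Γ, K (Sum.inl l) (g * ((q.out : D.Γ) : G))) +
    ∑ᶠ l : D.Lam, K (Sum.inr l) g

end Data

end Nilmanifold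

end

noncomputable section

namespace Nilmanifold

/-! ### The exponential map as the flow of left-invariant vector fields -/

section LieExp

variable {n : ℕ} {G : Type*} [TopologicalSpace G] [ChartedSpace (EuclideanSpace ℝ (Fin n)) G]
  [Group G] [LieGroup (𝓡 n) ∞ G]

/-! Let A be ad X_n on the abelian ideal m, identified with ℝ^d. As m is abelian of codimension one
and G is simply connected, (t, x) ↦ exp(t X_n) exp(x) is an isomorphism onto G from ℝ × ℝ^d with the
product (s, y)(t, x) = (s + t, e^{-tA} y + x) (`Adapted.expMap_mul`, `Adapted.bijective_hom`). In
these coordinates M is {t = 0} and Γ is ℤ × ℤ^d (`Data.mem_Γ`). Hence e^{jA} preserves ℤ^d for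
integral j, and G/Γ is a bundle of tori over ℝ/ℤ: a function on it is ℤ^d-periodic in x, and its
value at (j + t, x) is the one at (t, e^{jA} x).

For an integral covector k, let c_k(t) be the Fourier coefficient `coef` of ξ on the torus over t.
For l in Σ, U(ξ)(l) is c_k on the whole line, with k = l|_m (`Data.opU_inl`). For l in Λ, U(ξ)(l) is
a Fourier coefficient of c_k on one period (`Data.opU_inr`). Moreover c_k(j + t) = c_{k'}(t) with k'
= k ∘ e^{-jA} (`coef_int_add`), so one covector on the whole line carries the same information as
its ℤ-orbit on one period.

The derived ideal is the image of A (`derived_eq`). The integral covectors that vanish on it are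
fixed by every e^{jA}; on the others ℤ acts freely, because e^{sA} is unipotent
(`apply_eq_zero_of_apply_flow_eq`). So Σ × ℤ enumerates the covectors that are not fixed, and Λ the
pairs of a fixed covector and a frequency in t (`exists_orbitEquiv`, `exists_lamEquiv`). Parseval in
x, and in t for the fixed covectors, shows that U is isometric (`Index.tsum_energy`).

In the other direction, the coset sum of a section with profile a has, over t, exactly the
frequencies in the orbit of l, with coefficients a(t + j) (`Index.coef_per`). Reading off the
coefficient at l|_m returns a, and the other components vanish; this gives U V = 1 on H_ρ^0
(`Index.exists_opU_eq`). As C_c(ℝ) is dense in L²(ℝ), H_ρ^0 is dense; it lies in the closed range of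
the extended isometry, which is therefore unitary, and its injectivity turns U V = 1 into V U = 1.

The Lie theory rests on one principle: a one-parameter group in G is t ↦ exp(tX) as soon as its
derivative at 0 is X (`lieExp_eq_of_hasDerivOne`). -/

theorem contMDiff_field (X : GroupLieAlgebra (𝓡 n) G) :
    ContMDiff (𝓡 n) (𝓡 n).tangent 1
      (fun g : G => (⟨g, mulInvariantVectorField X g⟩ : TangentBundle (𝓡 n) G)) := by
  refine (contMDiff_mulInvariantVectorField X).of_le ?_
  rw [minSmoothness_of_isRCLikeNormedField]
  norm_num

theorem mdifferentiableAt_mul_left (g h : G) :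
    MDifferentiableAt (𝓡 n) (𝓡 n) (fun x : G => g * x) h :=
  (contMDiff_mul_left (I := 𝓡 n) (n := ∞) (a := g)).mdifferentiableAt (by simp)

theorem mfderiv_mul_left_field (X : GroupLieAlgebra (𝓡 n) G) (g h : G) :
    mfderiv (𝓡 n) (𝓡 n) (fun x : G => g * x) h (mulInvariantVectorField X h) =
      mulInvariantVectorField X (g * h) := by
  have e : (fun x : G => g * h * x) = (fun x => g * x) ∘ (fun x => h * x) := by
    funext x; simp [mul_assoc]
  unfold mulInvariantVectorField
  rw [e, mfderiv_comp_of_eq (y := h) (mdifferentiableAt_mul_left g h)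
    (mdifferentiableAt_mul_left h 1) (mul_one h)]
  -- The tangent spaces at `h` and at `h * 1` are distinct dependent types. Evaluating on vectors of
  -- the model space lets the base point be changed.
  have key : ∀ k : G, h = k → ∀ v : EuclideanSpace ℝ (Fin n),
      (mfderiv (𝓡 n) (𝓡 n) (fun x : G => g * x) h : _ →L[ℝ] EuclideanSpace ℝ (Fin n)) v =
      (mfderiv (𝓡 n) (𝓡 n) (fun x : G => g * x) k : _ →L[ℝ] EuclideanSpace ℝ (Fin n)) v := by
    rintro k rfl v; rfl
  exact key _ (mul_one h).symm _

theorem isMIntegralCurveOn_mul_left {X : GroupLieAlgebra (𝓡 n) G} {c : ℝ → G} {s : Set ℝ}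
    (hc : IsMIntegralCurveOn (I := 𝓡 n) c (mulInvariantVectorField X) s) (g : G) :
    IsMIntegralCurveOn (I := 𝓡 n) (fun t => g * c t) (mulInvariantVectorField X) s := by
  intro t ht
  have h := (mdifferentiableAt_mul_left g (c t)).hasMFDerivAt.comp_hasMFDerivWithinAt t (hc t ht)
  refine h.congr_mfderiv ?_
  refine ContinuousLinearMap.ext fun r => ?_
  refine (map_smul (mfderiv (𝓡 n) (𝓡 n) (fun x : G => g * x) (c t)) (show ℝ from r)
    (mulInvariantVectorField X (c t))).trans ?_
  rw [mfderiv_mul_left_field]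
  rfl

theorem isMIntegralCurve_mul_left {X : GroupLieAlgebra (𝓡 n) G} {c : ℝ → G}
    (hc : IsMIntegralCurve (I := 𝓡 n) c (mulInvariantVectorField X)) (g : G) :
    IsMIntegralCurve (I := 𝓡 n) (fun t => g * c t) (mulInvariantVectorField X) := by
  rw [isMIntegralCurve_iff_isMIntegralCurveOn] at *
  exact isMIntegralCurveOn_mul_left hc g

variable [T2Space G]

/-- Left translates of a local integral curve through 1 are integral curves through every point, all
of the same duration; a uniform existence time makes the field complete. -/
theorem exists_oneParam (X : GroupLieAlgebra (𝓡 n) G) :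
    ∃ c : ℝ → G, c 0 = 1 ∧ IsMIntegralCurve (I := 𝓡 n) c (mulInvariantVectorField X) := by
  obtain ⟨c, hc0, hc⟩ := exists_isMIntegralCurveAt_of_contMDiffAt_boundaryless (I := 𝓡 n)
    (v := mulInvariantVectorField X) (x₀ := (1 : G)) 0 (contMDiff_field X 1)
  obtain ⟨ε, hε, hc⟩ := isMIntegralCurveAt_iff'.1 hc
  refine exists_isMIntegralCurve_of_isMIntegralCurveOn (contMDiff_field X) hε (fun g => ?_) 1
  refine ⟨fun t => g * c t, by simp [hc0], ?_⟩
  rw [Real.ball_eq_Ioo] at hc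
  simpa using isMIntegralCurveOn_mul_left hc g

/-- Rescaling time turns a curve for `X` into one for `t • X`; uniqueness of integral curves then
identifies the value that `Classical.epsilon` picks. -/
theorem lieExp_eq_of_isMIntegralCurve {X : GroupLieAlgebra (𝓡 n) G} {c : ℝ → G} (h0 : c 0 = 1)
    (hc : IsMIntegralCurve (I := 𝓡 n) c (mulInvariantVectorField X)) (t : ℝ) :
    lieExp (t • X) = c t := by
  have key : ∃ g : G, ∃ c : ℝ → G,
    c 0 = 1 ∧ IsMIntegralCurve (I := 𝓡 n) c (mulInvariantVectorField (t • X)) ∧ c 1 = g := by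
    refine ⟨_, c ∘ (· * t), by simpa using h0, ?_, rfl⟩
    rw [mulInvariantVectorField_smul]
    exact hc.comp_mul t
  obtain ⟨c', h0', hc', h1'⟩ := Classical.epsilon_spec key
  have hc2 := hc.comp_mul t
  rw [← mulInvariantVectorField_smul] at hc2
  have := isMIntegralCurve_Ioo_eq_of_contMDiff_boundaryless (t₀ := 0) (contMDiff_field (t • X))
    hc' hc2 (by simp [h0, h0'])
  have h2 := congrFun this 1
  have h3 : (lieExp (t • X) : G) = c' 1 := h1'.symm
  rw [h3, h2]
  simp

theorem isMIntegralCurve_lieExp (X : GroupLieAlgebra (𝓡 n) G) :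
    IsMIntegralCurve (I := 𝓡 n) (fun t : ℝ => (lieExp (t • X) : G)) (mulInvariantVectorField X) := by
  obtain ⟨c, h0, hc⟩ := exists_oneParam X
  have : (fun t : ℝ => (lieExp (t • X) : G)) = c :=
    funext fun t => lieExp_eq_of_isMIntegralCurve h0 hc t
  rwa [this]

theorem lieExp_zero : (lieExp (0 : GroupLieAlgebra (𝓡 n) G) : G) = 1 := by
  obtain ⟨c, h0, hc⟩ := exists_oneParam (0 : GroupLieAlgebra (𝓡 n) G)
  simpa [h0] using lieExp_eq_of_isMIntegralCurve h0 hc 0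

/-- Both sides, as functions of `t`, are integral curves of the same field with the same starting
point. -/
theorem lieExp_add_smul (X : GroupLieAlgebra (𝓡 n) G) (s t : ℝ) :
    (lieExp ((s + t) • X) : G) = lieExp (s • X) * lieExp (t • X) := by
  have h := isMIntegralCurve_lieExp (G := G) X
  have h1 := h.comp_add s
  have h2 := isMIntegralCurve_mul_left h (lieExp (s • X) : G)
  have := isMIntegralCurve_Ioo_eq_of_contMDiff_boundaryless (t₀ := 0) (contMDiff_field X)
    h1 h2 (by simp [lieExp_zero])
  simpa [add_comm] using congrFun this t

theorem lieExp_neg (X : GroupLieAlgebra (𝓡 n) G) : (lieExp (-X) : G) = (lieExp X)⁻¹ := by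
  have := lieExp_add_smul (G := G) X (-1) 1
  simp [lieExp_zero] at this
  exact eq_inv_of_mul_eq_one_left this.symm

theorem continuous_lieExp_smul (X : GroupLieAlgebra (𝓡 n) G) :
    Continuous fun t : ℝ => (lieExp (t • X) : G) :=
  (isMIntegralCurve_lieExp X).continuous

end LieExp

/-! ### The multiplication and the Lie bracket in the chart at the identity -/

section ChartCalculus

variable {n : ℕ} {G : Type*} [TopologicalSpace G] [ChartedSpace (EuclideanSpace ℝ (Fin n)) G]
  [Group G]

variable (n G) in
/-- The chart at the identity. -/
abbrev chartOne : PartialEquiv G (EuclideanSpace ℝ (Fin n)) := extChartAt (𝓡 n) (1 : G)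

variable (n G) in
/-- The multiplication in the chart at the identity. -/
def chartMul (q : EuclideanSpace ℝ (Fin n) × EuclideanSpace ℝ (Fin n)) :
    EuclideanSpace ℝ (Fin n) :=
  chartOne n G ((chartOne n G).symm q.1 * (chartOne n G).symm q.2)

theorem chartOne_symm_one : (chartOne n G).symm (chartOne n G 1) = 1 :=
  (chartOne n G).left_inv (mem_extChartAt_source 1)

theorem chartOne_mem_target : chartOne n G 1 ∈ (chartOne n G).target := mem_extChartAt_target 1

theorem mfderiv_eq_fderiv_chartOne {f : G → G} (h1 : f 1 = 1)
    (hf : MDifferentiableAt (𝓡 n) (𝓡 n) f 1) :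
    @Eq (EuclideanSpace ℝ (Fin n) →L[ℝ] EuclideanSpace ℝ (Fin n)) (mfderiv (𝓡 n) (𝓡 n) f 1)
      (fderiv ℝ (fun a => chartOne n G (f ((chartOne n G).symm a))) (chartOne n G 1)) := by
  have : writtenInExtChartAt (𝓡 n) (𝓡 n) 1 f =
      fun a => chartOne n G (f ((chartOne n G).symm a)) := by
    unfold writtenInExtChartAt
    rw [h1]
    rfl
  let L : EuclideanSpace ℝ (Fin n) →L[ℝ] EuclideanSpace ℝ (Fin n) := mfderiv (𝓡 n) (𝓡 n) f 1
  have h : HasFDerivWithinAt (writtenInExtChartAt (𝓡 n) (𝓡 n) 1 f) L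
      (Set.range (𝓡 n)) (chartOne n G 1) := hf.hasMFDerivAt.2
  rw [this, ModelWithCorners.range_eq_univ] at h
  exact h.hasFDerivAt_of_univ.fderiv.symm

variable [LieGroup (𝓡 n) ∞ G]

theorem contMDiffAt_chartOne_symm {a : EuclideanSpace ℝ (Fin n)}
    (ha : a ∈ (chartOne n G).target) :
    ContMDiffAt 𝓘(ℝ, EuclideanSpace ℝ (Fin n)) (𝓡 n) ∞ (chartOne n G).symm a :=
  (contMDiffOn_extChartAt_symm (I := 𝓡 n) (n := ∞) (1 : G)).contMDiffAt
    ((isOpen_extChartAt_target (I := 𝓡 n) (1 : G)).mem_nhds ha)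

theorem contMDiffAt_chartOne {g : G} (hg : g ∈ (chartOne n G).source) :
    ContMDiffAt (𝓡 n) 𝓘(ℝ, EuclideanSpace ℝ (Fin n)) ∞ (chartOne n G) g :=
  contMDiffAt_extChartAt' (by simpa using hg)

theorem contDiffAt_chartMul {a b : EuclideanSpace ℝ (Fin n)}
    (ha : a ∈ (chartOne n G).target) (hb : b ∈ (chartOne n G).target)
    (hab : (chartOne n G).symm a * (chartOne n G).symm b ∈ (chartOne n G).source) :
    ContDiffAt ℝ ∞ (chartMul n G) (a, b) := by
  rw [← contMDiffAt_iff_contDiffAt]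
  have h1 : ContMDiffAt 𝓘(ℝ, EuclideanSpace ℝ (Fin n) × EuclideanSpace ℝ (Fin n)) (𝓡 n) ∞
      (fun q : EuclideanSpace ℝ (Fin n) × EuclideanSpace ℝ (Fin n) => (chartOne n G).symm q.1)
      (a, b) :=
    (contMDiffAt_chartOne_symm (a := a) ha).comp (a, b) contDiff_fst.contMDiff.contMDiffAt
  have h2 : ContMDiffAt 𝓘(ℝ, EuclideanSpace ℝ (Fin n) × EuclideanSpace ℝ (Fin n)) (𝓡 n) ∞
      (fun q : EuclideanSpace ℝ (Fin n) × EuclideanSpace ℝ (Fin n) => (chartOne n G).symm q.2)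
      (a, b) :=
    (contMDiffAt_chartOne_symm (a := b) hb).comp (a, b) contDiff_snd.contMDiff.contMDiffAt
  exact (contMDiffAt_chartOne hab).comp (a, b) (h1.mul h2)

theorem contDiffAt_chartMul_left {a : EuclideanSpace ℝ (Fin n)}
    (ha : a ∈ (chartOne n G).target) :
    ContDiffAt ℝ ∞ (chartMul n G) (a, chartOne n G 1) := by
  refine contDiffAt_chartMul ha chartOne_mem_target ?_
  rw [chartOne_symm_one, mul_one]
  exact (chartOne n G).map_target ha

/-- The left-invariant field is obtained by differentiating x ↦ g x at 1. In the chart this is a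
partial derivative of the multiplication, to which ordinary calculus applies. -/
theorem mfderiv_chartOne_field (X : GroupLieAlgebra (𝓡 n) G) {a : EuclideanSpace ℝ (Fin n)}
    (ha : a ∈ (chartOne n G).target) :
    @Eq (EuclideanSpace ℝ (Fin n))
    (mfderiv (𝓡 n) 𝓘(ℝ, EuclideanSpace ℝ (Fin n)) (chartOne n G) ((chartOne n G).symm a)
      (mulInvariantVectorField X ((chartOne n G).symm a)))
    (fderiv ℝ (chartMul n G) (a, chartOne n G 1) (0, X)) := by
  set g := (chartOne n G).symm a with hg
  have hgs : g ∈ (chartOne n G).source := (chartOne n G).map_target ha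
  have hd : MDifferentiableAt (𝓡 n) 𝓘(ℝ, EuclideanSpace ℝ (Fin n)) (chartOne n G) g :=
    (contMDiffAt_chartOne hgs).mdifferentiableAt (by simp)
  have hm := mdifferentiableAt_mul_left g (1 : G) (n := n)
  have hcomp : MDifferentiableAt (𝓡 n) 𝓘(ℝ, EuclideanSpace ℝ (Fin n))
      ((chartOne n G) ∘ (fun x => g * x)) 1 := by
    refine MDifferentiableAt.comp (1 : G) (I' := 𝓡 n) ?_ hm
    rwa [mul_one]
  have e1 := mfderiv_comp_of_eq (x := (1 : G)) hd hm (mul_one g)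
  have e2 : @Eq (EuclideanSpace ℝ (Fin n) →L[ℝ] EuclideanSpace ℝ (Fin n))
      (mfderiv (𝓡 n) 𝓘(ℝ, EuclideanSpace ℝ (Fin n)) ((chartOne n G) ∘ (fun x => g * x)) 1)
      (fderiv ℝ (fun b => chartMul n G (a, b)) (chartOne n G 1)) := by
    let L : EuclideanSpace ℝ (Fin n) →L[ℝ] EuclideanSpace ℝ (Fin n) :=
      mfderiv (𝓡 n) 𝓘(ℝ, EuclideanSpace ℝ (Fin n)) ((chartOne n G) ∘ (fun x => g * x)) 1
    have h : HasFDerivWithinAt (fun b => chartMul n G (a, b)) L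
        (Set.range (𝓡 n)) (chartOne n G 1) := hcomp.hasMFDerivAt.2
    rw [ModelWithCorners.range_eq_univ] at h
    exact h.hasFDerivAt_of_univ.fderiv.symm
  have e3 : fderiv ℝ (fun b => chartMul n G (a, b)) (chartOne n G 1) =
      (fderiv ℝ (chartMul n G) (a, chartOne n G 1)).comp
        (ContinuousLinearMap.inr ℝ (EuclideanSpace ℝ (Fin n)) (EuclideanSpace ℝ (Fin n))) := by
    have h := ((contDiffAt_chartMul_left ha).differentiableAt (by simp)).hasFDerivAt.comp
      (chartOne n G 1) (hasFDerivAt_prodMk_right a (chartOne n G 1))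
    exact h.fderiv
  have key : ∀ k : G, k = g → ∀ v : EuclideanSpace ℝ (Fin n),
      (mfderiv (𝓡 n) 𝓘(ℝ, EuclideanSpace ℝ (Fin n)) (chartOne n G) g :
        _ →L[ℝ] EuclideanSpace ℝ (Fin n)) v =
      (mfderiv (𝓡 n) 𝓘(ℝ, EuclideanSpace ℝ (Fin n)) (chartOne n G) k :
        _ →L[ℝ] EuclideanSpace ℝ (Fin n)) v := by
    rintro k rfl v; rfl
  have e4 := congrArg (fun L : EuclideanSpace ℝ (Fin n) →L[ℝ] EuclideanSpace ℝ (Fin n) => L X)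
    (e2.trans e3)
  rw [e1] at e4
  refine Eq.trans ?_ e4
  exact key _ (mul_one g) _

/-- By the unit law, the multiplication with second factor 1 is the identity near `a`. -/
theorem fderiv_chartMul_inl {a : EuclideanSpace ℝ (Fin n)} (ha : a ∈ (chartOne n G).target)
    (Z : EuclideanSpace ℝ (Fin n)) : fderiv ℝ (chartMul n G) (a, chartOne n G 1) (Z, 0) = Z := by
  have h := HasFDerivAt.comp (f := fun b => (b, chartOne n G 1)) a
    ((contDiffAt_chartMul_left ha).differentiableAt (by simp)).hasFDerivAt
    (hasFDerivAt_prodMk_left a (chartOne n G 1))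
  have h2 : (chartMul n G ∘ fun b => (b, chartOne n G 1)) =ᶠ[𝓝 a] id := by
    filter_upwards [(isOpen_extChartAt_target (I := 𝓡 n) (1 : G)).mem_nhds ha] with b hb
    simp only [Function.comp_apply, chartMul, chartOne_symm_one, mul_one, id]
    exact (chartOne n G).right_inv hb
  have h3 := (h.congr_of_eventuallyEq h2.symm).unique (hasFDerivAt_id a)
  simpa using congrArg (fun L : EuclideanSpace ℝ (Fin n) →L[ℝ] EuclideanSpace ℝ (Fin n) => L Z) h3

theorem fderiv_chartMul_inr (Z : EuclideanSpace ℝ (Fin n)) :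
    fderiv ℝ (chartMul n G) (chartOne n G 1, chartOne n G 1) (0, Z) = Z := by
  have h := HasFDerivAt.comp (f := fun b => (chartOne n G 1, b)) (chartOne n G 1)
    ((contDiffAt_chartMul_left chartOne_mem_target).differentiableAt (by simp)).hasFDerivAt
    (hasFDerivAt_prodMk_right (chartOne n G 1) (chartOne n G 1))
  have h2 : (chartMul n G ∘ fun b => (chartOne n G 1, b)) =ᶠ[𝓝 (chartOne n G 1)] id := by
    filter_upwards [(isOpen_extChartAt_target (I := 𝓡 n) (1 : G)).mem_nhds
      (chartOne_mem_target (n := n) (G := G))] with b hb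
    simp only [Function.comp_apply, chartMul, chartOne_symm_one, one_mul, id]
    exact (chartOne n G).right_inv hb
  have h3 := (h.congr_of_eventuallyEq h2.symm).unique (hasFDerivAt_id _)
  simpa using congrArg (fun L : EuclideanSpace ℝ (Fin n) →L[ℝ] EuclideanSpace ℝ (Fin n) => L Z) h3

theorem fderiv_chartMul (Z W : EuclideanSpace ℝ (Fin n)) :
    fderiv ℝ (chartMul n G) (chartOne n G 1, chartOne n G 1) (Z, W) = Z + W := by
  have : (Z, W) = (Z, (0 : EuclideanSpace ℝ (Fin n))) + (0, W) := by simp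
  rw [this, map_add, fderiv_chartMul_inl chartOne_mem_target, fderiv_chartMul_inr]

theorem differentiableAt_fderiv_chartMul :
    DifferentiableAt ℝ (fderiv ℝ (chartMul n G)) (chartOne n G 1, chartOne n G 1) :=
  ((contDiffAt_chartMul_left chartOne_mem_target).fderiv_right
    (m := 1) (by norm_cast)).differentiableAt (by simp)

/-- By `fderiv_chartMul_inl` the first derivative in this direction is constant along the slice with
second factor 1. -/
theorem fderiv_fderiv_chartMul_inl (Z W : EuclideanSpace ℝ (Fin n)) :
    fderiv ℝ (fderiv ℝ (chartMul n G)) (chartOne n G 1, chartOne n G 1) (W, 0) (Z, 0) = 0 := by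
  have h2 := (HasFDerivAt.comp (f := fun a => (a, chartOne n G 1)) (chartOne n G 1)
    differentiableAt_fderiv_chartMul.hasFDerivAt
    (hasFDerivAt_prodMk_left (chartOne n G 1) (chartOne n G 1))).clm_apply
    (hasFDerivAt_const ((Z, 0) : EuclideanSpace ℝ (Fin n) × EuclideanSpace ℝ (Fin n))
      (chartOne n G 1))
  have h3 : (fun a => fderiv ℝ (chartMul n G) (a, chartOne n G 1) (Z, 0))
      =ᶠ[𝓝 (chartOne n G 1)] fun _ => Z := by
    filter_upwards [(isOpen_extChartAt_target (I := 𝓡 n) (1 : G)).mem_nhds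
      (chartOne_mem_target (n := n) (G := G))] with b hb
    exact fderiv_chartMul_inl hb Z
  have h4 := (h2.congr_of_eventuallyEq h3.symm).unique (hasFDerivAt_const Z _)
  simpa using congrArg (fun L : EuclideanSpace ℝ (Fin n) →L[ℝ] EuclideanSpace ℝ (Fin n) => L W) h4

/-- The Lie bracket as antisymmetrized second derivative of the multiplication in the chart. -/
theorem bracket_eq_chartMul (X Y : GroupLieAlgebra (𝓡 n) G) :
    @Eq (EuclideanSpace ℝ (Fin n)) (⁅X, Y⁆ : GroupLieAlgebra (𝓡 n) G)
    (fderiv ℝ (fderiv ℝ (chartMul n G)) (chartOne n G 1, chartOne n G 1) (X, 0) (0, Y) -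
     fderiv ℝ (fderiv ℝ (chartMul n G)) (chartOne n G 1, chartOne n G 1) (Y, 0) (0, X)) := by
  -- The pullback under the inverse chart is the pushforward under the chart, which
  -- `mfderiv_chartOne_field` computes.
  have hV : ∀ Z : GroupLieAlgebra (𝓡 n) G,
      (VectorField.mpullbackWithin 𝓘(ℝ, EuclideanSpace ℝ (Fin n)) (𝓡 n) (chartOne n G).symm
        (mulInvariantVectorField Z) (Set.range (𝓡 n)) :
          EuclideanSpace ℝ (Fin n) → EuclideanSpace ℝ (Fin n)) =ᶠ[𝓝 (chartOne n G 1)]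
      fun a => fderiv ℝ (chartMul n G) (a, chartOne n G 1) (0, Z) := by
    intro Z
    filter_upwards [(isOpen_extChartAt_target (I := 𝓡 n) (1 : G)).mem_nhds
      (chartOne_mem_target (n := n) (G := G))] with a ha
    rw [← mfderiv_chartOne_field Z ha]
    refine congrArg (fun L : EuclideanSpace ℝ (Fin n) →L[ℝ] EuclideanSpace ℝ (Fin n) =>
      L (mulInvariantVectorField Z ((chartOne n G).symm a))) ?_
    exact ContinuousLinearMap.inverse_eq (mfderivWithin_extChartAt_symm_comp_mfderiv_extChartAt ha)
      (mfderiv_extChartAt_comp_mfderivWithin_extChartAt_symm ha)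
  have hD : ∀ Z W : EuclideanSpace ℝ (Fin n),
      fderiv ℝ (fun a => fderiv ℝ (chartMul n G) (a, chartOne n G 1) (0, Z)) (chartOne n G 1) W =
      fderiv ℝ (fderiv ℝ (chartMul n G)) (chartOne n G 1, chartOne n G 1) (W, 0) (0, Z) := by
    intro Z W
    have h2 := (HasFDerivAt.comp (f := fun a => (a, chartOne n G 1)) (chartOne n G 1)
      differentiableAt_fderiv_chartMul.hasFDerivAt
      (hasFDerivAt_prodMk_left (chartOne n G 1) (chartOne n G 1))).clm_apply
      (hasFDerivAt_const ((0, Z) : EuclideanSpace ℝ (Fin n) × EuclideanSpace ℝ (Fin n))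
        (chartOne n G 1))
    have h3 := h2.fderiv
    simp only [Function.comp_def] at h3
    rw [h3]
    simp
  rw [GroupLieAlgebra.bracket_def, VectorField.mlieBracket, VectorField.mlieBracketWithin_apply]
  refine (congrArg (fun L : EuclideanSpace ℝ (Fin n) →L[ℝ] EuclideanSpace ℝ (Fin n) => L.inverse _)
    mfderiv_extChartAt_self).trans ?_
  refine (congrArg (fun L : EuclideanSpace ℝ (Fin n) →L[ℝ] EuclideanSpace ℝ (Fin n) => L _)
    ContinuousLinearMap.inverse_id).trans ?_
  rw [ContinuousLinearMap.id_apply]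
  have hs : (extChartAt (𝓡 n) (1 : G)).symm ⁻¹' Set.univ ∩ Set.range (𝓡 n) = Set.univ := by simp
  rw [hs]
  refine (Filter.EventuallyEq.lieBracketWithin_vectorField_eq_nhds (hV X) (hV Y)).trans ?_
  rw [VectorField.lieBracketWithin_univ, VectorField.lieBracket]
  refine congrArg₂ (fun a b : EuclideanSpace ℝ (Fin n) => a - b)
    ((hD Y _).trans ?_) ((hD X _).trans ?_)
  · exact congrArg (fun W : EuclideanSpace ℝ (Fin n) => fderiv ℝ (fderiv ℝ (chartMul n G))
      (chartOne n G 1, chartOne n G 1) (W, 0) (0, Y)) (fderiv_chartMul_inr X)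
  · exact congrArg (fun W : EuclideanSpace ℝ (Fin n) => fderiv ℝ (fderiv ℝ (chartMul n G))
      (chartOne n G 1, chartOne n G 1) (W, 0) (0, X)) (fderiv_chartMul_inr Y)

end ChartCalculus

/-! ### Strict derivatives at the identity, and one-parameter groups -/

section DerivOne

variable {n : ℕ} {G : Type*} [TopologicalSpace G] [ChartedSpace (EuclideanSpace ℝ (Fin n)) G]
  [Group G]

/-- `f 0 = 1`, and `f` is strictly differentiable at `0`, with derivative `L`. -/
structure HasDerivOne {W : Type*} [NormedAddCommGroup W] [NormedSpace ℝ W] (f : W → G)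
    (L : W →L[ℝ] EuclideanSpace ℝ (Fin n)) : Prop where
  map_zero : f 0 = 1
  continuousAt : ContinuousAt f 0
  hasStrictFDerivAt : HasStrictFDerivAt (fun w => chartOne n G (f w)) L 0

theorem HasDerivOne.eventually_mem_source {W : Type*} [NormedAddCommGroup W] [NormedSpace ℝ W]
    {f : W → G} {L : W →L[ℝ] EuclideanSpace ℝ (Fin n)} (hf : HasDerivOne f L) :
    ∀ᶠ w in 𝓝 0, f w ∈ (chartOne n G).source := by
  refine hf.continuousAt.eventually_mem ?_
  rw [hf.map_zero]
  exact extChartAt_source_mem_nhds 1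

theorem HasDerivOne.one {W : Type*} [NormedAddCommGroup W] [NormedSpace ℝ W] :
    HasDerivOne (n := n) (fun _ : W => (1 : G)) 0 :=
  ⟨rfl, continuousAt_const, hasStrictFDerivAt_const _ _⟩

theorem HasDerivOne.comp {W W' : Type*} [NormedAddCommGroup W] [NormedSpace ℝ W]
    [NormedAddCommGroup W'] [NormedSpace ℝ W'] {f : W → G}
    {L : W →L[ℝ] EuclideanSpace ℝ (Fin n)} (hf : HasDerivOne f L) {g : W' → W} {T : W' →L[ℝ] W}
    (h0 : g 0 = 0) (hg : HasStrictFDerivAt g T 0) :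
    HasDerivOne (fun w => f (g w)) (L.comp T) := by
  refine ⟨by simp [hf.map_zero, h0], ?_, ?_⟩
  · exact ContinuousAt.comp (by rw [h0]; exact hf.continuousAt) hg.continuousAt
  · refine HasStrictFDerivAt.comp (g := fun w => chartOne n G (f w)) (0 : W') ?_ hg
    rw [h0]; exact hf.hasStrictFDerivAt

theorem HasDerivOne.hasMFDerivAt {W : Type*} [NormedAddCommGroup W] [NormedSpace ℝ W]
    {f : W → G} {L : W →L[ℝ] EuclideanSpace ℝ (Fin n)} (hf : HasDerivOne f L) :
    @HasMFDerivAt ℝ _ W _ _ W _ 𝓘(ℝ, W) W _ _ (EuclideanSpace ℝ (Fin n)) _ _ _ _ (𝓡 n) G _ _ f 0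
      L := by
  refine ⟨hf.continuousAt, ?_⟩
  have e : writtenInExtChartAt 𝓘(ℝ, W) (𝓡 n) 0 f = fun w => chartOne n G (f w) := by
    unfold writtenInExtChartAt
    rw [hf.map_zero]
    rfl
  rw [e]
  exact hf.hasStrictFDerivAt.hasFDerivAt.hasFDerivWithinAt

variable [LieGroup (𝓡 n) ∞ G]

/-- To first order at the identity, multiplication is addition; hence derivatives at 1 add up in
products. -/
theorem hasStrictFDerivAt_chartMul :
    HasStrictFDerivAt (chartMul n G)
      (ContinuousLinearMap.fst ℝ (EuclideanSpace ℝ (Fin n)) (EuclideanSpace ℝ (Fin n)) +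
        ContinuousLinearMap.snd ℝ (EuclideanSpace ℝ (Fin n)) (EuclideanSpace ℝ (Fin n)))
      (chartOne n G 1, chartOne n G 1) := by
  have h := (contDiffAt_chartMul_left (n := n) (G := G) chartOne_mem_target).hasStrictFDerivAt
    (by simp)
  refine h.congr_fderiv ?_
  refine ContinuousLinearMap.ext fun q => ?_
  obtain ⟨x, y⟩ := q
  rw [fderiv_chartMul]
  simp

theorem HasDerivOne.mul {W : Type*} [NormedAddCommGroup W] [NormedSpace ℝ W] {f g : W → G}
    {L L' : W →L[ℝ] EuclideanSpace ℝ (Fin n)} (hf : HasDerivOne f L) (hg : HasDerivOne g L') :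
    HasDerivOne (fun w => f w * g w) (L + L') := by
  have := topologicalGroup_of_lieGroup (G := G) (𝓡 n) ∞
  refine ⟨by simp [hf.map_zero, hg.map_zero], hf.continuousAt.mul hg.continuousAt, ?_⟩
  have h1 := hf.hasStrictFDerivAt.prodMk hg.hasStrictFDerivAt
  have h2 : HasStrictFDerivAt (chartMul n G)
      (ContinuousLinearMap.fst ℝ (EuclideanSpace ℝ (Fin n)) (EuclideanSpace ℝ (Fin n)) +
        ContinuousLinearMap.snd ℝ (EuclideanSpace ℝ (Fin n)) (EuclideanSpace ℝ (Fin n)))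
      ((fun w => (chartOne n G (f w), chartOne n G (g w))) 0) := by
    simp only [hf.map_zero, hg.map_zero]
    exact hasStrictFDerivAt_chartMul
  have h3 := h2.comp (0 : W) h1
  refine (h3.congr_of_eventuallyEq ?_).congr_fderiv ?_
  · filter_upwards [hf.eventually_mem_source, hg.eventually_mem_source] with w h4 h5
    simp only [chartMul]
    rw [(chartOne n G).left_inv h4, (chartOne n G).left_inv h5]
  · ext; simp

theorem HasDerivOne.list_prod {W : Type*} [NormedAddCommGroup W] [NormedSpace ℝ W] :
    ∀ {k : ℕ} {f : Fin k → W → G} {L : Fin k → W →L[ℝ] EuclideanSpace ℝ (Fin n)}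
    (_ : ∀ i, HasDerivOne (f i) (L i)),
    HasDerivOne (fun w => (List.ofFn fun i => f i w).prod) (∑ i, L i)
  | 0, f, L, _ => by simpa using HasDerivOne.one
  | k + 1, f, L, h => by
      simp only [List.ofFn_succ, List.prod_cons, Fin.sum_univ_succ]
      exact (h 0).mul (HasDerivOne.list_prod fun i => h i.succ)

/-- From c(s) = c(t) c(s - t), the derivative at time 0 is carried to time t by the left translation
by c(t). -/
theorem isMIntegralCurve_of_hasDerivOne {c : ℝ → G} (hc : ∀ s t, c (s + t) = c s * c t)
    {X : GroupLieAlgebra (𝓡 n) G} (hX : HasDerivOne c (ContinuousLinearMap.toSpanSingleton ℝ X)) :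
    IsMIntegralCurve (I := 𝓡 n) c (mulInvariantVectorField X) := by
  intro t
  have e : c = (fun x => c t * x) ∘ (c ∘ fun s => s - t) := by
    funext s; simp [← hc]
  have h1 : HasMFDerivAt 𝓘(ℝ, ℝ) 𝓘(ℝ, ℝ) (fun s : ℝ => s - t) t
      (ContinuousLinearMap.id ℝ ℝ) :=
    ((hasFDerivAt_id t).sub_const t).hasMFDerivAt
  have h2 : @HasMFDerivAt ℝ _ ℝ _ _ ℝ _ 𝓘(ℝ, ℝ) ℝ _ _ (EuclideanSpace ℝ (Fin n)) _ _ _ _ (𝓡 n) G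
      _ _ c ((fun s : ℝ => s - t) t) (ContinuousLinearMap.toSpanSingleton ℝ X) := by
    have h0 : ∀ s : ℝ, s = 0 →
        @HasMFDerivAt ℝ _ ℝ _ _ ℝ _ 𝓘(ℝ, ℝ) ℝ _ _ (EuclideanSpace ℝ (Fin n)) _ _ _ _ (𝓡 n) G
          _ _ c s (ContinuousLinearMap.toSpanSingleton ℝ X) := by
      rintro s rfl
      exact hX.hasMFDerivAt
    exact h0 _ (sub_self t)
  have h3 := HasMFDerivAt.comp (f := fun s : ℝ => s - t) t h2 h1
  have h4 : MDifferentiableAt (𝓡 n) (𝓡 n) (fun x => c t * x) ((c ∘ fun s => s - t) t) :=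
    mdifferentiableAt_mul_left _ _
  have h5 := h4.hasMFDerivAt.comp t h3
  rw [← e] at h5
  have key : ∀ k : G, k = 1 → ∀ v : EuclideanSpace ℝ (Fin n),
      (mfderiv (𝓡 n) (𝓡 n) (fun x : G => c t * x) k : _ →L[ℝ] EuclideanSpace ℝ (Fin n)) v =
      (mfderiv (𝓡 n) (𝓡 n) (fun x : G => c t * x) 1 : _ →L[ℝ] EuclideanSpace ℝ (Fin n)) v := by
    rintro k rfl v; rfl
  refine h5.congr_mfderiv (ContinuousLinearMap.ext fun r => ?_)
  refine (key ((c ∘ fun s => s - t) t) (by simp [hX.map_zero]) _).trans ?_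
  exact ContinuousLinearMap.map_smul (mfderiv (𝓡 n) (𝓡 n) (fun x : G => c t * x) 1)
    (show ℝ from r) X

variable [T2Space G]

/-- The tool for all later formulas for the exponential: exhibit a one-parameter group and compute
its derivative at 0. -/
theorem lieExp_eq_of_hasDerivOne {c : ℝ → G} (hc : ∀ s t, c (s + t) = c s * c t)
    {X : GroupLieAlgebra (𝓡 n) G} (hX : HasDerivOne c (ContinuousLinearMap.toSpanSingleton ℝ X))
    (t : ℝ) : c t = lieExp (t • X) :=
  (lieExp_eq_of_isMIntegralCurve hX.map_zero (isMIntegralCurve_of_hasDerivOne hc hX) t).symm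

/-- An integral curve is differentiable at each time, with velocity given by the field; this
velocity is continuous at 0, so the derivative there is strict. -/
theorem hasDerivOne_lieExp (X : GroupLieAlgebra (𝓡 n) G) :
    HasDerivOne (fun t : ℝ => (lieExp (t • X) : G)) (ContinuousLinearMap.toSpanSingleton ℝ X) := by
  have h0 : (lieExp ((0 : ℝ) • X) : G) = 1 := by rw [zero_smul, lieExp_zero]
  have hcont := continuous_lieExp_smul (G := G) X
  refine ⟨h0, hcont.continuousAt, ?_⟩
  have hsrc : ∀ᶠ t : ℝ in 𝓝 0, (lieExp (t • X) : G) ∈ (chartOne n G).source := by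
    refine hcont.continuousAt.eventually_mem ?_
    rw [h0]
    exact extChartAt_source_mem_nhds 1
  have hd : ∀ᶠ t : ℝ in 𝓝 0, HasFDerivAt (fun t : ℝ => chartOne n G (lieExp (t • X) : G))
      (ContinuousLinearMap.toSpanSingleton ℝ (fderiv ℝ (chartMul n G)
        (chartOne n G (lieExp (t • X) : G), chartOne n G 1) (0, X))) t := by
    filter_upwards [hsrc] with t ht
    have h1 : MDifferentiableAt (𝓡 n) 𝓘(ℝ, EuclideanSpace ℝ (Fin n)) (chartOne n G)
      (lieExp (t • X) : G) := (contMDiffAt_chartOne ht).mdifferentiableAt (by simp)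
    have h2 := h1.hasMFDerivAt.comp t (isMIntegralCurve_lieExp (G := G) X t)
    have h3 := mfderiv_chartOne_field X ((chartOne n G).map_source ht)
    rw [(chartOne n G).left_inv ht] at h3
    have h4 := hasMFDerivAt_iff_hasFDerivAt.1 h2
    refine h4.congr_fderiv (ContinuousLinearMap.ext fun r => ?_)
    rw [← h3]
    exact ContinuousLinearMap.map_smul
      (mfderiv (𝓡 n) 𝓘(ℝ, EuclideanSpace ℝ (Fin n)) (chartOne n G) (lieExp (t • X) : G))
      (show ℝ from r) (mulInvariantVectorField X (lieExp (t • X) : G))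
  have hc1 : ContinuousAt (fun t : ℝ => chartOne n G (lieExp (t • X) : G)) 0 := hd.self_of_nhds.continuousAt
  have hc2 : ContinuousAt (fun t : ℝ => ContinuousLinearMap.toSpanSingleton ℝ
      (fderiv ℝ (chartMul n G) (chartOne n G (lieExp (t • X) : G), chartOne n G 1) (0, X))) 0 := by
    have h1 : ContinuousAt (fderiv ℝ (chartMul n G))
        (chartOne n G (lieExp ((0 : ℝ) • X) : G), chartOne n G 1) := by
      rw [h0]; exact differentiableAt_fderiv_chartMul.continuousAt
    have h2 : ContinuousAt (fun t : ℝ => fderiv ℝ (chartMul n G)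
        (chartOne n G (lieExp (t • X) : G), chartOne n G 1)) 0 :=
      ContinuousAt.comp (f := fun t : ℝ => (chartOne n G (lieExp (t • X) : G), chartOne n G 1)) h1
        (hc1.prodMk continuousAt_const)
    have h3 := h2.clm_apply
      (continuousAt_const (y := ((0, X) : EuclideanSpace ℝ (Fin n) × EuclideanSpace ℝ (Fin n))))
    exact (ContinuousLinearMap.toSpanSingletonCLE (𝕜 := ℝ)
      (E := EuclideanSpace ℝ (Fin n))).continuous.continuousAt.comp h3
  have := hasStrictFDerivAt_of_hasFDerivAt_of_continuousAt hd hc2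
  rw [h0] at this
  exact this.congr_fderiv
    (congrArg (ContinuousLinearMap.toSpanSingleton ℝ) (fderiv_chartMul_inr X))

end DerivOne

/-! ### The adjoint representation and its derivative -/

section Adjoint

variable {n : ℕ} {G : Type*} [TopologicalSpace G] [ChartedSpace (EuclideanSpace ℝ (Fin n)) G]
  [Group G]

/-- `lieAd g` as a continuous linear map. -/
def lieAdL (g : G) : EuclideanSpace ℝ (Fin n) →L[ℝ] EuclideanSpace ℝ (Fin n) :=
  mfderiv (𝓡 n) (𝓡 n) (fun x : G => g * x * g⁻¹) 1

theorem lieAdL_one : lieAdL (n := n) (1 : G) = ContinuousLinearMap.id ℝ _ := by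
  have : (fun x : G => 1 * x * 1⁻¹) = id := by funext x; simp
  unfold lieAdL
  rw [this]
  exact mfderiv_id

variable [LieGroup (𝓡 n) ∞ G]

theorem two_le_infty : (2 : ℕ∞ω) ≤ (∞ : ℕ∞ω) := ENat.LEInfty.out

theorem contMDiff_conj (g : G) : ContMDiff (𝓡 n) (𝓡 n) ∞ (fun x : G => g * x * g⁻¹) :=
  (contMDiff_const.mul contMDiff_id).mul contMDiff_const

theorem mdifferentiableAt_conj (g h : G) :
    MDifferentiableAt (𝓡 n) (𝓡 n) (fun x : G => g * x * g⁻¹) h :=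
  (contMDiff_conj g).mdifferentiableAt (by simp)

theorem lieAdL_eq_fderiv (g : G) :
    lieAdL (n := n) g = fderiv ℝ (fun a => chartOne n G (g * (chartOne n G).symm a * g⁻¹))
      (chartOne n G 1) :=
  mfderiv_eq_fderiv_chartOne (by simp) (mdifferentiableAt_conj g 1)

theorem lieAdL_mul (g h : G) : lieAdL (n := n) (g * h) = (lieAdL g).comp (lieAdL h) := by
  have e : (fun x : G => g * h * x * (g * h)⁻¹) =
      (fun x => g * x * g⁻¹) ∘ (fun x => h * x * h⁻¹) := by
    funext x; simp [mul_assoc]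
  have h1 := mfderiv_comp_of_eq (x := (1 : G)) (y := 1) (mdifferentiableAt_conj g 1)
    (mdifferentiableAt_conj (n := n) h 1) (by simp)
  rw [← e] at h1
  refine h1.trans ?_
  have key : ∀ k : G, k = 1 → ∀ v : EuclideanSpace ℝ (Fin n),
      (mfderiv (𝓡 n) (𝓡 n) (fun x : G => g * x * g⁻¹) k : _ →L[ℝ] EuclideanSpace ℝ (Fin n)) v =
      (mfderiv (𝓡 n) (𝓡 n) (fun x : G => g * x * g⁻¹) 1 : _ →L[ℝ] EuclideanSpace ℝ (Fin n)) v := by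
    rintro k rfl v; rfl
  refine ContinuousLinearMap.ext fun v => key (h * 1 * h⁻¹) (by simp) _

theorem HasDerivOne.conj {W : Type*} [NormedAddCommGroup W] [NormedSpace ℝ W] {f : W → G}
    {L : W →L[ℝ] EuclideanSpace ℝ (Fin n)} (hf : HasDerivOne f L) (g : G) :
    HasDerivOne (fun w => g * f w * g⁻¹) ((lieAdL g).comp L) := by
  have := topologicalGroup_of_lieGroup (G := G) (𝓡 n) ∞
  refine ⟨by simp [hf.map_zero], (continuousAt_const.mul hf.continuousAt).mul continuousAt_const,
    ?_⟩
  have h1 : ContMDiffAt 𝓘(ℝ, EuclideanSpace ℝ (Fin n)) 𝓘(ℝ, EuclideanSpace ℝ (Fin n)) ∞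
      (fun a => chartOne n G (g * (chartOne n G).symm a * g⁻¹)) (chartOne n G 1) := by
    refine ContMDiffAt.comp (chartOne n G 1) (contMDiffAt_chartOne ?_)
      ((contMDiff_conj g).contMDiffAt.comp _ (contMDiffAt_chartOne_symm chartOne_mem_target))
    simp only [chartOne_symm_one]
    simp
  have h2 := (contMDiffAt_iff_contDiffAt.1 h1).hasStrictFDerivAt (by simp)
  rw [← lieAdL_eq_fderiv, ← hf.map_zero] at h2
  have h3 := HasStrictFDerivAt.comp (f := fun w => chartOne n G (f w)) (0 : W) h2
    hf.hasStrictFDerivAt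
  refine h3.congr_of_eventuallyEq ?_
  filter_upwards [hf.eventually_mem_source] with w hw
  rw [(chartOne n G).left_inv hw]

/-- `ad X` as a continuous linear map. -/
def lieadL (X : GroupLieAlgebra (𝓡 n) G) :
    EuclideanSpace ℝ (Fin n) →L[ℝ] EuclideanSpace ℝ (Fin n) :=
  (fderiv ℝ (fderiv ℝ (chartMul n G)) (chartOne n G 1, chartOne n G 1) (X, -X)).comp
    (ContinuousLinearMap.inl ℝ _ _) +
  (fderiv ℝ (fderiv ℝ (chartMul n G)) (chartOne n G 1, chartOne n G 1) (X, 0)).comp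
    (ContinuousLinearMap.inr ℝ _ _)

/-- The expression `lieadL` is what the product rule produces in `hasDerivAt_lieAdL_zero`. Symmetry
of the second derivative and the vanishing of its pure part turn it into the antisymmetrized mixed
derivative of `bracket_eq_chartMul`. -/
theorem lieadL_apply (X Y : GroupLieAlgebra (𝓡 n) G) :
    @Eq (EuclideanSpace ℝ (Fin n)) (lieadL X Y) (⁅X, Y⁆ : GroupLieAlgebra (𝓡 n) G) := by
  refine Eq.trans ?_ (bracket_eq_chartMul X Y).symm
  have hsym : IsSymmSndFDerivAt ℝ (chartMul n G) (chartOne n G 1, chartOne n G 1) :=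
    ((contDiffAt_chartMul_left chartOne_mem_target).of_le two_le_infty).isSymmSndFDerivAt
      (by simp)
  have key : ∀ X Y : EuclideanSpace ℝ (Fin n),
      fderiv ℝ (fderiv ℝ (chartMul n G)) (chartOne n G 1, chartOne n G 1) (X, -X) (Y, 0) +
      fderiv ℝ (fderiv ℝ (chartMul n G)) (chartOne n G 1, chartOne n G 1) (X, 0) (0, Y) =
      fderiv ℝ (fderiv ℝ (chartMul n G)) (chartOne n G 1, chartOne n G 1) (X, 0) (0, Y) -
      fderiv ℝ (fderiv ℝ (chartMul n G)) (chartOne n G 1, chartOne n G 1) (Y, 0) (0, X) := by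
    intro X Y
    have h : ((X, -X) : EuclideanSpace ℝ (Fin n) × EuclideanSpace ℝ (Fin n)) =
      (X, 0) - (0, X) := by simp
    rw [h, map_sub, sub_apply, fderiv_fderiv_chartMul_inl, hsym (0, X) (Y, 0)]
    abel
  exact key X Y

variable [T2Space G]

/-- Conjugation maps one-parameter groups to one-parameter groups and acts on their derivatives by
Ad. -/
theorem lieExp_conj (g : G) (Y : GroupLieAlgebra (𝓡 n) G) (t : ℝ) :
    g * lieExp (t • Y) * g⁻¹ = lieExp (t • (show GroupLieAlgebra (𝓡 n) G from lieAdL g Y)) := by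
  have h1 := (hasDerivOne_lieExp Y).conj g
  have h2 : (lieAdL g).comp (ContinuousLinearMap.toSpanSingleton ℝ
      (show EuclideanSpace ℝ (Fin n) from Y)) =
      ContinuousLinearMap.toSpanSingleton ℝ (lieAdL g Y) :=
    ContinuousLinearMap.comp_toSpanSingleton _ _
  exact lieExp_eq_of_hasDerivOne (c := fun t : ℝ => g * lieExp (t • Y) * g⁻¹)
    (fun s t => by simp [lieExp_add_smul, mul_assoc]) (Eq.mp (congrArg (HasDerivOne _) h2) h1) t

theorem lieExp_conj' (g : G) (Y : GroupLieAlgebra (𝓡 n) G) :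
    g * lieExp Y * g⁻¹ = lieExp (show GroupLieAlgebra (𝓡 n) G from lieAdL g Y) := by
  have := lieExp_conj g Y 1
  rwa [one_smul, one_smul] at this

theorem lieExp_zero_smul (X : GroupLieAlgebra (𝓡 n) G) : (lieExp ((0 : ℝ) • X) : G) = 1 := by
  rw [zero_smul, lieExp_zero]

/-- In the chart, Ad(exp tX) is a composition of two partial derivatives of the multiplication,
taken along curves through the identity; both factors are the identity at t = 0, so the product rule
yields the sum of their derivatives. -/
theorem hasDerivAt_lieAdL_zero (X : GroupLieAlgebra (𝓡 n) G) :
    HasDerivAt (fun t : ℝ => lieAdL (lieExp (t • X) : G)) (lieadL X) 0 := by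
  have hX := hasDerivOne_lieExp (G := G) X
  have hcont := continuous_lieExp_smul (G := G) X
  have htop := topologicalGroup_of_lieGroup (G := G) (𝓡 n) ∞
  set u : ℝ → EuclideanSpace ℝ (Fin n) := fun t => chartOne n G (lieExp (t • X)) with hu
  have hu0 : u 0 = chartOne n G 1 := by simp only [hu, lieExp_zero_smul]
  have hu1 : HasDerivAt u X 0 := by
    exact hX.hasStrictFDerivAt.hasFDerivAt.hasDerivAt.congr_deriv
      (one_smul ℝ (show EuclideanSpace ℝ (Fin n) from X))
  have hu2 : HasDerivAt (fun t => u (-t)) (-X : EuclideanSpace ℝ (Fin n)) 0 := by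
    have h : HasDerivAt u X (-0) := by rwa [neg_zero]
    exact (h.scomp 0 (hasDerivAt_neg 0)).congr_deriv
      (neg_one_smul ℝ (show EuclideanSpace ℝ (Fin n) from X))
  have hneg : ∀ t : ℝ, (lieExp (-t • X) : G) = (lieExp (t • X))⁻¹ := fun t => by
    rw [neg_smul, lieExp_neg]
  have hsrc := hX.eventually_mem_source
  have hsrc2 : ∀ᶠ t : ℝ in 𝓝 0, (lieExp (-t • X) : G) ∈ (chartOne n G).source := by
    have : Filter.Tendsto (fun t : ℝ => -t) (𝓝 0) (𝓝 0) := by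
      simpa using (continuous_neg (G := ℝ)).tendsto 0
    exact this.eventually hsrc
  set D := fderiv ℝ (chartMul n G) with hD
  have hmul0 : ∀ᶠ q in 𝓝 ((chartOne n G 1, chartOne n G 1) :
      EuclideanSpace ℝ (Fin n) × EuclideanSpace ℝ (Fin n)),
      DifferentiableAt ℝ (chartMul n G) q :=
    (((contDiffAt_chartMul_left (n := n) (G := G) chartOne_mem_target).of_le
      two_le_infty).eventually (by simp)).mono fun q hq => hq.differentiableAt (by simp)
  have hpair : ContinuousAt (fun t => (u t, u (-t))) 0 :=
    hu1.continuousAt.prodMk hu2.continuousAt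
  -- Conjugation is a left multiplication by exp(tX) followed by a right multiplication by exp(-tX);
  -- the chain rule gives one factor for each.
  have hev : (fun t : ℝ => lieAdL (lieExp (t • X) : G)) =ᶠ[𝓝 0]
      fun t => ((D (u t, u (-t))).comp (ContinuousLinearMap.inl ℝ _ _)).comp
        ((D (u t, chartOne n G 1)).comp (ContinuousLinearMap.inr ℝ _ _)) := by
    have hdiff : ∀ᶠ t in 𝓝 (0 : ℝ), DifferentiableAt ℝ (chartMul n G) (u t, u (-t)) := by
      refine hpair.eventually ?_
      simpa [hu0] using hmul0
    filter_upwards [hsrc, hsrc2, hdiff] with t h1 h2 h3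
    rw [lieAdL_eq_fderiv]
    have hut : u t ∈ (chartOne n G).target := (chartOne n G).map_source h1
    have hd1 : HasFDerivAt (fun a => chartMul n G (u t, a))
        ((D (u t, chartOne n G 1)).comp (ContinuousLinearMap.inr ℝ _ _)) (chartOne n G 1) :=
      HasFDerivAt.comp (f := fun a => (u t, a)) (chartOne n G 1)
        ((contDiffAt_chartMul_left hut).differentiableAt (by simp)).hasFDerivAt
        (hasFDerivAt_prodMk_right _ _)
    have hval : chartMul n G (u t, chartOne n G 1) = u t := by
      simp only [chartMul, chartOne_symm_one, mul_one]
      exact (chartOne n G).right_inv hut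
    have hd2 : HasFDerivAt (fun b => chartMul n G (b, u (-t)))
        ((D (u t, u (-t))).comp (ContinuousLinearMap.inl ℝ _ _))
        (chartMul n G (u t, chartOne n G 1)) := by
      rw [hval]
      exact HasFDerivAt.comp (f := fun b => (b, u (-t))) (u t) h3.hasFDerivAt
        (hasFDerivAt_prodMk_left _ _)
    have hd3 := hd2.comp (chartOne n G 1) hd1
    refine (hd3.congr_of_eventuallyEq ?_).fderiv
    have hcm : ContinuousAt (fun a => (lieExp (t • X) : G) * (chartOne n G).symm a)
        (chartOne n G 1) :=
      continuousAt_const.mul (contMDiffAt_chartOne_symm chartOne_mem_target).continuousAt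
    have hmem : ∀ᶠ a in 𝓝 (chartOne n G 1),
        (lieExp (t • X) : G) * (chartOne n G).symm a ∈ (chartOne n G).source := by
      refine hcm.eventually_mem ((isOpen_extChartAt_source (I := 𝓡 n) (1 : G)).mem_nhds ?_)
      rw [chartOne_symm_one, mul_one]
      exact h1
    filter_upwards [hmem] with a ha
    simp only [Function.comp_apply, chartMul, hu]
    rw [(chartOne n G).left_inv h1, (chartOne n G).left_inv ha, (chartOne n G).left_inv h2, hneg]
  refine HasDerivAt.congr_of_eventuallyEq ?_ hev
  have hD0 : HasFDerivAt D (fderiv ℝ D (chartOne n G 1, chartOne n G 1))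
      (chartOne n G 1, chartOne n G 1) := differentiableAt_fderiv_chartMul.hasFDerivAt
  have hA : HasDerivAt (fun t => D (u t, u (-t)))
      (fderiv ℝ D (chartOne n G 1, chartOne n G 1) (X, -X)) 0 := by
    refine HasFDerivAt.comp_hasDerivAt (f := fun t => (u t, u (-t))) (0 : ℝ) ?_ (hu1.prodMk hu2)
    simpa [hu0] using hD0
  have hB : HasDerivAt (fun t => D (u t, chartOne n G 1))
      (fderiv ℝ D (chartOne n G 1, chartOne n G 1) (X, 0)) 0 := by
    refine HasFDerivAt.comp_hasDerivAt (f := fun t => (u t, chartOne n G 1)) (0 : ℝ) ?_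
      (hu1.prodMk (hasDerivAt_const _ _))
    simpa [hu0] using hD0
  have hA' := hA.clm_comp (hasDerivAt_const (0 : ℝ) (ContinuousLinearMap.inl ℝ
    (EuclideanSpace ℝ (Fin n)) (EuclideanSpace ℝ (Fin n))))
  have hB' := hB.clm_comp (hasDerivAt_const (0 : ℝ) (ContinuousLinearMap.inr ℝ
    (EuclideanSpace ℝ (Fin n)) (EuclideanSpace ℝ (Fin n))))
  refine (hA'.clm_comp hB').congr_deriv ?_
  refine ContinuousLinearMap.ext fun v => ?_
  have k1 : ∀ Z, D (chartOne n G 1, chartOne n G 1) (Z, 0) = Z :=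
    fderiv_chartMul_inl chartOne_mem_target
  have k2 : ∀ Z, D (chartOne n G 1, chartOne n G 1) (0, Z) = Z := fderiv_chartMul_inr
  simp only [hu0, neg_zero, ContinuousLinearMap.comp_zero, add_zero, add_apply,
    ContinuousLinearMap.comp_apply, ContinuousLinearMap.inl_apply, ContinuousLinearMap.inr_apply,
    k1, k2, lieadL]
  rfl

/-- As Ad is multiplicative, its derivative at time t follows from the one at time 0. -/
theorem hasDerivAt_lieAdL (X : GroupLieAlgebra (𝓡 n) G) (t : ℝ) :
    HasDerivAt (fun t : ℝ => lieAdL (n := n) (lieExp (t • X) : G))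
      ((lieAdL (n := n) (lieExp (t • X) : G)).comp (lieadL X)) t := by
  have e : (fun s : ℝ => lieAdL (n := n) (lieExp (s • X) : G)) =
      fun s => (lieAdL (n := n) (lieExp (t • X) : G)).comp (lieAdL (n := n) (lieExp ((s - t) • X) : G)) := by
    funext s
    rw [← lieAdL_mul, ← lieExp_add_smul]
    simp
  rw [e]
  have h1 : HasDerivAt (fun s : ℝ => lieAdL (n := n) (lieExp ((s - t) • X) : G)) (lieadL X) t :=
    HasDerivAt.comp_sub_const (f := fun s : ℝ => lieAdL (n := n) (lieExp (s • X) : G)) t t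
      (by simpa using hasDerivAt_lieAdL_zero X)
  have h2 := (hasDerivAt_const t (lieAdL (n := n) (lieExp (t • X) : G))).clm_comp h1
  simpa using h2

end Adjoint

/-! ### The linear flow e^{tA} and its integral -/

section Flow

variable {V : Type*} [NormedAddCommGroup V] [NormedSpace ℝ V]

/-- The one-parameter group `e^{tA}`. -/
def flow (A : V →L[ℝ] V) (t : ℝ) : V →L[ℝ] V := NormedSpace.exp (t • A)

theorem flow_zero (A : V →L[ℝ] V) : flow A 0 = 1 := by simp [flow]

theorem flow_smul (A : V →L[ℝ] V) (c t : ℝ) : flow (c • A) t = flow A (t * c) := by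
  simp [flow, smul_smul]

/-- The integral `∫₀ˢ e^{uA} du`. -/
def flowInt (A : V →L[ℝ] V) (s : ℝ) : V →L[ℝ] V := ∫ u in (0 : ℝ)..s, flow A u

theorem flowInt_zero (A : V →L[ℝ] V) : flowInt A 0 = 0 := by simp [flowInt]

variable [CompleteSpace V]

theorem flow_add (A : V →L[ℝ] V) (s t : ℝ) : flow A (s + t) = flow A s * flow A t := by
  unfold flow
  let _ : NormedAlgebra ℚ (V →L[ℝ] V) := NormedAlgebra.restrictScalars ℚ ℝ (V →L[ℝ] V)
  rw [add_smul, NormedSpace.exp_add_of_commute]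
  exact (Commute.refl A).smul_left s |>.smul_right t

theorem flow_add_apply (A : V →L[ℝ] V) (s t : ℝ) (x : V) :
    flow A (s + t) x = flow A s (flow A t x) := by rw [flow_add]; rfl

theorem flow_neg_apply (A : V →L[ℝ] V) (t : ℝ) (x : V) : flow A (-t) (flow A t x) = x := by
  rw [← flow_add_apply]; simp [flow_zero]

theorem flow_apply_neg (A : V →L[ℝ] V) (t : ℝ) (x : V) : flow A t (flow A (-t) x) = x := by
  rw [← flow_add_apply]; simp [flow_zero]

theorem hasDerivAt_flow (A : V →L[ℝ] V) (t : ℝ) : HasDerivAt (flow A) (flow A t * A) t :=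
  hasDerivAt_exp_smul_const A t

theorem hasDerivAt_flow' (A : V →L[ℝ] V) (t : ℝ) : HasDerivAt (flow A) (A * flow A t) t :=
  hasDerivAt_exp_smul_const' A t

theorem continuous_flow (A : V →L[ℝ] V) : Continuous (flow A) :=
  continuous_iff_continuousAt.2 fun t => (hasDerivAt_flow A t).continuousAt

theorem flow_eq_self (A : V →L[ℝ] V) {x : V} (hx : A x = 0) (t : ℝ) : flow A t x = x := by
  have hd : ∀ t, HasDerivAt (fun t => flow A t x) 0 t := fun t => by
    have := (hasDerivAt_flow A t).clm_apply (hasDerivAt_const t x)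
    simpa [hx] using this
  have := is_const_of_deriv_eq_zero (fun t => (hd t).differentiableAt) (fun t => (hd t).deriv) t 0
  simpa [flow_zero] using this

theorem apply_flow_eq {W : Type*} [NormedAddCommGroup W] [NormedSpace ℝ W]
    (A : V →L[ℝ] V) {l : V →L[ℝ] W} (hl : ∀ x, l (A x) = 0)
    (t : ℝ) (x : V) : l (flow A t x) = l x := by
  have hd : ∀ t, HasDerivAt (fun t => l (flow A t x)) 0 t := fun t => by
    have := l.hasFDerivAt.comp_hasDerivAt t
      ((hasDerivAt_flow' A t).clm_apply (hasDerivAt_const t x))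
    simpa [hl, Function.comp_def] using this
  have := is_const_of_deriv_eq_zero (fun t => (hd t).differentiableAt) (fun t => (hd t).deriv) t 0
  simpa [flow_zero] using this

theorem hasStrictDerivAt_flowInt (A : V →L[ℝ] V) (s : ℝ) :
    HasStrictDerivAt (flowInt A) (flow A s) s :=
  intervalIntegral.integral_hasStrictDerivAt_right ((continuous_flow A).intervalIntegrable _ _)
    ((continuous_flow A).stronglyMeasurableAtFilter _ _) (continuous_flow A).continuousAt

/-- Integrate the derivative A e^{uA} of the flow from 0 to s. -/
theorem mul_flowInt (A : V →L[ℝ] V) (s : ℝ) : A * flowInt A s = flow A s - 1 := by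
  have h := intervalIntegral.integral_eq_sub_of_hasDerivAt (a := 0) (b := s)
    (fun t _ => hasDerivAt_flow' A t)
    ((continuous_const.mul (continuous_flow A)).intervalIntegrable _ _)
  rw [flow_zero] at h
  rw [← h, flowInt]
  exact ((ContinuousLinearMap.mul ℝ (V →L[ℝ] V) A).intervalIntegral_comp_comm
    ((continuous_flow A).intervalIntegrable _ _)).symm

theorem flowInt_mul (A : V →L[ℝ] V) (s : ℝ) : flowInt A s * A = flow A s - 1 := by
  have h := intervalIntegral.integral_eq_sub_of_hasDerivAt (a := 0) (b := s)
    (fun t _ => hasDerivAt_flow A t)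
    (((continuous_flow A).mul continuous_const).intervalIntegrable _ _)
  rw [flow_zero] at h
  rw [← h, flowInt]
  exact (((ContinuousLinearMap.mul ℝ (V →L[ℝ] V)).flip A).intervalIntegral_comp_comm
    ((continuous_flow A).intervalIntegrable _ _)).symm

theorem apply_flowInt {W : Type*} [NormedAddCommGroup W] [NormedSpace ℝ W] [CompleteSpace W]
    (A : V →L[ℝ] V) (l : V →L[ℝ] W) (s : ℝ) (x : V) :
    l (flowInt A s x) = ∫ u in (0 : ℝ)..s, l (flow A u x) := by
  have h := (l.comp (ContinuousLinearMap.apply ℝ V x)).intervalIntegral_comp_comm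
    ((continuous_flow A).intervalIntegrable (μ := volume) 0 s)
  exact h.symm

theorem flowInt_eq_smul (A : V →L[ℝ] V) {x : V} (hx : A x = 0) (s : ℝ) :
    flowInt A s x = s • x := by
  have := apply_flowInt A (ContinuousLinearMap.id ℝ V) s x
  simpa [flow_eq_self A hx] using this

theorem apply_flowInt_eq (A : V →L[ℝ] V) {l : V →L[ℝ] ℝ} (hl : ∀ x, l (A x) = 0)
    (s : ℝ) (x : V) : l (flowInt A s x) = s * l x := by
  rw [apply_flowInt]
  simp [apply_flow_eq A hl]

/-- Cut the integral at t and shift the upper piece by t. This cocycle identity is what makes the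
curve in `Adapted.lieExp_smul_add` a one-parameter group. -/
theorem flowInt_add (A : V →L[ℝ] V) (s t : ℝ) :
    flowInt A (s + t) = flow A t * flowInt A s + flowInt A t := by
  have h1 : flow A t * flowInt A s = ∫ u in t..(s + t), flow A u := by
    have h := (ContinuousLinearMap.mul ℝ (V →L[ℝ] V) (flow A t)).intervalIntegral_comp_comm
      ((continuous_flow A).intervalIntegrable (μ := volume) 0 s)
    have h2 := intervalIntegral.integral_comp_add_left (a := 0) (b := s) (fun u => flow A u) t
    simp only [flow_add, add_zero] at h2
    rw [add_comm s t, ← h2]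
    exact h.symm
  rw [h1, add_comm (∫ u in t..(s + t), flow A u)]
  unfold flowInt
  exact (intervalIntegral.integral_add_adjacent_intervals
    ((continuous_flow A).intervalIntegrable (μ := volume) _ _)
    ((continuous_flow A).intervalIntegrable _ _)).symm

/-- For v ≠ 0 in the kernel, the last nonzero vector A^r v is killed by A, so the integral acts on
it as the scalar s; since the integral commutes with A, it also kills that vector. -/
theorem flowInt_injective {A : V →L[ℝ] V} (hA : IsNilpotent A) {s : ℝ} (hs : s ≠ 0) :
    Function.Injective (flowInt A s) := by
  rw [injective_iff_map_eq_zero]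
  intro v hv
  by_contra hv0
  have hex : ∃ k, (A ^ k) v = 0 := by
    obtain ⟨k, hk⟩ := hA
    exact ⟨k, by simp [hk]⟩
  classical
  set k := Nat.find hex with hk
  have hk1 : (A ^ k) v = 0 := Nat.find_spec hex
  have hk0 : k ≠ 0 := by
    intro h
    rw [h] at hk1
    exact hv0 (by simpa using hk1)
  obtain ⟨r, hr⟩ := Nat.exists_eq_succ_of_ne_zero hk0
  have hr0 : (A ^ r) v ≠ 0 := Nat.find_min hex (by omega)
  have hAr : A ((A ^ r) v) = 0 := by
    rw [hr, pow_succ'] at hk1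
    exact hk1
  have hcomm : Commute (flowInt A s) (A ^ r) := by
    refine Commute.pow_right ?_ r
    rw [commute_iff_eq, mul_flowInt, flowInt_mul]
  have h1 : flowInt A s ((A ^ r) v) = (A ^ r) (flowInt A s v) :=
    congrArg (fun T : V →L[ℝ] V => T v) hcomm.eq
  rw [hv, map_zero, flowInt_eq_smul A hAr] at h1
  exact (smul_ne_zero hs hr0) h1

/-- The integral of the flow is injective, hence onto; on x = ∫₀ˢ e^{uA} y du one has A x = e^{sA} y
- y, which `l` does not see. This is why the orbits of covectors that are not fixed are free. -/
theorem apply_eq_zero_of_apply_flow_eq [FiniteDimensional ℝ V] {A : V →L[ℝ] V}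
    (hA : IsNilpotent A) {l : V →L[ℝ] ℝ} {s : ℝ} (hs : s ≠ 0)
    (h : ∀ x, l (flow A s x) = l x) (x : V) : l (A x) = 0 := by
  obtain ⟨y, rfl⟩ := (LinearMap.injective_iff_surjective (f := (flowInt A s : V →ₗ[ℝ] V))).1
    (flowInt_injective hA hs) x
  have : A (flowInt A s y) = flow A s y - y := congrArg (fun T : V →L[ℝ] V => T y) (mul_flowInt A s)
  change l (A (flowInt A s y)) = 0
  rw [this, map_sub, h, sub_self]

/-- As e^{tA} - 1 is nilpotent, the characteristic polynomial of 1 - e^{tA} is a power of the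
variable; its value at 1 is the determinant of e^{tA}. -/
theorem det_flow [FiniteDimensional ℝ V] {A : V →L[ℝ] V} (hA : IsNilpotent A) (t : ℝ) :
    LinearMap.det (flow A t : V →ₗ[ℝ] V) = 1 := by
  have hN : IsNilpotent (flow A t - 1) := by
    rw [← mul_flowInt]
    refine Commute.isNilpotent_mul_right ?_ hA
    rw [commute_iff_eq, mul_flowInt, flowInt_mul]
  obtain ⟨k, hk⟩ := hN
  have hN' : IsNilpotent (1 - (flow A t : V →ₗ[ℝ] V)) := by
    rw [← neg_sub]
    refine IsNilpotent.neg ⟨k, ?_⟩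
    have h2 := congrArg (fun T : V →L[ℝ] V => (T : V →ₗ[ℝ] V)) hk
    simpa using h2
  have h1 := LinearMap.eval_charpoly (1 - (flow A t : V →ₗ[ℝ] V)) 1
  obtain ⟨k, hk⟩ := hN'
  rw [(LinearMap.charpoly_eq_X_pow_iff _).2 fun m => ⟨k, by rw [hk]; rfl⟩] at h1
  simpa using h1.symm

end Flow

/-! ### The adjoint action of exponentials, and commuting exponentials -/

section Commute

variable {n : ℕ} {G : Type*} [TopologicalSpace G] [ChartedSpace (EuclideanSpace ℝ (Fin n)) G]
  [Group G] [LieGroup (𝓡 n) ∞ G] [T2Space G]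

/-- If `ad X` acts on the image of `J` as `A`, then `Ad (exp tX)` acts as `exp tA`. -/
theorem lieAdL_flow {V : Type*} [NormedAddCommGroup V] [NormedSpace ℝ V] [CompleteSpace V]
    {X : GroupLieAlgebra (𝓡 n) G} {J : V →L[ℝ] EuclideanSpace ℝ (Fin n)} {A : V →L[ℝ] V}
    (hA : ∀ x, lieadL X (J x) = J (A x)) (t : ℝ) (x : V) :
    lieAdL (n := n) (lieExp (t • X) : G) (J x) = J (flow A t x) := by
  -- The curve t ↦ Ad(exp tX) J(e^{-tA} x) has derivative zero, because ad X on the image of J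
  -- cancels against A.
  have key : ∀ t x, lieAdL (n := n) (lieExp (t • X) : G) (J (flow A (-t) x)) = J x := by
    intro t x
    have hd : ∀ s : ℝ, HasDerivAt
        (fun s => lieAdL (n := n) (lieExp (s • X) : G) (J (flow A (-s) x))) 0 s := by
      intro s
      have h1 : HasDerivAt (fun s => flow A (-s) x) (-(A (flow A (-s) x))) s := by
        have h := ((hasDerivAt_flow' A (-s)).scomp s (hasDerivAt_neg s)).clm_apply
          (hasDerivAt_const s x)
        simpa using h
      have h2 := (J.hasFDerivAt (x := flow A (-s) x)).comp_hasDerivAt s h1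
      have h3 := (hasDerivAt_lieAdL (G := G) X s).clm_apply h2
      refine h3.congr_deriv ?_
      simp [hA]
    have := is_const_of_deriv_eq_zero (fun s => (hd s).differentiableAt)
      (fun s => (hd s).deriv) t 0
    rw [this, lieExp_zero_smul, lieAdL_one, neg_zero, flow_zero]
    simp
  have := key t (flow A t x)
  rwa [flow_neg_apply] at this

/-- Apply `lieAdL_flow` to the line through `Y` with A = 0: Ad(exp sX) fixes `Y`. -/
theorem lieExp_commute {X Y : GroupLieAlgebra (𝓡 n) G} (h : ⁅X, Y⁆ = 0) (s t : ℝ) :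
    (lieExp (s • X) * lieExp (t • Y) : G) = lieExp (t • Y) * lieExp (s • X) := by
  have h1 := lieAdL_flow (X := X)
    (J := ContinuousLinearMap.toSpanSingleton ℝ (show EuclideanSpace ℝ (Fin n) from Y))
    (A := (0 : ℝ →L[ℝ] ℝ)) (fun x => by
      rw [ContinuousLinearMap.toSpanSingleton_apply, map_smul, zero_apply, map_zero]
      refine .trans (congrArg (fun Z : EuclideanSpace ℝ (Fin n) => x • Z)
        ((lieadL_apply X Y).trans h)) (smul_zero (A := EuclideanSpace ℝ (Fin n)) x)) s 1
  rw [flow_eq_self (0 : ℝ →L[ℝ] ℝ) rfl, ContinuousLinearMap.toSpanSingleton_apply, one_smul] at h1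
  have h2 := lieExp_conj (lieExp (s • X) : G) Y t
  rw [h1] at h2
  exact mul_inv_eq_iff_eq_mul.1 h2

/-- Since the factors commute, t ↦ exp(tX) exp(tY) is a one-parameter group, and its derivative at 0
is X + Y. -/
theorem lieExp_add_of_bracket {X Y : GroupLieAlgebra (𝓡 n) G} (h : ⁅X, Y⁆ = 0) :
    (lieExp (X + Y) : G) = lieExp X * lieExp Y := by
  have h1 := (hasDerivOne_lieExp (G := G) X).mul (hasDerivOne_lieExp Y)
  have h2 : ContinuousLinearMap.toSpanSingleton ℝ (show EuclideanSpace ℝ (Fin n) from X) +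
      ContinuousLinearMap.toSpanSingleton ℝ (show EuclideanSpace ℝ (Fin n) from Y) =
      ContinuousLinearMap.toSpanSingleton ℝ (show EuclideanSpace ℝ (Fin n) from X + Y) := by
    exact (ContinuousLinearMap.toSpanSingleton_add ℝ (show EuclideanSpace ℝ (Fin n) from X)
      (show EuclideanSpace ℝ (Fin n) from Y)).symm
  have h3 := lieExp_eq_of_hasDerivOne (c := fun t : ℝ => (lieExp (t • X) * lieExp (t • Y) : G))
    (fun s t => by
      simp only [lieExp_add_smul]
      rw [mul_assoc, mul_assoc, ← mul_assoc (lieExp (t • X)), lieExp_commute h]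
      simp only [mul_assoc])
    (Eq.mp (congrArg (HasDerivOne _) h2) h1) 1
  simpa only [one_smul] using h3.symm

end Commute

/-! ### The semidirect product `ℝ ⋉ V` -/

section Semi

variable {V : Type*} [NormedAddCommGroup V] [NormedSpace ℝ V]

/-- The group `ℝ × V` with the product `(s, y) (t, x) = (s + t, exp(-tA) y + x)`. -/
def Semi (_ : V →L[ℝ] V) : Type _ := ℝ × V

instance (A : V →L[ℝ] V) : TopologicalSpace (Semi A) := inferInstanceAs (TopologicalSpace (ℝ × V))

variable [CompleteSpace V]

instance (A : V →L[ℝ] V) : Group (Semi A) where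
  mul a b := (a.1 + b.1, flow A (-b.1) a.2 + b.2)
  one := (0, 0)
  inv a := (-a.1, -flow A a.1 a.2)
  mul_assoc a b c := by
    refine Prod.ext (add_assoc a.1 b.1 c.1) ?_
    change flow A (-c.1) (flow A (-b.1) a.2 + b.2) + c.2 =
      flow A (-(b.1 + c.1)) a.2 + (flow A (-c.1) b.2 + c.2)
    rw [map_add, ← flow_add_apply, neg_add_rev, add_assoc]
  one_mul a := by
    refine Prod.ext (zero_add a.1) ?_
    change flow A (-a.1) 0 + a.2 = a.2
    rw [map_zero, zero_add]
  mul_one a := by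
    refine Prod.ext (add_zero a.1) ?_
    change flow A (-0) a.2 + 0 = a.2
    rw [neg_zero, flow_zero, add_zero]; rfl
  inv_mul_cancel a := by
    refine Prod.ext (neg_add_cancel a.1) ?_
    change flow A (-a.1) (-flow A a.1 a.2) + a.2 = 0
    rw [map_neg, flow_neg_apply, neg_add_cancel]

instance (A : V →L[ℝ] V) : IsTopologicalGroup (Semi A) where
  continuous_mul := by
    have h : Continuous fun q : (ℝ × V) × (ℝ × V) =>
        (q.1.1 + q.2.1, flow A (-q.2.1) q.1.2 + q.2.2) := by
      have := continuous_flow A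
      fun_prop
    exact h
  continuous_inv := by
    have h : Continuous fun q : ℝ × V => (-q.1, -flow A q.1 q.2) := by
      have := continuous_flow A
      fun_prop
    exact h

end Semi

/-! ### The coordinates of a group with an abelian ideal of codimension one -/

section Coord

variable {d : ℕ} {G : Type*} [TopologicalSpace G] [ChartedSpace (EuclideanSpace ℝ (Fin (d + 1))) G]
  [Group G]

/-- A vector `X`, and the image of `J`, which is an abelian ideal of codimension one. -/
structure Adapted (X : GroupLieAlgebra (𝓡 (d + 1)) G)
    (J : (Fin d → ℝ) →L[ℝ] EuclideanSpace ℝ (Fin (d + 1)))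
    (A : (Fin d → ℝ) →L[ℝ] (Fin d → ℝ)) : Prop where
  bracket : ∀ x, @Eq (EuclideanSpace ℝ (Fin (d + 1)))
    (⁅X, (show GroupLieAlgebra (𝓡 (d + 1)) G from J x)⁆ : GroupLieAlgebra (𝓡 (d + 1)) G) (J (A x))
  comm : ∀ x y, ⁅(show GroupLieAlgebra (𝓡 (d + 1)) G from J x),
    (show GroupLieAlgebra (𝓡 (d + 1)) G from J y)⁆ = 0
  bijective : Function.Bijective ((ContinuousLinearMap.toSpanSingleton ℝ
    (show EuclideanSpace ℝ (Fin (d + 1)) from X)).coprod J)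

/-- `(t, x) ↦ exp(tX) exp(J x)`. -/
def expMap (X : GroupLieAlgebra (𝓡 (d + 1)) G)
    (J : (Fin d → ℝ) →L[ℝ] EuclideanSpace ℝ (Fin (d + 1))) (a : ℝ × (Fin d → ℝ)) : G :=
  lieExp (a.1 • X) * lieExp (show GroupLieAlgebra (𝓡 (d + 1)) G from J a.2)

variable [LieGroup (𝓡 (d + 1)) ∞ G] [T2Space G] {X : GroupLieAlgebra (𝓡 (d + 1)) G}
  {J : (Fin d → ℝ) →L[ℝ] EuclideanSpace ℝ (Fin (d + 1))} {A : (Fin d → ℝ) →L[ℝ] (Fin d → ℝ)}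

namespace Adapted

theorem lieAdL_exp (h : Adapted X J A) (t : ℝ) (x : Fin d → ℝ) :
    lieAdL (n := d + 1) (lieExp (t • X) : G) (J x) = J (flow A t x) :=
  lieAdL_flow (X := X) (fun x => (lieadL_apply _ _).trans (h.bracket x)) t x

theorem lieAdL_expJ (h : Adapted X J A) (y x : Fin d → ℝ) :
    lieAdL (n := d + 1) (lieExp (show GroupLieAlgebra (𝓡 (d + 1)) G from J y) : G) (J x) =
      J x := by
  have := lieAdL_flow (X := (show GroupLieAlgebra (𝓡 (d + 1)) G from J y)) (J := J)
    (A := (0 : (Fin d → ℝ) →L[ℝ] (Fin d → ℝ)))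
    (fun x => by
      rw [zero_apply, map_zero]
      exact (lieadL_apply (show GroupLieAlgebra (𝓡 (d + 1)) G from J y) _).trans (h.comm y x)) 1 x
  rwa [flow_eq_self (0 : (Fin d → ℝ) →L[ℝ] (Fin d → ℝ)) rfl, one_smul] at this

theorem lieExp_add (h : Adapted X J A) (x y : Fin d → ℝ) :
    (lieExp (show GroupLieAlgebra (𝓡 (d + 1)) G from J (x + y)) : G) =
      lieExp (show GroupLieAlgebra (𝓡 (d + 1)) G from J x) *
        lieExp (show GroupLieAlgebra (𝓡 (d + 1)) G from J y) := by
  rw [map_add]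
  exact lieExp_add_of_bracket (h.comm x y)

theorem lieExp_J_zero :
    (lieExp (show GroupLieAlgebra (𝓡 (d + 1)) G from J 0) : G) = 1 := by
  rw [map_zero]; exact lieExp_zero

theorem list_prod_lieExp (h : Adapted X J A) : ∀ {k : ℕ} (y : Fin k → Fin d → ℝ),
    (List.ofFn fun i => (lieExp (show GroupLieAlgebra (𝓡 (d + 1)) G from J (y i)) : G)).prod =
      lieExp (show GroupLieAlgebra (𝓡 (d + 1)) G from J (∑ i, y i))
  | 0, y => by
      rw [List.ofFn_zero, List.prod_nil, Finset.univ_eq_empty, Finset.sum_empty]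
      exact lieExp_J_zero.symm
  | k + 1, y => by
      rw [List.ofFn_succ, List.prod_cons, Fin.sum_univ_succ, h.lieExp_add,
        h.list_prod_lieExp fun i => y i.succ]

/-- On the abelian ideal the exponential is the product of the exponentials along the coordinate
axes, each a one-parameter group with known derivative. This avoids proving that the exponential map
is smooth. -/
theorem hasDerivOne_lieExp_J (h : Adapted X J A) :
    HasDerivOne (fun x => (lieExp (show GroupLieAlgebra (𝓡 (d + 1)) G from J x) : G)) J := by
  have h1 : ∀ i : Fin d, HasDerivOne
      (fun x : Fin d → ℝ => (lieExp (x i • (show GroupLieAlgebra (𝓡 (d + 1)) G from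
        J (Pi.single i 1))) : G))
      ((ContinuousLinearMap.toSpanSingleton ℝ (J (Pi.single i 1))).comp
        (ContinuousLinearMap.proj i)) := fun i =>
    (hasDerivOne_lieExp _).comp (g := fun x : Fin d → ℝ => x i) rfl
      (ContinuousLinearMap.proj (R := ℝ) (φ := fun _ : Fin d => ℝ) i).hasStrictFDerivAt
  have h2 := HasDerivOne.list_prod h1
  have h3 : (fun x : Fin d → ℝ => (List.ofFn fun i => (lieExp (x i •
      (show GroupLieAlgebra (𝓡 (d + 1)) G from J (Pi.single i 1))) : G)).prod) =
      fun x => (lieExp (show GroupLieAlgebra (𝓡 (d + 1)) G from J x) : G) := by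
    funext x
    have h4 := h.list_prod_lieExp fun i => x i • (Pi.single i 1 : Fin d → ℝ)
    simp only [map_smul] at h4
    refine h4.trans ?_
    congr 2
    simp [← pi_eq_sum_univ' x]
  have h4 : ∑ i, (ContinuousLinearMap.toSpanSingleton ℝ (J (Pi.single i 1))).comp
      (ContinuousLinearMap.proj (R := ℝ) (φ := fun _ : Fin d => ℝ) i) = J := by
    refine ContinuousLinearMap.ext fun x => ?_
    have e : ∑ i, x i • (Pi.single i 1 : Fin d → ℝ) = x := by simp [← pi_eq_sum_univ' x]
    conv_rhs => rw [← e, map_sum]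
    rw [sum_apply]
    simp
  rw [h3, h4] at h2
  exact h2

/-- Moving exp(J y) to the right past exp(tX) conjugates it by exp(-tX), that is, replaces y by
e^{-tA} y; exponentials of the abelian ideal then add. -/
theorem expMap_mul (h : Adapted X J A) (a b : ℝ × (Fin d → ℝ)) :
    (expMap X J a * expMap X J b : G) = expMap X J (a.1 + b.1, flow A (-b.1) a.2 + b.2) := by
  have h1 : (lieExp (-b.1 • X) * lieExp (show GroupLieAlgebra (𝓡 (d + 1)) G from J a.2) *
      (lieExp (-b.1 • X))⁻¹ : G) =
      lieExp (show GroupLieAlgebra (𝓡 (d + 1)) G from J (flow A (-b.1) a.2)) := by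
    have := lieExp_conj' (lieExp (-b.1 • X) : G)
      (show GroupLieAlgebra (𝓡 (d + 1)) G from J a.2)
    rw [h.lieAdL_exp] at this
    exact this
  rw [neg_smul, lieExp_neg, inv_inv] at h1
  unfold expMap
  rw [h.lieExp_add, ← h1, lieExp_add_smul]
  group

theorem hasDerivOne_expMap (h : Adapted X J A) :
    HasDerivOne (expMap X J : _ → G) ((ContinuousLinearMap.toSpanSingleton ℝ
      (show EuclideanSpace ℝ (Fin (d + 1)) from X)).coprod J) := by
  have h1 := (hasDerivOne_lieExp (G := G) X).comp (g := Prod.fst) (W' := ℝ × (Fin d → ℝ)) rfl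
    hasStrictFDerivAt_fst
  have h2 := h.hasDerivOne_lieExp_J.comp (g := Prod.snd) (W' := ℝ × (Fin d → ℝ)) rfl
    hasStrictFDerivAt_snd
  exact h1.mul h2

/-- `expMap` as a homomorphism. -/
def hom (h : Adapted X J A) : Semi A →* G where
  toFun a := expMap X J a
  map_one' := h.hasDerivOne_expMap.map_zero
  map_mul' a b := (h.expMap_mul a b).symm

theorem continuous_hom (h : Adapted X J A) : Continuous h.hom := by
  have := topologicalGroup_of_lieGroup (G := G) (𝓡 (d + 1)) ∞
  exact continuous_of_continuousAt_one h.hom h.hasDerivOne_expMap.continuousAt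

/-- For a homomorphism, openness at the identity suffices; there the strict derivative is onto. -/
theorem isOpenMap_hom (h : Adapted X J A) : IsOpenMap h.hom := by
  have := topologicalGroup_of_lieGroup (G := G) (𝓡 (d + 1)) ∞
  refine IsTopologicalGroup.isOpenMap_iff_nhds_one.2 ?_
  have h1 := h.hasDerivOne_expMap
  have h2 := h1.hasStrictFDerivAt.map_nhds_eq_of_surj
    (LinearMap.range_eq_top.2 h.bijective.2)
  have h3 : Filter.map (chartOne (d + 1) G).symm (Filter.map
      (fun a => chartOne (d + 1) G (expMap X J a)) (𝓝 0)) = Filter.map (expMap X J) (𝓝 0) := by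
    rw [Filter.map_map]
    refine Filter.map_congr ?_
    filter_upwards [h1.eventually_mem_source] with a ha
    exact (chartOne (d + 1) G).left_inv ha
  rw [h2, h1.map_zero] at h3
  have h4 : Filter.map (chartOne (d + 1) G).symm (𝓝 (chartOne (d + 1) G 1)) = 𝓝 1 := by
    have := map_extChartAt_nhds_of_boundaryless (I := 𝓡 (d + 1)) (1 : G)
    unfold chartOne
    rw [← this, Filter.map_map]
    conv_rhs => rw [← Filter.map_id (f := 𝓝 (1 : G))]
    refine Filter.map_congr ?_
    filter_upwards [extChartAt_source_mem_nhds (I := 𝓡 (d + 1)) (1 : G)] with a ha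
    exact (extChartAt (𝓡 (d + 1)) (1 : G)).left_inv ha
  exact (h4.symm.trans h3).le

/-- The strict derivative at the identity is invertible, so the homomorphism is injective near it
and the kernel meets that neighbourhood only in the identity. -/
theorem isDiscrete_ker_hom (h : Adapted X J A) : IsDiscrete (h.hom.ker : Set (Semi A)) := by
  have h1 := h.hasDerivOne_expMap
  let L := ContinuousLinearEquiv.ofBijective _ (LinearMap.ker_eq_bot.2 h.bijective.1)
    (LinearMap.range_eq_top.2 h.bijective.2)
  have h2 : HasStrictFDerivAt (fun w => chartOne (d + 1) G (expMap X J w))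
      (L : ℝ × (Fin d → ℝ) →L[ℝ] EuclideanSpace ℝ (Fin (d + 1))) 0 := h1.hasStrictFDerivAt
  set P := h2.toOpenPartialHomeomorph with hP
  have hd : DiscreteTopology h.hom.ker := discreteTopology_of_isOpen_singleton_one ?_
  · exact ⟨hd⟩
  refine ⟨P.source, P.open_source, ?_⟩
  ext a
  constructor
  · intro ha
    have h3 : expMap X J (show ℝ × (Fin d → ℝ) from a.1) = (1 : G) := a.2
    refine Subtype.ext ?_
    refine P.injOn ha h2.mem_toOpenPartialHomeomorph_source ?_
    change chartOne (d + 1) G (expMap X J (show ℝ × (Fin d → ℝ) from a.1)) =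
      chartOne (d + 1) G (expMap X J 0)
    rw [h3, h1.map_zero]
  · rintro rfl
    exact h2.mem_toOpenPartialHomeomorph_source

/-- The image is an open subgroup, hence also closed, of a connected group. -/
theorem surjective_hom [ConnectedSpace G] (h : Adapted X J A) : Function.Surjective h.hom := by
  have := topologicalGroup_of_lieGroup (G := G) (𝓡 (d + 1)) ∞
  have h1 : IsOpen (h.hom.range : Set G) := h.isOpenMap_hom.isOpen_range
  have h2 : IsClopen (h.hom.range : Set G) := ⟨h.hom.range.isClosed_of_isOpen h1, h1⟩
  intro g
  have h3 := h2.eq_univ ⟨1, one_mem _⟩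
  have h4 : g ∈ (h.hom.range : Set G) := h3 ▸ Set.mem_univ g
  exact h4

/-- An open surjective homomorphism with discrete kernel is a covering. As G is simply connected,
the identity of G lifts to a section F; then F ∘ hom and the identity of the connected group `Semi
A` are lifts of the same map that agree at 1, so F is a left inverse. -/
theorem bijective_hom [SimplyConnectedSpace G] (h : Adapted X J A) :
    Function.Bijective h.hom := by
  refine ⟨?_, h.surjective_hom⟩
  have hq : Topology.IsQuotientMap h.hom :=
    h.isOpenMap_hom.isQuotientMap h.continuous_hom h.surjective_hom
  have hc := (hq.isQuotientCoveringMap_of_isDiscrete_ker_monoidHom h.isDiscrete_ker_hom).isCoveringMap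
  have := ChartedSpace.locallyPathConnectedSpace (EuclideanSpace ℝ (Fin (d + 1))) G
  obtain ⟨F, ⟨hF1, hF2⟩, -⟩ := hc.existsUnique_continuousMap_lifts (ContinuousMap.id G) 1 1
    (by simp)
  have : PreconnectedSpace (Semi A) := inferInstanceAs (PreconnectedSpace (ℝ × (Fin d → ℝ)))
  have h2 : F ∘ h.hom = id := by
    refine hc.eq_of_comp_eq (F.continuous.comp h.continuous_hom) continuous_id ?_ 1 (by simp [hF1])
    funext a
    exact congrFun hF2 (h.hom a)
  exact Function.LeftInverse.injective (congrFun h2)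

/-- `expMap` as a homeomorphism. -/
def homeo [SimplyConnectedSpace G] (h : Adapted X J A) : ℝ × (Fin d → ℝ) ≃ₜ G :=
  (Equiv.ofBijective h.hom h.bijective_hom).toHomeomorphOfContinuousOpen h.continuous_hom
    h.isOpenMap_hom

/-- The curve s ↦ (s t, ∫₀ˢ e^{-utA} y du) satisfies the product law by `flowInt_add`, and its
derivative at 0 is (t, y). The logarithm, and with it `chi`, becomes computable in coordinates. -/
theorem lieExp_smul_add (h : Adapted X J A) (t : ℝ) (y : Fin d → ℝ) :
    (lieExp (t • X + (show GroupLieAlgebra (𝓡 (d + 1)) G from J y)) : G) =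
      expMap X J (t, flowInt ((-t) • A) 1 y) := by
  set g : ℝ → ℝ × (Fin d → ℝ) := fun s => (s * t, flowInt ((-t) • A) s y) with hg
  have h1 : HasStrictFDerivAt g (ContinuousLinearMap.toSpanSingleton ℝ (t, y)) 0 := by
    have h2 : HasStrictDerivAt (fun s : ℝ => s * t) t 0 := by
      simpa using (hasStrictDerivAt_id (0 : ℝ)).mul_const t
    have h3 : HasStrictDerivAt (fun s : ℝ => flowInt ((-t) • A) s y) y 0 := by
      have := (hasStrictDerivAt_flowInt ((-t) • A) 0).clm_apply (hasStrictDerivAt_const 0 y)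
      simpa [flow_zero] using this
    exact (h2.prodMk h3).hasStrictFDerivAt
  have h2 := h.hasDerivOne_expMap.comp (g := g) (by simp [hg, flowInt_zero]) h1
  have h3 : ((ContinuousLinearMap.toSpanSingleton ℝ
      (show EuclideanSpace ℝ (Fin (d + 1)) from X)).coprod J).comp
      (ContinuousLinearMap.toSpanSingleton ℝ (t, y)) = ContinuousLinearMap.toSpanSingleton ℝ
      (show EuclideanSpace ℝ (Fin (d + 1)) from
        t • X + (show GroupLieAlgebra (𝓡 (d + 1)) G from J y)) := by
    rw [ContinuousLinearMap.comp_toSpanSingleton]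
    rfl
  rw [h3] at h2
  have h4 := lieExp_eq_of_hasDerivOne (c := fun s => (expMap X J (g s) : G)) (fun s s' => by
    rw [h.expMap_mul]
    congr 1
    refine Prod.ext (add_mul s s' t) ?_
    change flowInt ((-t) • A) (s + s') y = flow A (-(s' * t)) (flowInt ((-t) • A) s y) + _
    rw [flowInt_add, flow_smul, mul_neg]
    rfl) h2 1
  rw [one_smul] at h4
  rw [← h4]
  simp [hg]

end Adapted

end Coord

/-! ### Linear algebra of the basis: the abelian ideal, ad X_n and the derived ideal -/

namespace Data

variable {d : ℕ} {G : Type*} [TopologicalSpace G]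
    [ChartedSpace (EuclideanSpace ℝ (Fin (d + 1))) G] [Group G]
    [LieGroup (𝓡 (d + 1)) ∞ G] (D : Data d G)

/-- `x ↦ ∑ x_i X_i`, `i < d`. -/
def JG : (Fin d → ℝ) →ₗ[ℝ] GroupLieAlgebra (𝓡 (d + 1)) G :=
  Fintype.linearCombination ℝ fun i : Fin d => D.X i.castSucc

/-- `JG` as a continuous map. -/
def J : (Fin d → ℝ) →L[ℝ] EuclideanSpace ℝ (Fin (d + 1)) :=
  LinearMap.toContinuousLinearMap
    (show (Fin d → ℝ) →ₗ[ℝ] EuclideanSpace ℝ (Fin (d + 1)) from D.JG)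

theorem JG_apply (x : Fin d → ℝ) : D.JG x = ∑ i : Fin d, x i • D.X i.castSucc := rfl

theorem repr_JG (x : Fin d → ℝ) (i : Fin d) : D.X.repr (D.JG x) i.castSucc = x i := by
  rw [JG_apply, map_sum, Finsupp.finsetSum_apply]
  simp [Finsupp.single_apply]

theorem repr_JG_last (x : Fin d → ℝ) : D.X.repr (D.JG x) (Fin.last d) = 0 := by
  rw [JG_apply, map_sum, Finsupp.finsetSum_apply]
  simp [Fin.castSucc_ne_last]

theorem mem_m {Y : GroupLieAlgebra (𝓡 (d + 1)) G} : Y ∈ D.m ↔ ∃ x, D.JG x = Y := by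
  have h1 : D.X '' {i | (i : ℕ) < d} = Set.range fun i : Fin d => D.X i.castSucc := by
    ext Z
    constructor
    · rintro ⟨i, hi, rfl⟩
      exact ⟨⟨i, hi⟩, rfl⟩
    · rintro ⟨i, rfl⟩
      exact ⟨i.castSucc, i.2, rfl⟩
  have h2 : LinearMap.range D.JG = D.m.toSubmodule := by
    rw [← D.span_m, h1]
    exact Fintype.range_linearCombination ℝ _
  rw [← LieSubmodule.mem_toSubmodule, ← h2, LinearMap.mem_range]

/-- The matrix of `ad X_n` on the abelian ideal. -/
def A : (Fin d → ℝ) →L[ℝ] (Fin d → ℝ) :=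
  LinearMap.toContinuousLinearMap
    ((LinearMap.funLeft ℝ ℝ Fin.castSucc) ∘ₗ D.X.equivFun.toLinearMap ∘ₗ
      (LieAlgebra.ad ℝ _ (D.X (Fin.last d))) ∘ₗ D.JG)

theorem A_apply (x : Fin d → ℝ) (i : Fin d) :
    D.A x i = D.X.repr ⁅D.X (Fin.last d), D.JG x⁆ i.castSucc := rfl

theorem lie_JG (x : Fin d → ℝ) : ⁅D.X (Fin.last d), D.JG x⁆ = D.JG (D.A x) := by
  obtain ⟨y, hy⟩ := D.mem_m.1 (lie_mem_right ℝ _ D.m (D.X (Fin.last d)) (D.JG x)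
    (D.mem_m.2 ⟨x, rfl⟩))
  have : D.A x = y := by
    funext i
    rw [A_apply, ← hy, repr_JG]
  rw [this, hy]

theorem lie_JG' (x : Fin d → ℝ) : ⁅D.JG x, D.X (Fin.last d)⁆ = -D.JG (D.A x) := by
  rw [← lie_skew, lie_JG]

theorem lie_JG_JG (x y : Fin d → ℝ) : ⁅D.JG x, D.JG y⁆ = 0 := by
  have := D.abelian
  have h := trivial_lie_zero D.m D.m ⟨D.JG x, D.mem_m.2 ⟨x, rfl⟩⟩ ⟨D.JG y, D.mem_m.2 ⟨y, rfl⟩⟩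
  exact congrArg Subtype.val h

theorem eq_smul_add (Y : GroupLieAlgebra (𝓡 (d + 1)) G) :
    Y = D.X.repr Y (Fin.last d) • D.X (Fin.last d) + D.JG fun i => D.X.repr Y i.castSucc := by
  conv_lhs => rw [← D.X.sum_repr Y, Fin.sum_univ_castSucc]
  exact add_comm _ _

theorem adapted : Adapted (D.X (Fin.last d)) D.J D.A where
  bracket x := D.lie_JG x
  comm x y := D.lie_JG_JG x y
  bijective := by
    constructor
    · rw [injective_iff_map_eq_zero]
      rintro ⟨t, x⟩ h
      have h' : t • D.X (Fin.last d) + D.JG x = 0 := h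
      have h1 := congrArg (fun Y => D.X.repr Y (Fin.last d)) h'
      have h2 := fun i : Fin d => congrArg (fun Y => D.X.repr Y i.castSucc) h'
      simp only [map_add, map_smul, Finsupp.add_apply, Finsupp.smul_apply, repr_JG_last,
        repr_JG, Module.Basis.repr_self, Finsupp.single_eq_same, map_zero, Finsupp.zero_apply,
        smul_eq_mul, mul_one, add_zero] at h1 h2
      refine Prod.ext h1 (funext fun i => ?_)
      simpa [h1] using h2 i
    · intro Y
      exact ⟨(D.X.repr Y (Fin.last d), fun i => D.X.repr Y i.castSucc), (D.eq_smul_add Y).symm⟩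

theorem JG_pow (k : ℕ) (x : Fin d → ℝ) :
    D.JG ((D.A ^ k) x) = (LieAlgebra.ad ℝ _ (D.X (Fin.last d)) ^ k) (D.JG x) := by
  induction k with
  | zero => rfl
  | succ k ih =>
    rw [pow_succ', pow_succ', mul_apply_eq_comp, ← lie_JG, ih]
    rfl

theorem JG_injective : Function.Injective D.JG := by
  intro x y h
  funext i
  rw [← D.repr_JG x i, h, repr_JG]

/-- The injection `JG` intertwines `A` with ad X_n, which is nilpotent in a nilpotent Lie algebra.
-/
theorem isNilpotent_A (hnil : LieRing.IsNilpotent (GroupLieAlgebra (𝓡 (d + 1)) G)) :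
    IsNilpotent D.A := by
  obtain ⟨k, hk⟩ := LieModule.isNilpotent_toEnd_of_isNilpotent ℝ
    (GroupLieAlgebra (𝓡 (d + 1)) G) (GroupLieAlgebra (𝓡 (d + 1)) G) (D.X (Fin.last d))
  refine ⟨k, ContinuousLinearMap.ext fun x => D.JG_injective ?_⟩
  rw [JG_pow]
  have : LieAlgebra.ad ℝ _ (D.X (Fin.last d)) ^ k = 0 := hk
  rw [this]
  simp

/-- Because the ideal is abelian, a bracket of a X_n + u and b X_n + v is A(a v - b u); conversely A
x is the bracket of X_n with x. -/
theorem derived_eq {Y : GroupLieAlgebra (𝓡 (d + 1)) G} :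
    Y ∈ ⁅(⊤ : LieIdeal ℝ (GroupLieAlgebra (𝓡 (d + 1)) G)),
      (⊤ : LieIdeal ℝ (GroupLieAlgebra (𝓡 (d + 1)) G))⁆ ↔ ∃ x, D.JG (D.A x) = Y := by
  constructor
  · intro h
    have h1 : ⁅(⊤ : LieIdeal ℝ (GroupLieAlgebra (𝓡 (d + 1)) G)),
      (⊤ : LieIdeal ℝ (GroupLieAlgebra (𝓡 (d + 1)) G))⁆.toSubmodule ≤
        LinearMap.range (D.JG ∘ₗ D.A.toLinearMap) := by
      rw [LieSubmodule.lieIdeal_oper_eq_linear_span', Submodule.span_le]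
      rintro Z ⟨a, -, b, -, rfl⟩
      refine ⟨D.X.repr a (Fin.last d) • (fun i => D.X.repr b i.castSucc) -
        D.X.repr b (Fin.last d) • (fun i => D.X.repr a i.castSucc), ?_⟩
      conv_rhs => rw [D.eq_smul_add a, D.eq_smul_add b]
      simp only [add_lie, lie_add, smul_lie, lie_smul, lie_JG, lie_JG', lie_JG_JG, lie_self]
      simp only [LinearMap.comp_apply, map_sub, map_smul, ContinuousLinearMap.coe_coe]
      simp only [smul_zero]
      module
    obtain ⟨x, hx⟩ := h1 h
    exact ⟨x, hx⟩
  · rintro ⟨x, rfl⟩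
    rw [← lie_JG]
    exact LieSubmodule.lie_mem_lie (LieSubmodule.mem_top _) (LieSubmodule.mem_top _)

end Data

/-- An integral vector, as a real vector. -/
def intVec {d : ℕ} (k : Fin d → ℤ) : Fin d → ℝ := fun i => k i

/-- The pairing of an integral covector with a real vector. -/
def pair {d : ℕ} (k : Fin d → ℤ) : (Fin d → ℝ) →L[ℝ] ℝ :=
  ∑ i, (k i : ℝ) • ContinuousLinearMap.proj i

theorem pair_apply {d : ℕ} (k : Fin d → ℤ) (x : Fin d → ℝ) : pair k x = ∑ i, k i * x i := by
  simp [pair, sum_apply]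

theorem pair_single {d : ℕ} (k : Fin d → ℤ) (i : Fin d) : pair k (Pi.single i 1) = k i := by
  simp [pair_apply, Pi.single_apply]

theorem pair_injective {d : ℕ} {k k' : Fin d → ℤ} (h : ∀ x, pair k x = pair k' x) : k = k' := by
  funext i
  have := h (Pi.single i 1)
  rw [pair_single, pair_single] at this
  exact_mod_cast this

/-- The integers are the values of the functional on the standard basis vectors. -/
theorem exists_pair {d : ℕ} (f : (Fin d → ℝ) →ₗ[ℝ] ℝ)
    (h : ∀ k : Fin d → ℤ, ∃ j : ℤ, f (intVec k) = j) : ∃ k, ∀ x, pair k x = f x := by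
  choose k hk using fun i : Fin d => h (Pi.single i 1)
  refine ⟨k, fun x => ?_⟩
  have e : ∑ i, x i • (Pi.single i 1 : Fin d → ℝ) = x := by simp [← pi_eq_sum_univ' x]
  conv_rhs => rw [← e, map_sum]
  rw [pair_apply]
  refine Finset.sum_congr rfl fun i _ => ?_
  have : intVec (Pi.single i 1 : Fin d → ℤ) = Pi.single i 1 := by
    funext j
    by_cases hj : j = i
    · subst hj; simp [intVec]
    · simp [intVec, hj]
  rw [map_smul, smul_eq_mul, ← this, hk, mul_comm]

theorem pair_intVec {d : ℕ} (k m : Fin d → ℤ) : ∃ j : ℤ, pair k (intVec m) = j :=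
  ⟨∑ i, k i * m i, by simp [pair_apply, intVec]⟩

/-! ### Integral functionals, and the coordinates of G, M and Γ -/

namespace Data

variable {d : ℕ} {G : Type*} [TopologicalSpace G]
    [ChartedSpace (EuclideanSpace ℝ (Fin (d + 1))) G] [Group G]
    [LieGroup (𝓡 (d + 1)) ∞ G] (D : Data d G)

section Functional

/-- A functional is the combination of the dual basis whose coefficients are its values on the
basis. -/
theorem mem_span_coord {s : Set (Fin (d + 1))}
    {l : Module.Dual ℝ (GroupLieAlgebra (𝓡 (d + 1)) G)} :
    l ∈ Submodule.span ℤ (D.X.coord '' s) ↔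
      ∀ i, (∃ z : ℤ, l (D.X i) = z) ∧ (i ∉ s → l (D.X i) = 0) := by
  classical
  constructor
  · intro h
    induction h using Submodule.span_induction with
    | mem l hl =>
      obtain ⟨j, hj, rfl⟩ := hl
      intro i
      refine ⟨⟨if i = j then 1 else 0, ?_⟩, fun hi => ?_⟩
      · simp [Finsupp.single_apply]
      · have : i ≠ j := fun h => hi (h ▸ hj)
        simp [this]
    | zero => exact fun i => ⟨⟨0, by simp⟩, fun _ => rfl⟩
    | add l l' _ _ h h' =>
      intro i
      obtain ⟨⟨z, hz⟩, h0⟩ := h i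
      obtain ⟨⟨z', hz'⟩, h0'⟩ := h' i
      exact ⟨⟨z + z', by simp [hz, hz']⟩, fun hi => by simp [h0 hi, h0' hi]⟩
    | smul c l _ h =>
      intro i
      obtain ⟨⟨z, hz⟩, h0⟩ := h i
      exact ⟨⟨c * z, by simp [hz]⟩, fun hi => by simp [h0 hi]⟩
  · intro h
    choose z hz using fun i => (h i).1
    have e : l = ∑ i, z i • D.X.coord i := by
      refine D.X.ext fun j => ?_
      rw [LinearMap.sum_apply, Finset.sum_eq_single j]
      · simp [hz]
      · intro b _ hb
        simp [hb.symm]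
      · simp
    rw [e]
    refine Submodule.sum_mem _ fun i _ => ?_
    by_cases hi : i ∈ s
    · exact Submodule.smul_mem _ _ (Submodule.subset_span ⟨i, hi, rfl⟩)
    · have h1 := (h i).2 hi
      rw [hz] at h1
      rw [Int.cast_eq_zero.1 h1, zero_smul]
      exact zero_mem _

theorem apply_JG_eq {l : Module.Dual ℝ (GroupLieAlgebra (𝓡 (d + 1)) G)} {k : Fin d → ℤ}
    (h : ∀ i, l (D.X (Fin.castSucc i)) = k i) (x : Fin d → ℝ) : l (D.JG x) = pair k x := by
  rw [JG_apply, map_sum, pair_apply]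
  exact Finset.sum_congr rfl fun i _ => by rw [map_smul, h, smul_eq_mul, mul_comm]

theorem JG_single (i : Fin d) : D.JG (Pi.single i 1) = D.X i.castSucc := by
  rw [JG_apply, Finset.sum_eq_single i]
  · simp
  · intro b _ hb
    simp [hb]
  · simp

/-- By `derived_eq`, the condition on the derived ideal depends only on the restriction to the
abelian ideal and on `A`. -/
theorem mem_gen {l : Module.Dual ℝ (GroupLieAlgebra (𝓡 (d + 1)) G)} :
    l ∈ D.gen ↔ (∃ k, ∀ x, pair k x = l (D.JG x)) ∧ l (D.X (Fin.last d)) = 0 ∧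
      ∃ x, l (D.JG (D.A x)) ≠ 0 := by
  have h1 : (∃ Y ∈ ⁅(⊤ : LieIdeal ℝ (GroupLieAlgebra (𝓡 (d + 1)) G)),
      (⊤ : LieIdeal ℝ (GroupLieAlgebra (𝓡 (d + 1)) G))⁆, l Y ≠ 0) ↔
      ∃ x, l (D.JG (D.A x)) ≠ 0 := by
    constructor
    · rintro ⟨Y, hY, h⟩
      obtain ⟨x, rfl⟩ := D.derived_eq.1 hY
      exact ⟨x, h⟩
    · rintro ⟨x, h⟩
      exact ⟨_, D.derived_eq.2 ⟨x, rfl⟩, h⟩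
  rw [gen, Set.mem_ofPred_eq, h1, mem_span_coord, ← and_assoc]
  refine and_congr_left fun _ => ⟨fun h => ⟨?_, (h _).2 (by simp)⟩, ?_⟩
  · choose k hk using fun i : Fin d => (h i.castSucc).1
    exact ⟨k, fun x => (D.apply_JG_eq hk x).symm⟩
  · rintro ⟨⟨k, hk⟩, h0⟩ i
    induction i using Fin.lastCases with
    | last => exact ⟨⟨0, by simpa using h0⟩, fun _ => h0⟩
    | cast i => exact ⟨⟨k i, by rw [← JG_single, ← hk, pair_single]⟩, fun hi => (hi i.2).elim⟩

/-- The missing coefficients are those at the first p basis vectors, which span the derived ideal,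
that is, the image of `A`. -/
theorem mem_Lam {l : Module.Dual ℝ (GroupLieAlgebra (𝓡 (d + 1)) G)} :
    l ∈ D.Lam ↔ (∃ k, ∀ x, pair k x = l (D.JG x)) ∧ (∃ j : ℤ, l (D.X (Fin.last d)) = j) ∧
      ∀ x, l (D.JG (D.A x)) = 0 := by
  have h1 : (∀ i, i ∉ {i : Fin (d + 1) | D.p ≤ (i : ℕ)} → l (D.X i) = 0) ↔
      ∀ x, l (D.JG (D.A x)) = 0 := by
    have h2 : (∀ i, i ∉ {i : Fin (d + 1) | D.p ≤ (i : ℕ)} → l (D.X i) = 0) ↔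
        Submodule.span ℝ (D.X '' {i | (i : ℕ) < D.p}) ≤ LinearMap.ker l := by
      rw [Submodule.span_le]
      constructor
      · rintro h _ ⟨i, hi, rfl⟩
        exact h i fun h' => not_le.2 (show (i : ℕ) < D.p from hi) h'
      · intro h i hi
        exact h ⟨i, show (i : ℕ) < D.p from not_le.1 hi, rfl⟩
    rw [h2, D.span_derived]
    constructor
    · intro h x
      exact h (D.derived_eq.2 ⟨x, rfl⟩)
    · intro h Y hY
      obtain ⟨x, rfl⟩ := D.derived_eq.1 hY
      exact h x
  rw [Lam, SetLike.mem_coe, mem_span_coord, ← and_assoc, ← h1, forall_and]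
  refine and_congr_left fun _ => ⟨fun h => ⟨?_, h _⟩, ?_⟩
  · choose k hk using fun i : Fin d => h i.castSucc
    exact ⟨k, fun x => (D.apply_JG_eq hk x).symm⟩
  · rintro ⟨⟨k, hk⟩, h0⟩ i
    induction i using Fin.lastCases with
    | last => exact h0
    | cast i => exact ⟨k i, by rw [← JG_single, ← hk, pair_single]⟩

/-- The functional with given values on the abelian ideal and on `X_n`. -/
def func (k : Fin d → ℤ) (j : ℤ) : Module.Dual ℝ (GroupLieAlgebra (𝓡 (d + 1)) G) :=
  D.X.constr ℝ (Fin.lastCases (j : ℝ) fun i => (k i : ℝ))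

theorem func_JG (k : Fin d → ℤ) (j : ℤ) (x : Fin d → ℝ) : D.func k j (D.JG x) = pair k x :=
  D.apply_JG_eq (fun i => by rw [func, Module.Basis.constr_basis, Fin.lastCases_castSucc]) x

theorem func_last (k : Fin d → ℤ) (j : ℤ) : D.func k j (D.X (Fin.last d)) = j := by
  rw [func, Module.Basis.constr_basis, Fin.lastCases_last]

theorem functional_ext {l l' : Module.Dual ℝ (GroupLieAlgebra (𝓡 (d + 1)) G)}
    (h : ∀ x, l (D.JG x) = l' (D.JG x))
    (h' : l (D.X (Fin.last d)) = l' (D.X (Fin.last d))) : l = l' := by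
  refine D.X.ext fun i => ?_
  induction i using Fin.lastCases with
  | last => exact h'
  | cast i => rw [← JG_single, h]

end Functional

theorem bijective_flowInt (hnil : LieRing.IsNilpotent (GroupLieAlgebra (𝓡 (d + 1)) G))
    (t : ℝ) : Function.Bijective (flowInt (t • D.A) 1) := by
  have h : IsNilpotent (t • D.A) := (D.isNilpotent_A hnil).smul t
  have h1 := flowInt_injective h one_ne_zero
  exact ⟨h1, (LinearMap.injective_iff_surjective
    (f := (flowInt (t • D.A) 1 : (Fin d → ℝ) →ₗ[ℝ] (Fin d → ℝ)))).1 h1⟩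

variable [T2Space G] [SimplyConnectedSpace G]

/-- The coordinates `(t, x) ↦ exp(t X_n) exp(∑ x_i X_i)` of `G`. -/
def e : ℝ × (Fin d → ℝ) ≃ₜ G := D.adapted.homeo

theorem e_apply (t : ℝ) (x : Fin d → ℝ) :
    D.e (t, x) = lieExp (t • D.X (Fin.last d)) * lieExp (D.JG x) := rfl

theorem e_mul (a b : ℝ × (Fin d → ℝ)) :
    D.e a * D.e b = D.e (a.1 + b.1, flow D.A (-b.1) a.2 + b.2) := D.adapted.expMap_mul a b

theorem lieExp_JG (x : Fin d → ℝ) : lieExp (D.JG x) = D.e (0, x) := by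
  rw [e_apply, lieExp_zero_smul, one_mul]

theorem lieExp_last (t : ℝ) : lieExp (t • D.X (Fin.last d)) = D.e (t, 0) := by
  rw [e_apply, map_zero, lieExp_zero, mul_one]

theorem e_zero : (D.e 0 : G) = 1 := by
  have h := D.adapted.hasDerivOne_expMap
  exact h.map_zero

theorem e_inv (t : ℝ) (x : Fin d → ℝ) : (D.e (t, x))⁻¹ = D.e (-t, -flow D.A t x) := by
  rw [inv_eq_iff_mul_eq_one, e_mul, ← D.e_zero]
  congr 1
  simp

theorem symm_mul (g h : G) : D.e.symm (g * h) =
    ((D.e.symm g).1 + (D.e.symm h).1, flow D.A (-(D.e.symm h).1) (D.e.symm g).2 +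
      (D.e.symm h).2) := by
  rw [Homeomorph.symm_apply_eq, ← e_mul]
  simp

theorem lieExp_smul_add (t : ℝ) (y : Fin d → ℝ) :
    lieExp (t • D.X (Fin.last d) + D.JG y) = D.e (t, flowInt ((-t) • D.A) 1 y) :=
  D.adapted.lieExp_smul_add t y

theorem lieAd_e (t : ℝ) (x y : Fin d → ℝ) :
    lieAd (D.e (t, x)) (D.JG y) = D.JG (flow D.A t y) := by
  have h1 : lieAdL (n := d + 1) (D.e (t, x)) (D.J y) = D.J (flow D.A t y) := by
    rw [e_apply, lieAdL_mul, ContinuousLinearMap.comp_apply]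
    exact (congrArg _ (D.adapted.lieAdL_expJ x y)).trans (D.adapted.lieAdL_exp t y)
  exact h1

theorem adRel_e {t : ℝ} {x : Fin d → ℝ} {l l' : Module.Dual ℝ (GroupLieAlgebra (𝓡 (d + 1)) G)} :
    D.AdRel (D.e (t, x)) l l' ↔ ∀ y, l' (D.JG y) = l (D.JG (flow D.A (-t) y)) := by
  constructor
  · intro h y
    rw [h _ (D.mem_m.2 ⟨y, rfl⟩), e_inv, lieAd_e]
  · intro h Y hY
    obtain ⟨y, rfl⟩ := D.mem_m.1 hY
    rw [h, e_inv, lieAd_e]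

theorem mem_M {g : G} : g ∈ D.M ↔ (D.e.symm g).1 = 0 := by
  constructor
  · intro h
    induction h using Subgroup.closure_induction with
    | mem g hg =>
      obtain ⟨Y, hY, rfl⟩ := hg
      obtain ⟨x, rfl⟩ := D.mem_m.1 hY
      rw [lieExp_JG, Homeomorph.symm_apply_apply]
    | one => rw [← D.e_zero, Homeomorph.symm_apply_apply]; rfl
    | mul g h _ _ hg hh => rw [symm_mul, hg, hh, add_zero]
    | inv g _ hg =>
      have h1 : g = D.e ((D.e.symm g).1, (D.e.symm g).2) := by simp
      rw [h1, e_inv, Homeomorph.symm_apply_apply, hg, neg_zero]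
  · intro h
    have h1 : g = D.e ((D.e.symm g).1, (D.e.symm g).2) := by simp
    rw [h1, h, ← lieExp_JG]
    exact Subgroup.subset_closure ⟨_, D.mem_m.2 ⟨_, rfl⟩, rfl⟩

theorem e_mem_M {a : ℝ × (Fin d → ℝ)} : D.e a ∈ D.M ↔ a.1 = 0 := by
  rw [mem_M, Homeomorph.symm_apply_apply]

theorem list_prod_lieExp {k : ℕ} (y : Fin k → Fin d → ℝ) :
    (List.ofFn fun i => (lieExp (D.JG (y i)) : G)).prod = D.e (0, ∑ i, y i) := by
  rw [← lieExp_JG]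
  exact D.adapted.list_prod_lieExp y

theorem list_prod_X {σ : Equiv.Perm (Fin d)} (x : Fin d → ℝ) :
    (List.ofFn fun i => (lieExp (x (σ i) • D.X (σ i).castSucc) : G)).prod = D.e (0, x) := by
  have h := D.list_prod_lieExp fun i => x (σ i) • (Pi.single (σ i) 1 : Fin d → ℝ)
  simp only [map_smul, JG_single] at h
  rw [h, Equiv.sum_comp σ fun i => x i • (Pi.single i 1 : Fin d → ℝ)]
  congr 2
  simp [← pi_eq_sum_univ' x]

theorem coordMap_eq (t : Fin (d + 1) → ℝ) :
    D.coordMap t = D.e (t (Fin.last d), fun i => t i.castSucc) := by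
  rw [coordMap, List.ofFn_succ, List.prod_cons, e_apply, lieExp_JG]
  simp only [Fin.rev_zero, Fin.rev_succ]
  congr 1
  exact D.list_prod_X (σ := Fin.revPerm) fun i => t i.castSucc

theorem coordMapM_eq (x : Fin d → ℝ) : (D.coordMapM x : G) = D.e (0, x) := by
  rw [← D.list_prod_X (σ := Fin.revPerm) x, coordMapM, ← Subgroup.coe_subtype, map_list_prod,
    List.map_ofFn]
  rfl

/-- In the product that describes Γ the factor of X_n comes last, whereas in the coordinates `e` it
comes first. The two orders differ by a flow. -/
theorem mem_Γ_aux {g : G} : g ∈ D.Γ ↔ ∃ (j : ℤ) (k : Fin d → ℤ),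
    g = D.e (0, intVec k) * D.e (j, 0) := by
  have h : ∀ t : Fin (d + 1) → ℤ, (List.ofFn fun i => (lieExp ((t i : ℝ) • D.X i) : G)).prod =
      D.e (0, intVec fun i => t i.castSucc) * D.e (t (Fin.last d), 0) := by
    intro t
    rw [List.ofFn_succ', List.concat_eq_append, List.prod_append, List.prod_singleton, lieExp_last]
    congr 1
    exact D.list_prod_X (σ := Equiv.refl _) (intVec fun i => t i.castSucc)
  rw [← SetLike.mem_coe, D.based]
  constructor
  · rintro ⟨t, rfl⟩
    exact ⟨t (Fin.last d), fun i => t i.castSucc, h t⟩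
  · rintro ⟨j, k, rfl⟩
    refine ⟨Fin.lastCases j k, ?_⟩
    simp only [h, Fin.lastCases_last, Fin.lastCases_castSucc]

theorem e_int_mem (j : ℤ) (k : Fin d → ℤ) : D.e (j, intVec k) ∈ D.Γ := by
  have h0 : intVec (0 : Fin d → ℤ) = 0 := by funext i; simp [intVec]
  have h1 : D.e (j, 0) ∈ D.Γ := by
    refine D.mem_Γ_aux.2 ⟨j, 0, ?_⟩
    rw [e_mul, h0]; simp
  have h2 : D.e (0, intVec k) ∈ D.Γ := by
    refine D.mem_Γ_aux.2 ⟨0, k, ?_⟩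
    rw [e_mul]; simp [flow_zero]
  have h3 := D.Γ.mul_mem h1 h2
  rw [e_mul] at h3
  simpa using h3

/-- As Γ is a group, it contains the products exp(j X_n) exp(k). Writing such an element in the
order of `mem_Γ_aux` replaces k by e^{jA} k, which is therefore integral. -/
theorem exists_flow_intVec (j : ℤ) (k : Fin d → ℤ) :
    ∃ m : Fin d → ℤ, flow D.A j (intVec k) = intVec m := by
  obtain ⟨j', m, h⟩ := D.mem_Γ_aux.1 (D.e_int_mem j k)
  rw [e_mul] at h
  have h1 := Prod.ext_iff.1 (D.e.injective h)
  simp only [zero_add, add_zero] at h1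
  refine ⟨m, ?_⟩
  rw [h1.2, ← h1.1, flow_apply_neg]

theorem mem_Γ {a : ℝ × (Fin d → ℝ)} : D.e a ∈ D.Γ ↔
    ∃ (j : ℤ) (k : Fin d → ℤ), a = (↑j, intVec k) := by
  constructor
  · intro h
    obtain ⟨j, k, h⟩ := D.mem_Γ_aux.1 h
    rw [e_mul] at h
    have h1 := D.e.injective h
    simp only [zero_add, add_zero] at h1
    obtain ⟨m, hm⟩ := D.exists_flow_intVec (-j) k
    exact ⟨j, m, by rw [h1, ← hm]; simp⟩
  · rintro ⟨j, k, rfl⟩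
    exact D.e_int_mem j k

/-- The exponential does not change the X_n-coordinate t, and on the other coordinates it is the
bijection `flowInt` of -tA. Hence `lieLog` is a genuine left inverse. -/
theorem lieExp_injective (D : Data d G)
    (hnil : LieRing.IsNilpotent (GroupLieAlgebra (𝓡 (d + 1)) G)) :
    Function.Injective (lieExp : GroupLieAlgebra (𝓡 (d + 1)) G → G) := by
  intro Y Z h
  rw [D.eq_smul_add Y, D.eq_smul_add Z] at h ⊢
  rw [lieExp_smul_add, lieExp_smul_add] at h
  have h1 := Prod.ext_iff.1 (D.e.injective h)
  simp only at h1
  obtain ⟨h2, h3⟩ := h1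
  rw [h2] at h3 ⊢
  rw [(D.bijective_flowInt hnil _).1 h3]

theorem chi_e_flowInt (hnil : LieRing.IsNilpotent (GroupLieAlgebra (𝓡 (d + 1)) G))
    (l : Module.Dual ℝ (GroupLieAlgebra (𝓡 (d + 1)) G)) (t : ℝ)
    (y : Fin d → ℝ) : chi l (D.e (t, flowInt ((-t) • D.A) 1 y)) =
      Circle.exp (2 * Real.pi * (t * l (D.X (Fin.last d)) + l (D.JG y))) := by
  rw [← lieExp_smul_add, chi, lieLog, Function.leftInverse_invFun (D.lieExp_injective hnil),
    map_add, map_smul, smul_eq_mul]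

theorem chi_e_zero (hnil : LieRing.IsNilpotent (GroupLieAlgebra (𝓡 (d + 1)) G))
    (l : Module.Dual ℝ (GroupLieAlgebra (𝓡 (d + 1)) G)) (x : Fin d → ℝ) :
    chi l (D.e (0, x)) = Circle.exp (2 * Real.pi * l (D.JG x)) := by
  have h := D.chi_e_flowInt hnil l 0 x
  rwa [flowInt_eq_smul _ (by simp), one_smul, zero_mul, zero_add] at h

/-- Passing from exponential coordinates to the coordinates `e` applies `flowInt`, which changes
vectors only along the image of `A`, where `l` vanishes. -/
theorem chi_e_of_derived (hnil : LieRing.IsNilpotent (GroupLieAlgebra (𝓡 (d + 1)) G))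
    {l : Module.Dual ℝ (GroupLieAlgebra (𝓡 (d + 1)) G)}
    (hl : ∀ x, l (D.JG (D.A x)) = 0) (t : ℝ) (x : Fin d → ℝ) : chi l (D.e (t, x)) =
      Circle.exp (2 * Real.pi * (t * l (D.X (Fin.last d)) + l (D.JG x))) := by
  obtain ⟨y, rfl⟩ := (D.bijective_flowInt hnil (-t)).2 x
  rw [D.chi_e_flowInt hnil]
  have h := apply_flowInt_eq ((-t) • D.A)
    (l := LinearMap.toContinuousLinearMap (l ∘ₗ D.JG)) (fun x => by
      rw [smul_apply, map_smul]
      exact (congrArg _ (hl x)).trans (smul_zero _)) 1 y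
  rw [one_mul] at h
  have h' : l (D.JG (flowInt ((-t) • D.A) 1 y)) = l (D.JG y) := h
  rw [h']

end Data

/-! ### The integral covectors, enumerated by Σ × ℤ and by Λ -/

namespace Data

variable {d : ℕ} {G : Type*} [TopologicalSpace G]
    [ChartedSpace (EuclideanSpace ℝ (Fin (d + 1))) G] [Group G]
    [LieGroup (𝓡 (d + 1)) ∞ G] (D : Data d G)

/-- The integral covectors that vanish on the derived ideal. -/
def IsFixed (k : Fin d → ℤ) : Prop := ∀ x, pair k (D.A x) = 0

/-- An element of Λ is determined by its restriction to the abelian ideal, which is a fixed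
covector, and by its integral value on X_n; both can be prescribed freely. -/
theorem exists_lamEquiv : ∃ E : D.Lam ≃ {k // D.IsFixed k} × ℤ, ∀ l : D.Lam,
    (∀ x, pair (E l).1.1 x = l.1 (D.JG x)) ∧ l.1 (D.X (Fin.last d)) = (E l).2 := by
  have h1 : ∀ l : D.Lam, ∃ q : {k // D.IsFixed k} × ℤ,
      (∀ x, pair q.1.1 x = l.1 (D.JG x)) ∧ l.1 (D.X (Fin.last d)) = q.2 := by
    intro l
    obtain ⟨⟨k, hk⟩, ⟨j, hj⟩, h0⟩ := D.mem_Lam.1 l.2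
    exact ⟨(⟨k, fun x => by rw [hk, h0]⟩, j), hk, hj⟩
  choose F hF hF' using h1
  refine ⟨Equiv.ofBijective F ⟨fun l l' h => ?_, ?_⟩, fun l => ⟨hF l, hF' l⟩⟩
  · refine Subtype.ext (D.functional_ext (fun x => ?_) ?_)
    · rw [← hF, ← hF, h]
    · rw [hF', hF', h]
  · rintro ⟨⟨k, hk⟩, j⟩
    have hl : D.func k j ∈ D.Lam := D.mem_Lam.2
      ⟨⟨k, fun x => (D.func_JG k j x).symm⟩, ⟨j, D.func_last k j⟩, fun x => by
        rw [func_JG, hk]⟩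
    refine ⟨⟨_, hl⟩, Prod.ext (Subtype.ext (pair_injective fun x => ?_)) ?_⟩
    · rw [hF, func_JG]
    · have := hF' ⟨_, hl⟩
      rw [func_last] at this
      exact_mod_cast this.symm

variable [T2Space G] [SimplyConnectedSpace G]

/-- An element e(j, m) of Γ acts on covectors through e^{-jA} alone, so the Γ-orbits are the
ℤ-orbits. The cross section gives surjectivity and the uniqueness of `l`; the uniqueness of `j` is
the freeness of the action, a consequence of nilpotency. -/
theorem exists_orbitEquiv (hnil : LieRing.IsNilpotent (GroupLieAlgebra (𝓡 (d + 1)) G))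
    {S : Set (Module.Dual ℝ (GroupLieAlgebra (𝓡 (d + 1)) G))} (hS : D.IsCrossSection S) :
    ∃ E : S × ℤ ≃ {k // ¬ D.IsFixed k}, ∀ (l : S) (j : ℤ) (x : Fin d → ℝ),
      pair (E (l, j)).1 x = l.1 (D.JG (flow D.A (-j) x)) := by
  have h1 : ∀ q : S × ℤ, ∃ k : {k // ¬ D.IsFixed k}, ∀ x : Fin d → ℝ,
      pair k.1 x = q.1.1 (D.JG (flow D.A (-q.2) x)) := by
    rintro ⟨l, j⟩
    obtain ⟨⟨m, hm⟩, -, y, hy⟩ := D.mem_gen.1 (hS.1 l.2)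
    obtain ⟨k, hk⟩ := exists_pair (l.1 ∘ₗ D.JG ∘ₗ (flow D.A (-(j : ℝ))).toLinearMap) fun k => by
      obtain ⟨k', hk'⟩ := D.exists_flow_intVec (-j) k
      push_cast at hk'
      change ∃ i : ℤ, l.1 (D.JG (flow D.A (-(j : ℝ)) (intVec k))) = i
      rw [hk', ← hm]
      exact pair_intVec _ _
    refine ⟨⟨k, fun h => hy ?_⟩, hk⟩
    have h2 := h (flow D.A j y)
    rw [hk] at h2
    have h3 : D.A (flow D.A j y) = flow D.A j (D.A y) := by
      have := (hasDerivAt_flow' D.A (j : ℝ)).unique (hasDerivAt_flow D.A j)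
      exact congrArg (fun T : (Fin d → ℝ) →L[ℝ] (Fin d → ℝ) => T y) this
    rw [h3] at h2
    change l.1 (D.JG (flow D.A (-(j : ℝ)) (flow D.A j (D.A y)))) = 0 at h2
    rwa [flow_neg_apply] at h2
  choose F hF using h1
  refine ⟨Equiv.ofBijective F ⟨?_, ?_⟩, fun l j x => hF (l, j) x⟩
  · rintro ⟨l, j⟩ ⟨l', j'⟩ h
    have hg : D.func (F (l, j)).1 0 ∈ D.gen := by
      refine D.mem_gen.2 ⟨⟨_, fun x => (D.func_JG _ _ x).symm⟩, ?_, ?_⟩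
      · rw [func_last]; simp
      · have := (F (l, j)).2
        unfold IsFixed at this
        push Not at this
        obtain ⟨x, hx⟩ := this
        exact ⟨x, by rwa [func_JG]⟩
    obtain ⟨s, -, hs⟩ := hS.2 _ hg
    have key : ∀ (l : S) (j : ℤ) (k : Fin d → ℤ), (F (l, j)).1 = k →
        ∃ γ ∈ D.Γ, D.AdRel γ l.1 (D.func k 0) := by
      rintro l j _ rfl
      refine ⟨D.e (j, intVec 0), D.e_int_mem j 0, D.adRel_e.2 fun y => ?_⟩
      rw [func_JG, hF]
    have e1 := hs l.1 ⟨l.2, key l j _ rfl⟩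
    have e2 := hs l'.1 ⟨l'.2, key l' j' _ (by rw [h])⟩
    have e3 : l = l' := Subtype.ext (e1.trans e2.symm)
    subst e3
    refine Prod.ext rfl ?_
    by_contra hj
    obtain ⟨-, -, y, hy⟩ := D.mem_gen.1 (hS.1 l.2)
    -- If j ≠ j', then `l` is invariant under e^{(j - j')A}, hence vanishes on the image of `A`,
    -- contrary to `l` lying in `gen`.
    refine hy (apply_eq_zero_of_apply_flow_eq (D.isNilpotent_A hnil) (s := (j : ℝ) - j')
      (l := LinearMap.toContinuousLinearMap (l.1 ∘ₗ D.JG)) ?_ (fun x => ?_) y)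
    · rw [sub_ne_zero]
      exact_mod_cast hj
    · have h5 := hF (l, j) (flow D.A j x)
      rw [h, hF] at h5
      change l.1 (D.JG (flow D.A (-(j' : ℝ)) (flow D.A j x))) =
        l.1 (D.JG (flow D.A (-(j : ℝ)) (flow D.A j x))) at h5
      rw [flow_neg_apply, ← flow_add_apply, neg_add_eq_sub] at h5
      exact h5
  · rintro ⟨k, hk⟩
    have hg : D.func k 0 ∈ D.gen := by
      refine D.mem_gen.2 ⟨⟨_, fun x => (D.func_JG _ _ x).symm⟩, ?_, ?_⟩
      · rw [func_last]; simp
      · unfold IsFixed at hk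
        push Not at hk
        obtain ⟨x, hx⟩ := hk
        exact ⟨x, by rwa [func_JG]⟩
    obtain ⟨s, ⟨hs, γ, hγ, h⟩, -⟩ := hS.2 _ hg
    obtain ⟨a, rfl⟩ := D.e.surjective γ
    obtain ⟨j, m, rfl⟩ := D.mem_Γ.1 hγ
    refine ⟨(⟨s, hs⟩, j), Subtype.ext (pair_injective fun x => ?_)⟩
    rw [hF, ← D.func_JG k 0, D.adRel_e.1 h]

end Data

/-! ### The unit cube -/

section Cube

/-- Lebesgue measure on the unit cube. -/
def cubeMeasure (d : ℕ) : Measure (Fin d → ℝ) :=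
  volume.restrict (Set.pi Set.univ fun _ : Fin d => Set.Ico (0 : ℝ) 1)

instance (d : ℕ) : IsProbabilityMeasure (cubeMeasure d) :=
  ⟨by simp [cubeMeasure, Real.volume_pi_Ico]⟩

/-- Lebesgue measure on the unit interval. -/
def unitMeasure : Measure ℝ := volume.restrict (Set.Ico (0 : ℝ) 1)

instance : IsProbabilityMeasure unitMeasure := ⟨by simp [unitMeasure]⟩

/-- The torus is parametrized by the cube that is open on the left and closed on the right; the two
cubes differ by a null set. -/
theorem cubeMeasure_eq_Ioc (d : ℕ) : cubeMeasure d = volume.restrict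
    {x : Fin d → ℝ | ∀ i, x i ∈ Set.Ioc ((0 : Fin d → ℝ) i) ((0 : Fin d → ℝ) i + 1)} := by
  have h : {x : Fin d → ℝ | ∀ i, x i ∈ Set.Ioc ((0 : Fin d → ℝ) i) ((0 : Fin d → ℝ) i + 1)} =
      Set.pi Set.univ fun _ : Fin d => Set.Ioc (0 : ℝ) 1 := by
    ext x; simp
  rw [h]
  refine Measure.restrict_congr_set ?_
  have h1 : (Set.pi Set.univ fun _ : Fin d => Set.Ico (0 : ℝ) 1) =ᵐ[volume]
      Set.Icc (fun _ => 0) fun _ => 1 := Measure.univ_pi_Ico_ae_eq_Icc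
  have h2 : (Set.pi Set.univ fun _ : Fin d => Set.Ioc (0 : ℝ) 1) =ᵐ[volume]
      Set.Icc (fun _ => 0) fun _ => 1 := Measure.univ_pi_Ioc_ae_eq_Icc
  exact h1.trans h2.symm

/-- The character `x ↦ e^{2πi ⟨k, x⟩}`. -/
def chr {d : ℕ} (k : Fin d → ℤ) (x : Fin d → ℝ) : Circle := Circle.exp (2 * Real.pi * pair k x)

theorem chr_add {d : ℕ} (k : Fin d → ℤ) (x y : Fin d → ℝ) :
    chr k (x + y) = chr k x * chr k y := by
  rw [chr, map_add, mul_add, Circle.exp_add]; rfl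

theorem chr_sub_left {d : ℕ} (k k' : Fin d → ℤ) (x : Fin d → ℝ) :
    chr (k - k') x = chr k x * (chr k' x)⁻¹ := by
  have h : pair (k - k') x = pair k x - pair k' x := by
    simp only [pair_apply, Pi.sub_apply, Int.cast_sub, sub_mul, Finset.sum_sub_distrib]
  rw [chr, h, mul_sub, Circle.exp_sub, div_eq_mul_inv]; rfl

theorem chr_zero_left {d : ℕ} (x : Fin d → ℝ) : chr 0 x = 1 := by
  have h : pair 0 x = 0 := by simp [pair_apply]
  rw [chr, h]; simp

theorem chr_zero {d : ℕ} (k : Fin d → ℤ) : chr k 0 = 1 := by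
  rw [chr, map_zero]; simp

theorem chr_intVec {d : ℕ} (k m : Fin d → ℤ) : chr k (intVec m) = 1 := by
  obtain ⟨j, hj⟩ := pair_intVec k m
  rw [chr, hj, mul_comm]
  exact Circle.exp_int_mul_two_pi j

theorem continuous_chr {d : ℕ} (k : Fin d → ℤ) : Continuous (chr k) :=
  Circle.exp.continuous.comp (continuous_const.mul (pair k).continuous)

theorem chr_eq_mFourier {d : ℕ} (k : Fin d → ℤ) (x : Fin d → ℝ) :
    (chr k x : ℂ) = UnitAddTorus.mFourier k fun i => (x i : UnitAddCircle) := by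
  change _ = ∏ i, fourier (k i) (x i : AddCircle (1 : ℝ))
  simp only [fourier_coe_apply]
  rw [← Complex.exp_sum, chr, Circle.coe_exp]
  congr 1
  rw [pair_apply]
  push_cast
  rw [Finset.mul_sum, Finset.sum_mul]
  refine Finset.sum_congr rfl fun i _ => ?_
  ring

section Torus

attribute [local instance] instMeasureSpaceUnitAddCircle

/-- Parseval's formula on the unit cube. -/
theorem tsum_enorm_sq_coeff {d : ℕ} {f : (Fin d → ℝ) → ℂ} (hf : Measurable f) {C : ℝ}
    (hC : ∀ x, ‖f x‖ ≤ C) :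
    ∑' k : Fin d → ℤ, ‖∫ x, f x * chr k x ∂cubeMeasure d‖ₑ ^ 2 =
      ∫⁻ x, ‖f x‖ₑ ^ 2 ∂cubeMeasure d := by
  -- The function on the torus that takes the values of `f` on the representatives in the cube; `f`
  -- need not be periodic.
  set F : UnitAddTorus (Fin d) → ℂ :=
    fun q => f (UnitAddTorus.measurableEquivPiIoc (0 : Fin d → ℝ) q).1 with hF
  have hFm : Measurable F :=
    hf.comp (measurable_subtype_coe.comp (UnitAddTorus.measurableEquivPiIoc 0).measurable)
  have : IsProbabilityMeasure (volume : Measure UnitAddCircle) :=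
    inferInstanceAs (IsProbabilityMeasure AddCircle.haarAddCircle)
  have hFL : MemLp F 2 volume := MemLp.of_bound hFm.aestronglyMeasurable C (ae_of_all _ fun _ => hC _)
  have hset : MeasurableSet {x : Fin d → ℝ | ∀ i, x i ∈
      Set.Ioc ((0 : Fin d → ℝ) i) ((0 : Fin d → ℝ) i + 1)} :=
    MeasurableSet.univ_pi' fun i => measurableSet_Ioc
  have hFx : ∀ x ∈ {x : Fin d → ℝ | ∀ i, x i ∈
      Set.Ioc ((0 : Fin d → ℝ) i) ((0 : Fin d → ℝ) i + 1)},
      F (fun i => (x i : UnitAddCircle)) = f x := by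
    intro x hx
    have := (UnitAddTorus.measurableEquivPiIoc (0 : Fin d → ℝ)).apply_symm_apply ⟨x, hx⟩
    exact congrArg (fun q => f q.1) this
  -- The sign: Fourier coefficients on the torus pair with the conjugate character, the integrals
  -- here with `chr k` itself. The sum is reindexed by negation below.
  have h1 : ∀ k : Fin d → ℤ, ∫ x, f x * chr k x ∂cubeMeasure d =
      UnitAddTorus.mFourierCoeff (hFL.toLp F) (-k) := by
    intro k
    have : UnitAddTorus.mFourierCoeff (hFL.toLp F) (-k) = UnitAddTorus.mFourierCoeff F (-k) :=
      integral_congr_ae (ae_eq_rfl.mul hFL.coeFn_toLp)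
    rw [this, UnitAddTorus.mFourierCoeff_eq_integral F (-k) 0, cubeMeasure_eq_Ioc]
    refine setIntegral_congr_fun hset fun x hx => ?_
    rw [hFx x hx, neg_neg, chr_eq_mFourier, smul_eq_mul, mul_comm]
  have h2 := UnitAddTorus.hasSum_sq_mFourierCoeff (hFL.toLp F)
  have h3 : ∑' k : Fin d → ℤ, ‖UnitAddTorus.mFourierCoeff (hFL.toLp F) k‖ₑ ^ 2 =
      ENNReal.ofReal (∫ t, ‖hFL.toLp F t‖ ^ 2) := by
    rw [← h2.tsum_eq, ENNReal.ofReal_tsum_of_nonneg (fun _ => by positivity) h2.summable]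
    refine tsum_congr fun k => ?_
    rw [← ofReal_norm, ENNReal.ofReal_pow (norm_nonneg _)]
  simp only [h1]
  refine ((Equiv.neg (Fin d → ℤ)).tsum_eq
    fun k => ‖UnitAddTorus.mFourierCoeff (hFL.toLp F) k‖ₑ ^ 2).trans ?_
  rw [h3]
  have h4 : ∫ t, ‖hFL.toLp F t‖ ^ 2 = ∫ t, ‖F t‖ ^ 2 := by
    refine integral_congr_ae ?_
    filter_upwards [hFL.coeFn_toLp] with t ht
    rw [ht]
  rw [h4, ofReal_integral_eq_lintegral_ofReal hFL.integrable_norm_pow'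
    (ae_of_all _ fun _ => by positivity), UnitAddTorus.lintegral_preimage _ 0, cubeMeasure_eq_Ioc]
  refine setLIntegral_congr_fun hset fun x hx => ?_
  simp only [hFx x hx]
  rw [← ofReal_norm, ENNReal.ofReal_pow (norm_nonneg _)]

end Torus

/-- Parseval for the constant function 1: the total is 1, and the term of k = 0 already equals 1, so
every other term vanishes. -/
theorem integral_chr {d : ℕ} (k : Fin d → ℤ) :
    ∫ x, (chr k x : ℂ) ∂cubeMeasure d = if k = 0 then 1 else 0 := by
  have h0 : ∫ x, (chr 0 x : ℂ) ∂cubeMeasure d = 1 := by simp [chr_zero_left]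
  split_ifs with hk
  · rw [hk, h0]
  · have h1 := tsum_enorm_sq_coeff (d := d) (f := fun _ => (1 : ℂ)) measurable_const (C := 1)
      (by simp)
    simp only [one_mul, enorm_one, one_pow, lintegral_one, measure_univ] at h1
    have h2 := ENNReal.sum_le_tsum (f := fun k : Fin d → ℤ =>
      ‖∫ x, (chr k x : ℂ) ∂cubeMeasure d‖ₑ ^ 2) {k, 0}
    rw [h1, Finset.sum_pair hk, h0, enorm_one, one_pow] at h2
    have h3 : ‖∫ x, (chr k x : ℂ) ∂cubeMeasure d‖ₑ ^ 2 = 0 := by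
      have := ENNReal.le_sub_of_add_le_right ENNReal.one_ne_top h2
      simpa using this
    simpa using h3

theorem measurePreserving_unit : MeasurePreserving (MeasurableEquiv.funUnique (Fin 1) ℝ)
    (cubeMeasure 1) unitMeasure := by
  have h := (volume_preserving_funUnique (Fin 1) ℝ).restrict_preimage
    (measurableSet_Ico (a := (0 : ℝ)) (b := 1))
  have h2 : (MeasurableEquiv.funUnique (Fin 1) ℝ) ⁻¹' Set.Ico (0 : ℝ) 1 =
      Set.pi Set.univ fun _ : Fin 1 => Set.Ico (0 : ℝ) 1 := by
    ext x
    simp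
  rw [h2] at h
  exact h

/-- Parseval's formula on the unit interval. -/
theorem tsum_enorm_sq_coeff_unit {c : ℝ → ℂ} (hc : Measurable c) {C : ℝ} (hC : ∀ t, ‖c t‖ ≤ C) :
    ∑' j : ℤ, ‖∫ t, c t * Circle.exp (2 * Real.pi * (t * j)) ∂unitMeasure‖ₑ ^ 2 =
      ∫⁻ t, ‖c t‖ₑ ^ 2 ∂unitMeasure := by
  have h := tsum_enorm_sq_coeff (d := 1) (f := fun x => c (x 0)) (hc.comp (measurable_pi_apply 0))
    fun x => hC _
  have h1 := measurePreserving_unit.lintegral_comp_emb (MeasurableEquiv.measurableEmbedding _)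
    fun t => ‖c t‖ₑ ^ 2
  rw [← h1, ← (Equiv.funUnique (Fin 1) ℤ).tsum_eq]
  refine Eq.trans (tsum_congr fun k => ?_) h
  have h2 := measurePreserving_unit.integral_comp (MeasurableEquiv.measurableEmbedding _)
    fun t => c t * (Circle.exp (2 * Real.pi * (t * (k 0 : ℤ))) : ℂ)
  have h3 : ((Equiv.funUnique (Fin 1) ℤ) k) = k 0 := rfl
  rw [h3, ← h2]
  congr 2
  refine integral_congr_ae (ae_of_all _ fun x => ?_)
  have h4 : (MeasurableEquiv.funUnique (Fin 1) ℝ) x = x 0 := rfl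
  simp only [h4, chr, pair_apply, Fin.sum_univ_one, mul_comm]

theorem integral_exp_unit (j : ℤ) :
    ∫ t, (Circle.exp (2 * Real.pi * (t * j)) : ℂ) ∂unitMeasure = if j = 0 then 1 else 0 := by
  have h2 := measurePreserving_unit.integral_comp (MeasurableEquiv.measurableEmbedding _)
    fun t => (Circle.exp (2 * Real.pi * (t * j)) : ℂ)
  have h3 := integral_chr (d := 1) fun _ => j
  have h4 : (fun _ : Fin 1 => j) = 0 ↔ j = 0 :=
    ⟨fun h => congrFun h 0, fun h => by rw [h]; rfl⟩
  simp only [h4] at h3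
  rw [← h2, ← h3]
  refine integral_congr_ae (ae_of_all _ fun x => ?_)
  have h5 : (MeasurableEquiv.funUnique (Fin 1) ℝ) x = x 0 := rfl
  simp only [h5, chr, pair_apply, Fin.sum_univ_one, mul_comm]

end Cube

/-! ### Integrals of periodic functions -/

section Periodic

variable {d : ℕ}

/-- The lattice `ℤ^d`. -/
def lattice (d : ℕ) : Submodule ℤ (Fin d → ℝ) :=
  Submodule.span ℤ (Set.range (Pi.basisFun ℝ (Fin d)))

theorem mem_lattice {x : Fin d → ℝ} : x ∈ lattice d ↔ ∃ k, intVec k = x := by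
  rw [lattice, Module.Basis.mem_span_iff_repr_mem]
  constructor
  · intro h
    choose k hk using h
    exact ⟨k, funext fun i => by simpa [intVec] using hk i⟩
  · rintro ⟨k, rfl⟩ i
    exact ⟨k i, by simp [intVec]⟩

theorem isAddFundamentalDomain_cube : IsAddFundamentalDomain (lattice d)
    (Set.pi Set.univ fun _ : Fin d => Set.Ico (0 : ℝ) 1) (volume : Measure (Fin d → ℝ)) := by
  rw [← ZSpan.fundamentalDomain_pi_basisFun]
  exact ZSpan.isAddFundamentalDomain (Pi.basisFun ℝ (Fin d)) volume

instance : VAddInvariantMeasure (lattice d) (Fin d → ℝ) volume :=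
  inferInstanceAs (VAddInvariantMeasure (lattice d).toAddSubgroup (Fin d → ℝ) volume)

instance : Countable (lattice d) := by
  refine Function.Surjective.countable
    (f := fun k : Fin d → ℤ => (⟨intVec k, mem_lattice.2 ⟨k, rfl⟩⟩ : lattice d)) ?_
  rintro ⟨x, hx⟩
  obtain ⟨k, rfl⟩ := mem_lattice.1 hx
  exact ⟨k, rfl⟩

/-- A linear automorphism that preserves the lattice and the volume. -/
structure IsLatticeMap (E : (Fin d → ℝ) ≃L[ℝ] (Fin d → ℝ)) : Prop where
  map : ∀ k : Fin d → ℤ, ∃ m : Fin d → ℤ, E (intVec k) = intVec m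
  symm_map : ∀ k : Fin d → ℤ, ∃ m : Fin d → ℤ, E.symm (intVec k) = intVec m
  det : LinearMap.det (E.toLinearEquiv : (Fin d → ℝ) →ₗ[ℝ] (Fin d → ℝ)) = 1

theorem IsLatticeMap.measurePreserving {E : (Fin d → ℝ) ≃L[ℝ] (Fin d → ℝ)} (hE : IsLatticeMap E)
    (y : Fin d → ℝ) :
    MeasurePreserving (E.toHomeomorph.trans (Homeomorph.addRight y)) volume volume := by
  refine (measurePreserving_add_right volume y).comp ⟨E.continuous.measurable, ?_⟩
  have h := Real.map_linearMap_volume_pi_eq_smul_volume_pi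
    (f := (E.toLinearEquiv : (Fin d → ℝ) →ₗ[ℝ] (Fin d → ℝ))) (by rw [hE.det]; exact one_ne_zero)
  rw [hE.det] at h
  simpa using h

/-- The affine map normalizes the translations by the lattice, so it carries one fundamental domain
to another. -/
theorem IsLatticeMap.isAddFundamentalDomain {E : (Fin d → ℝ) ≃L[ℝ] (Fin d → ℝ)}
    (hE : IsLatticeMap E) (y : Fin d → ℝ) : IsAddFundamentalDomain (lattice d)
      ((E.toHomeomorph.trans (Homeomorph.addRight y)) ''
        (Set.pi Set.univ fun _ : Fin d => Set.Ico (0 : ℝ) 1)) volume := by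
  have h1 : ∀ g ∈ lattice d, E g ∈ lattice d := by
    intro g hg
    obtain ⟨k, rfl⟩ := mem_lattice.1 hg
    obtain ⟨m, hm⟩ := hE.map k
    exact mem_lattice.2 ⟨m, hm.symm⟩
  have h2 : ∀ g ∈ lattice d, E.symm g ∈ lattice d := by
    intro g hg
    obtain ⟨k, rfl⟩ := mem_lattice.1 hg
    obtain ⟨m, hm⟩ := hE.symm_map k
    exact mem_lattice.2 ⟨m, hm.symm⟩
  let e : lattice d ≃ lattice d :=
    { toFun := fun g => ⟨E.symm g, h2 g g.2⟩
      invFun := fun g => ⟨E g, h1 g g.2⟩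
      left_inv := fun g => Subtype.ext (E.apply_symm_apply g)
      right_inv := fun g => Subtype.ext (E.symm_apply_apply g) }
  refine isAddFundamentalDomain_cube.image_of_equiv
    (E.toHomeomorph.trans (Homeomorph.addRight y)).toEquiv
    ((hE.measurePreserving y).symm
      (E.toHomeomorph.trans (Homeomorph.addRight y)).toMeasurableEquiv).quasiMeasurePreserving
    e fun g x => ?_
  change E (E.symm g + x) + y = g + (E x + y)
  rw [map_add, E.apply_symm_apply, add_assoc]

/-- The map preserves volume, which moves the integral to the image of the cube; a periodic function
has the same integral over each fundamental domain. -/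
theorem IsLatticeMap.lintegral_comp {E : (Fin d → ℝ) ≃L[ℝ] (Fin d → ℝ)} (hE : IsLatticeMap E)
    (y : Fin d → ℝ) {F : (Fin d → ℝ) → ℝ≥0∞} (hF : ∀ k x, F (intVec k + x) = F x) :
    ∫⁻ x, F (E x + y) ∂cubeMeasure d = ∫⁻ x, F x ∂cubeMeasure d := by
  have h1 := (hE.measurePreserving y).setLIntegral_comp_emb
    (E.toHomeomorph.trans (Homeomorph.addRight y)).measurableEmbedding F
    (Set.pi Set.univ fun _ : Fin d => Set.Ico (0 : ℝ) 1)
  refine h1.trans ?_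
  refine (hE.isAddFundamentalDomain y).setLIntegral_eq isAddFundamentalDomain_cube F ?_
  rintro ⟨g, hg⟩ x
  obtain ⟨k, rfl⟩ := mem_lattice.1 hg
  exact hF k x

theorem IsLatticeMap.integral_comp {E : (Fin d → ℝ) ≃L[ℝ] (Fin d → ℝ)} (hE : IsLatticeMap E)
    (y : Fin d → ℝ) {F : (Fin d → ℝ) → ℂ} (hF : ∀ k x, F (intVec k + x) = F x) :
    ∫ x, F (E x + y) ∂cubeMeasure d = ∫ x, F x ∂cubeMeasure d := by
  have h1 := (hE.measurePreserving y).setIntegral_image_emb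
    (E.toHomeomorph.trans (Homeomorph.addRight y)).measurableEmbedding F
    (Set.pi Set.univ fun _ : Fin d => Set.Ico (0 : ℝ) 1)
  refine h1.symm.trans ?_
  refine (hE.isAddFundamentalDomain y).setIntegral_eq isAddFundamentalDomain_cube ?_
  rintro ⟨g, hg⟩ x
  obtain ⟨k, rfl⟩ := mem_lattice.1 hg
  exact hF k x

theorem isLatticeMap_refl : IsLatticeMap (ContinuousLinearEquiv.refl ℝ (Fin d → ℝ)) where
  map k := ⟨k, rfl⟩
  symm_map k := ⟨k, rfl⟩
  det := LinearMap.det_id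

/-- A periodic function on the line has the same integral over each period. -/
theorem lintegral_unit_add (s : ℝ) {φ : ℝ → ℝ≥0∞} (hφ : ∀ (j : ℤ) t, φ (j + t) = φ t) :
    ∫⁻ t, φ (s + t) ∂unitMeasure = ∫⁻ t, φ t ∂unitMeasure := by
  have h := (isLatticeMap_refl (d := 1)).lintegral_comp (fun _ => s) (F := fun x => φ (x 0))
    fun k x => hφ (k 0) (x 0)
  have h1 := measurePreserving_unit.lintegral_comp_emb (MeasurableEquiv.measurableEmbedding _) φ
  have h2 := measurePreserving_unit.lintegral_comp_emb (MeasurableEquiv.measurableEmbedding _)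
    fun t => φ (s + t)
  rw [← h1, ← h2]
  refine Eq.trans (lintegral_congr fun x => ?_) h
  change φ (s + x 0) = φ (x 0 + s)
  rw [add_comm]

theorem lintegral_eq_tsum_unit (φ : ℝ → ℝ≥0∞) :
    ∫⁻ t, φ t = ∑' j : ℤ, ∫⁻ t, φ (t + j) ∂unitMeasure := by
  have h1 : (⋃ j : ℤ, Set.Ico (j : ℝ) (j + 1)) = Set.univ := by
    simpa using iUnion_Ico_intCast ℝ
  rw [← setLIntegral_univ, ← h1, lintegral_iUnion (fun _ => measurableSet_Ico)
    (Set.pairwise_disjoint_Ico_intCast ℝ)]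
  refine tsum_congr fun j => ?_
  have h2 := (measurePreserving_add_right (volume : Measure ℝ) (j : ℝ)).setLIntegral_comp_preimage_emb
    (measurableEmbedding_addRight (j : ℝ)) φ (Set.Ico (j : ℝ) (j + 1))
  rw [← h2, unitMeasure]
  congr 2
  ext t
  simp

end Periodic

/-- `flow A t` as an automorphism. -/
def flowEquiv {V : Type*} [NormedAddCommGroup V] [NormedSpace ℝ V] [CompleteSpace V]
    (A : V →L[ℝ] V) (t : ℝ) : V ≃L[ℝ] V :=
  ContinuousLinearEquiv.equivOfInverse (flow A t) (flow A (-t)) (flow_neg_apply A t)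
    (flow_apply_neg A t)

theorem intVec_zero {d : ℕ} : intVec (0 : Fin d → ℤ) = 0 := by
  funext i; simp [intVec]

/-! ### The quotients and their invariant measures in coordinates -/

namespace Data

variable {d : ℕ} {G : Type*} [TopologicalSpace G]
    [ChartedSpace (EuclideanSpace ℝ (Fin (d + 1))) G] [Group G]
    [LieGroup (𝓡 (d + 1)) ∞ G] (D : Data d G) [T2Space G]

theorem t2Space_quotient : T2Space (G ⧸ D.Γ) := by
  have := topologicalGroup_of_lieGroup (G := G) (𝓡 (d + 1)) ∞
  have := D.discrete
  infer_instance

variable [SimplyConnectedSpace G]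

theorem isLatticeMap_flow (hnil : LieRing.IsNilpotent (GroupLieAlgebra (𝓡 (d + 1)) G)) (j : ℤ) :
    IsLatticeMap (flowEquiv D.A j) where
  map k := D.exists_flow_intVec j k
  symm_map k := by
    have := D.exists_flow_intVec (-j) k
    push_cast at this
    exact this
  det := det_flow (D.isNilpotent_A hnil) j

theorem mk_e_add_intVec (t : ℝ) (x : Fin d → ℝ) (k : Fin d → ℤ) :
    (D.e (t, intVec k + x) : G ⧸ D.Γ) = D.e (t, x) := by
  refine (QuotientGroup.eq.2 ?_).symm
  have h : D.e (t, intVec k + x) = D.e (t, x) * D.e (0, intVec k) := by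
    rw [e_mul]
    simp [flow_zero, add_comm]
  rw [h, inv_mul_cancel_left]
  exact D.mem_Γ.2 ⟨0, k, by simp⟩

/-- One has e(j + t, x) = e(t, e^{jA} x) e(j, 0), and the last factor lies in Γ. This is the gluing
of the torus bundle G/Γ over the circle. -/
theorem mk_e_int_add (t : ℝ) (x : Fin d → ℝ) (j : ℤ) :
    (D.e (j + t, x) : G ⧸ D.Γ) = D.e (t, flow D.A j x) := by
  refine (QuotientGroup.eq.2 ?_).symm
  have h : D.e (j + t, x) = D.e (t, flow D.A j x) * D.e (j, 0) := by
    rw [e_mul]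
    simp [flow_neg_apply, add_comm]
  rw [h, inv_mul_cancel_left]
  exact D.mem_Γ.2 ⟨j, 0, by rw [intVec_zero]⟩

theorem coordMapM_mul (x y : Fin d → ℝ) : D.coordMapM (x + y) = D.coordMapM x * D.coordMapM y := by
  refine Subtype.ext ?_
  rw [Subgroup.coe_mul, coordMapM_eq, coordMapM_eq, coordMapM_eq, e_mul]
  simp [flow_zero]

theorem coordMapM_intVec_mem (k : Fin d → ℤ) :
    D.coordMapM (intVec k) ∈ D.Γ.subgroupOf D.M := by
  rw [Subgroup.mem_subgroupOf, coordMapM_eq]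
  exact D.mem_Γ.2 ⟨0, k, by simp⟩

theorem coordMapM_surjective : Function.Surjective D.coordMapM := by
  rintro ⟨g, hg⟩
  obtain ⟨⟨t, x⟩, rfl⟩ := D.e.surjective g
  have ht : t = 0 := D.e_mem_M.1 hg
  subst ht
  exact ⟨x, Subtype.ext (D.coordMapM_eq x)⟩

theorem mk_coordMapM_add (k : Fin d → ℤ) (x : Fin d → ℝ) :
    (D.coordMapM (intVec k + x) : D.M ⧸ D.Γ.subgroupOf D.M) = D.coordMapM x := by
  refine (QuotientGroup.eq.2 ?_).symm
  rw [add_comm, coordMapM_mul, inv_mul_cancel_left]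
  exact D.coordMapM_intVec_mem k

theorem continuous_coordMapM : Continuous D.coordMapM := by
  refine continuous_induced_rng.2 ?_
  have : Subtype.val ∘ D.coordMapM = fun x => D.e (0, x) := funext D.coordMapM_eq
  rw [this]
  fun_prop

/-- The coordinate `t` on `G/M`. -/
def tau : G ⧸ D.M → ℝ :=
  Quotient.lift (fun g => (D.e.symm g).1) fun a b h => by
    have h1 : a⁻¹ * b ∈ D.M := QuotientGroup.leftRel_apply.1 h
    have h2 := D.symm_mul a (a⁻¹ * b)
    rw [mul_inv_cancel_left, D.mem_M.1 h1, add_zero] at h2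
    exact (congrArg Prod.fst h2).symm

theorem tau_mk (g : G) : D.tau (g : G ⧸ D.M) = (D.e.symm g).1 := rfl

theorem continuous_tau : Continuous D.tau :=
  Continuous.quotient_lift (continuous_fst.comp D.e.symm.continuous) _

theorem mk_e (t : ℝ) (x : Fin d → ℝ) : (D.e (t, x) : G ⧸ D.M) = D.e (t, 0) := by
  refine QuotientGroup.eq.2 ?_
  rw [e_inv, e_mul]
  exact D.e_mem_M.2 (by simp)

theorem polishSpace (D : Data d G) [SecondCountableTopology G] : PolishSpace G :=
  D.e.symm.isClosedEmbedding.polishSpace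

variable [MeasurableSpace G]

theorem muGM_eq : D.muGM = Measure.map (fun t : ℝ => (D.e (t, 0) : G ⧸ D.M)) volume := by
  simp only [muGM, lieExp_last]

variable [BorelSpace G]

theorem measurable_mk_e : Measurable fun a => (D.e a : G ⧸ D.Γ) :=
  measurable_quotient_mk''.comp D.e.continuous.measurable

/-- Splitting off the last coordinate, which is the time, turns the unit cube of dimension d + 1
into a product. -/
theorem nu_eq : D.nu =
    Measure.map (fun a => (D.e a : G ⧸ D.Γ)) (unitMeasure.prod (cubeMeasure d)) := by
  have h1 := (volume_preserving_piFinSuccAbove (fun _ : Fin (d + 1) => ℝ)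
    (Fin.last d)).restrict_preimage
    ((measurableSet_Ico (a := (0 : ℝ)) (b := 1)).prod (MeasurableSet.univ_pi fun _ : Fin d =>
      measurableSet_Ico (a := (0 : ℝ)) (b := 1)))
  have h2 : (MeasurableEquiv.piFinSuccAbove (fun _ : Fin (d + 1) => ℝ) (Fin.last d)) ⁻¹'
      (Set.Ico (0 : ℝ) 1 ×ˢ Set.pi Set.univ fun _ : Fin d => Set.Ico (0 : ℝ) 1) =
      Set.pi Set.univ fun _ : Fin (d + 1) => Set.Ico (0 : ℝ) 1 := by
    ext t
    simp only [Set.mem_preimage, Set.mem_prod, Set.mem_pi, Set.mem_univ, true_implies]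
    rw [Fin.forall_fin_succ', and_comm]
    simp only [MeasurableEquiv.piFinSuccAbove, Fin.insertNthEquiv, Fin.removeNth,
      MeasurableEquiv.coe_mk, Equiv.coe_fn_symm_mk, Fin.succAbove_last]
  rw [h2, Measure.volume_eq_prod, ← Measure.prod_restrict] at h1
  have h3 : unitMeasure.prod (cubeMeasure d) = Measure.map
      (MeasurableEquiv.piFinSuccAbove (fun _ : Fin (d + 1) => ℝ) (Fin.last d))
      (volume.restrict (Set.pi Set.univ fun _ : Fin (d + 1) => Set.Ico (0 : ℝ) 1)) :=
    h1.map_eq.symm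
  rw [h3, Measure.map_map D.measurable_mk_e (MeasurableEquiv.measurable _), nu]
  congr 1
  funext t
  rw [coordMap_eq]
  simp [MeasurableEquiv.piFinSuccAbove, Fin.insertNthEquiv]
  rfl

theorem measurable_mk_coordMapM :
    Measurable fun x => (D.coordMapM x : D.M ⧸ D.Γ.subgroupOf D.M) :=
  measurable_quotient_mk''.comp D.continuous_coordMapM.measurable

theorem measurable_mk_e_M : Measurable fun t : ℝ => (D.e (t, 0) : G ⧸ D.M) :=
  measurable_quotient_mk''.comp (D.e.continuous.measurable.comp (by fun_prop))

theorem isProbabilityMeasure_nu : IsProbabilityMeasure D.nu := by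
  rw [nu_eq]
  exact Measure.isProbabilityMeasure_map D.measurable_mk_e.aemeasurable

theorem isProbabilityMeasure_nuM : IsProbabilityMeasure D.nuM := by
  unfold nuM; rw [← cubeMeasure]
  exact Measure.isProbabilityMeasure_map D.measurable_mk_coordMapM.aemeasurable

theorem lintegral_nu {F : G ⧸ D.Γ → ℝ≥0∞} (hF : Measurable F) :
    ∫⁻ q, F q ∂D.nu = ∫⁻ t, ∫⁻ x, F (D.e (t, x) : G) ∂cubeMeasure d ∂unitMeasure := by
  rw [nu_eq, lintegral_map hF D.measurable_mk_e]
  exact lintegral_prod _ (hF.comp D.measurable_mk_e).aemeasurable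

theorem measurable_smul_quotient {H : Type*} [Group H] [TopologicalSpace H] [IsTopologicalGroup H]
    [MeasurableSpace H] [BorelSpace H] (N : Subgroup H) (g : H) :
    Measurable fun q : H ⧸ N => g • q := by
  refine measurable_from_quotient.2 ?_
  exact measurable_quotient_mk''.comp (continuous_const_mul g).measurable

/-- Translation by e(s, z) shifts t by s and x by e^{-tA} z. The shift in x leaves the integral over
each torus unchanged, and that integral is 1-periodic in t because e^{jA} preserves the lattice and
the volume. -/
theorem lintegral_nu_smul (hnil : LieRing.IsNilpotent (GroupLieAlgebra (𝓡 (d + 1)) G)) (g : G)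
    {F : G ⧸ D.Γ → ℝ≥0∞} (hF : Measurable F) : ∫⁻ q, F (g • q) ∂D.nu = ∫⁻ q, F q ∂D.nu := by
  have := topologicalGroup_of_lieGroup (G := G) (𝓡 (d + 1)) ∞
  obtain ⟨⟨s, z⟩, rfl⟩ := D.e.surjective g
  rw [D.lintegral_nu hF, D.lintegral_nu (F := fun q => F (D.e (s, z) • q))
    (hF.comp (measurable_smul_quotient _ _))]
  have h1 : ∀ t, ∫⁻ x, F (D.e (s, z) • ((D.e (t, x) : G) : G ⧸ D.Γ)) ∂cubeMeasure d =
      ∫⁻ x, F (D.e (s + t, x) : G) ∂cubeMeasure d := by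
    intro t
    have h2 := isLatticeMap_refl.lintegral_comp (flow D.A (-t) z)
      (F := fun x => F (D.e (s + t, x) : G)) fun k x => by simp only [mk_e_add_intVec]
    rw [← h2]
    refine lintegral_congr fun x => ?_
    change F ((D.e (s, z) * D.e (t, x) : G) : G ⧸ D.Γ) = _
    rw [e_mul, add_comm _ (flow D.A (-t) z)]
    rfl
  simp only [h1]
  refine lintegral_unit_add s (φ := fun t => ∫⁻ x, F (D.e (t, x) : G) ∂cubeMeasure d)
    fun j t => ?_
  simp only [mk_e_int_add]
  have h2 := (D.isLatticeMap_flow hnil j).lintegral_comp 0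
    (F := fun x => F (D.e (t, x) : G)) fun k x => by simp only [mk_e_add_intVec]
  simp only [add_zero] at h2
  exact h2

theorem smulInvariantMeasure_nu (hnil : LieRing.IsNilpotent (GroupLieAlgebra (𝓡 (d + 1)) G)) :
    SMulInvariantMeasure G (G ⧸ D.Γ) D.nu := by
  have := topologicalGroup_of_lieGroup (G := G) (𝓡 (d + 1)) ∞
  refine ⟨fun g s hs => ?_⟩
  have h := D.lintegral_nu_smul hnil g (F := s.indicator 1) (measurable_one.indicator hs)
  rw [lintegral_indicator_one hs] at h
  rw [← h, ← lintegral_indicator_one (measurable_smul_quotient _ g hs)]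
  rfl

theorem smulInvariantMeasure_nuM :
    SMulInvariantMeasure D.M (D.M ⧸ D.Γ.subgroupOf D.M) D.nuM := by
  have := topologicalGroup_of_lieGroup (G := G) (𝓡 (d + 1)) ∞
  refine ⟨fun g s hs => ?_⟩
  obtain ⟨y, rfl⟩ := D.coordMapM_surjective g
  rw [← lintegral_indicator_one hs, ← lintegral_indicator_one (measurable_smul_quotient _ _ hs),
    nuM, ← cubeMeasure, lintegral_map (measurable_one.indicator hs) D.measurable_mk_coordMapM,
    lintegral_map (measurable_one.indicator (measurable_smul_quotient _ _ hs))
      D.measurable_mk_coordMapM]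
  have h2 := isLatticeMap_refl.lintegral_comp y
    (F := fun x => s.indicator 1 (D.coordMapM x : D.M ⧸ D.Γ.subgroupOf D.M)) fun k x => by
      simp only [mk_coordMapM_add]
  rw [← h2]
  refine lintegral_congr fun x => ?_
  rw [add_comm, coordMapM_mul]
  rfl

theorem measurable_tau : Measurable D.tau :=
  measurable_from_quotient.2 (continuous_fst.comp D.e.symm.continuous).measurable

/-- The continuous coordinate `tau` carries the measure to Lebesgue measure, and compact sets to
compact sets. -/
theorem isFiniteMeasureOnCompacts_muGM : IsFiniteMeasureOnCompacts D.muGM := by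
  refine ⟨fun K hK => ?_⟩
  have h1 : IsCompact (D.tau '' K) := hK.image D.continuous_tau
  have h2 : D.muGM (D.tau ⁻¹' (D.tau '' K)) = volume (D.tau '' K) := by
    rw [muGM_eq, Measure.map_apply D.measurable_mk_e_M (D.measurable_tau h1.measurableSet)]
    congr 1
    ext t
    rw [Set.mem_preimage, Set.mem_preimage, tau_mk, Homeomorph.symm_apply_apply]
  exact (measure_mono (Set.subset_preimage_image _ _)).trans_lt (h2 ▸ h1.measure_lt_top)

theorem smulInvariantMeasure_muGM : SMulInvariantMeasure G (G ⧸ D.M) D.muGM := by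
  have := topologicalGroup_of_lieGroup (G := G) (𝓡 (d + 1)) ∞
  refine ⟨fun g s hs => ?_⟩
  obtain ⟨⟨r, z⟩, rfl⟩ := D.e.surjective g
  rw [muGM_eq, Measure.map_apply D.measurable_mk_e_M hs,
    Measure.map_apply D.measurable_mk_e_M (measurable_smul_quotient _ _ hs)]
  have h := measure_preimage_add (volume : Measure ℝ) r
    ((fun t : ℝ => (D.e (t, 0) : G ⧸ D.M)) ⁻¹' s)
  rw [← h]
  congr 1
  ext t
  simp only [Set.mem_preimage]
  change ((D.e (r, z) * D.e (t, 0) : G) : G ⧸ D.M) ∈ s ↔ _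
  rw [e_mul, mk_e]

/-- G is Polish, being homeomorphic to ℝ × ℝ^d, and the quotient is Hausdorff; so the quotient
σ-algebra is the Borel one, as is needed to view continuous functions as elements of L². -/
theorem borelSpace_quotient [SecondCountableTopology G] : BorelSpace (G ⧸ D.Γ) := by
  have := topologicalGroup_of_lieGroup (G := G) (𝓡 (d + 1)) ∞
  have := D.polishSpace
  have := D.t2Space_quotient
  infer_instance

end Data

/-! ### Norms of sections -/

section Induced

variable {G : Type*} [Group G]

theorem apply_out_of_invariant {α : Type*} {N : Subgroup G} {f : G → α}
    (hf : ∀ g, ∀ n ∈ N, f (g * n) = f g) (g : G) : f (g : G ⧸ N).out = f g := by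
  obtain ⟨n, hn⟩ := QuotientGroup.mk_out_eq_mul N g
  rw [hn, hf g n n.2]

theorem mk_top_eq (q : G ⧸ (⊤ : Subgroup G)) : q = ((1 : G) : G ⧸ (⊤ : Subgroup G)) := by
  obtain ⟨g, rfl⟩ := QuotientGroup.mk_surjective q
  exact QuotientGroup.eq.2 trivial

variable [MeasurableSpace G] {M : Subgroup G} {χ : G → Circle}
  {μ : Measure (G ⧸ M)}

/-- `toInd` as a linear map. -/
def toIndL (M : Subgroup G) (χ : G → Circle) (μ : Measure (G ⧸ M)) :
    l2Sections M χ μ →ₗ[ℂ] IndSpace M χ μ where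
  toFun F := toInd F.1 F.2
  map_add' F F' := UniformSpace.Completion.coe_add (show PreInd M χ μ from F)
    (show PreInd M χ μ from F')
  map_smul' c F := UniformSpace.Completion.coe_smul c (show PreInd M χ μ from F)

theorem norm_toInd_sq {F : G → ℂ} (hF : F ∈ l2Sections M χ μ) :
    ‖toInd F hF‖ ^ 2 = ∫ q : G ⧸ M, ‖F q.out‖ ^ 2 ∂μ := by
  have h1 : ‖toInd F hF‖ = ‖(show PreInd M χ μ from ⟨F, hF⟩)‖ :=
    UniformSpace.Completion.norm_coe _
  rw [h1, ← inner_self_eq_norm_sq (𝕜 := ℂ)]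
  have h2 : inner ℂ (show PreInd M χ μ from ⟨F, hF⟩) (show PreInd M χ μ from ⟨F, hF⟩) =
    ∫ q : G ⧸ M, starRingEnd ℂ (F q.out) * F q.out ∂μ := rfl
  have h3 : (fun q : G ⧸ M => starRingEnd ℂ (F q.out) * F q.out) =
      fun q => ((‖F q.out‖ ^ 2 : ℝ) : ℂ) := by
    funext q
    rw [← Complex.normSq_eq_conj_mul_self, Complex.normSq_eq_norm_sq]
  rw [h2, h3, integral_complex_ofReal]
  simp

theorem enorm_toInd_sq {F : G → ℂ} (hF : F ∈ l2Sections M χ μ) :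
    ‖toInd F hF‖ₑ ^ 2 = ∫⁻ q : G ⧸ M, ‖F q.out‖ₑ ^ 2 ∂μ := by
  rw [← ofReal_norm, ← ENNReal.ofReal_pow (norm_nonneg _), norm_toInd_sq,
    ofReal_integral_eq_lintegral_ofReal hF.2.2 (ae_of_all _ fun _ => by positivity)]
  refine lintegral_congr fun q => ?_
  rw [ENNReal.ofReal_pow (norm_nonneg _), ofReal_norm]

/-- The quotient G/G is a point, so square integrability is automatic. -/
theorem mem_l2Sections_top {χ : G → Circle} {F : G → ℂ} :
    F ∈ l2Sections ⊤ χ (Measure.dirac ((1 : G) : G ⧸ (⊤ : Subgroup G))) ↔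
      Measurable F ∧ Covariant ⊤ χ F := by
  refine ⟨fun h => ⟨h.1, h.2.1⟩, fun h => ⟨h.1, h.2, ?_⟩⟩
  have : (fun q : G ⧸ (⊤ : Subgroup G) => ‖F q.out‖ ^ 2) = fun _ => ‖F 1‖ ^ 2 := by
    funext q
    have hq : q = ((1 : G) : G ⧸ (⊤ : Subgroup G)) := (mk_top_eq q)
    rw [hq, h.2.norm_out]
  rw [this]
  exact integrable_const _

theorem lintegral_dirac_top {χ : G → Circle} {F : G → ℂ} (h : Covariant ⊤ χ F) :
    ∫⁻ q : G ⧸ (⊤ : Subgroup G), ‖F q.out‖ₑ ^ 2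
      ∂(Measure.dirac ((1 : G) : G ⧸ (⊤ : Subgroup G))) = ‖F 1‖ₑ ^ 2 := by
  have : (fun q : G ⧸ (⊤ : Subgroup G) => ‖F q.out‖ₑ ^ 2) = fun _ => ‖F 1‖ₑ ^ 2 := by
    funext q
    have hq : q = ((1 : G) : G ⧸ (⊤ : Subgroup G)) := (mk_top_eq q)
    rw [hq, ← ofReal_norm, h.norm_out, ofReal_norm]
  rw [this, lintegral_const, measure_univ, mul_one]

end Induced

/-! ### Covariant functions in coordinates -/

namespace Data

variable {d : ℕ} {G : Type*} [TopologicalSpace G]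
    [ChartedSpace (EuclideanSpace ℝ (Fin (d + 1))) G] [Group G]
    [LieGroup (𝓡 (d + 1)) ∞ G] (D : Data d G) [T2Space G] [SimplyConnectedSpace G]

theorem e_mul_zero (t : ℝ) (x y : Fin d → ℝ) : D.e (t, x) * D.e (0, y) = D.e (t, x + y) := by
  rw [e_mul]; simp [flow_zero]

/-- The section of the induced representation with given values on `exp(ℝ X_n)`. -/
def sec (k : Fin d → ℤ) (a : ℝ → ℂ) (g : G) : ℂ :=
  ((chr k (D.e.symm g).2)⁻¹ : Circle) * a (D.e.symm g).1

theorem sec_e (k : Fin d → ℤ) (a : ℝ → ℂ) (t : ℝ) (x : Fin d → ℝ) :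
    D.sec k a (D.e (t, x)) = ((chr k x)⁻¹ : Circle) * a t := by
  rw [sec, Homeomorph.symm_apply_apply]

theorem continuous_sec (k : Fin d → ℤ) {a : ℝ → ℂ} (ha : Continuous a) :
    Continuous (D.sec k a) := by
  have h := continuous_chr k
  have h' := D.e.symm.continuous
  unfold sec
  fun_prop

variable {l : Module.Dual ℝ (GroupLieAlgebra (𝓡 (d + 1)) G)} {k : Fin d → ℤ}

theorem chi_e_zero_eq (hnil : LieRing.IsNilpotent (GroupLieAlgebra (𝓡 (d + 1)) G))
    (hk : ∀ x, pair k x = l (D.JG x)) (x : Fin d → ℝ) : chi l (D.e (0, x)) = chr k x := by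
  rw [D.chi_e_zero hnil, ← hk]; rfl

/-- Every element is e(t, 0) times an element of M, so a covariant function is determined by its
profile t ↦ F(e(t, 0)), which is arbitrary. -/
theorem covariant_iff (hnil : LieRing.IsNilpotent (GroupLieAlgebra (𝓡 (d + 1)) G))
    (hk : ∀ x, pair k x = l (D.JG x)) {F : G → ℂ} :
    Covariant D.M (chi l) F ↔ ∃ a, F = D.sec k a := by
  constructor
  · intro h
    refine ⟨fun t => F (D.e (t, 0)), funext fun g => ?_⟩
    obtain ⟨⟨t, x⟩, rfl⟩ := D.e.surjective g
    have := h (D.e (t, 0)) (D.e (0, x)) (D.e_mem_M.2 rfl)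
    rw [e_mul_zero, zero_add, D.chi_e_zero_eq hnil hk] at this
    rw [this, sec_e]
  · rintro ⟨a, rfl⟩ g m hm
    obtain ⟨⟨t, x⟩, rfl⟩ := D.e.surjective g
    obtain ⟨⟨s, y⟩, rfl⟩ := D.e.surjective m
    have hs : s = 0 := D.e_mem_M.1 hm
    subst hs
    rw [e_mul_zero, sec_e, sec_e, D.chi_e_zero_eq hnil hk, chr_add, mul_inv, Circle.coe_mul]
    ring

/-- The character of `G` with integral parameters. -/
theorem chi_e_eq (hnil : LieRing.IsNilpotent (GroupLieAlgebra (𝓡 (d + 1)) G))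
    (hk : ∀ x, pair k x = l (D.JG x)) (hf : D.IsFixed k) {j : ℤ}
    (hj : l (D.X (Fin.last d)) = j) (t : ℝ) (x : Fin d → ℝ) :
    chi l (D.e (t, x)) = Circle.exp (2 * Real.pi * (t * j)) * chr k x := by
  rw [D.chi_e_of_derived hnil (fun x => by rw [← hk, hf]), hj, ← hk, mul_add, Circle.exp_add]
  rfl

/-- The product of G twists the x-coordinate by a flow, which a fixed covector does not notice. -/
theorem chi_mul (hnil : LieRing.IsNilpotent (GroupLieAlgebra (𝓡 (d + 1)) G))
    (hk : ∀ x, pair k x = l (D.JG x)) (hf : D.IsFixed k) {j : ℤ}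
    (hj : l (D.X (Fin.last d)) = j) (g h : G) : chi l (g * h) = chi l g * chi l h := by
  obtain ⟨⟨t, x⟩, rfl⟩ := D.e.surjective g
  obtain ⟨⟨s, y⟩, rfl⟩ := D.e.surjective h
  have h1 : chr k (flow D.A (-s) x) = chr k x := by
    rw [chr, apply_flow_eq D.A hf]; rfl
  rw [e_mul, D.chi_e_eq hnil hk hf hj, D.chi_e_eq hnil hk hf hj, D.chi_e_eq hnil hk hf hj,
    chr_add, h1, add_mul, mul_add, Circle.exp_add]
  exact mul_mul_mul_comm _ _ _ _

theorem chi_one (hnil : LieRing.IsNilpotent (GroupLieAlgebra (𝓡 (d + 1)) G))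
    (hk : ∀ x, pair k x = l (D.JG x)) : chi l (1 : G) = 1 := by
  rw [← D.e_zero]
  exact (D.chi_e_zero_eq hnil hk 0).trans (chr_zero k)

theorem continuous_chi (hnil : LieRing.IsNilpotent (GroupLieAlgebra (𝓡 (d + 1)) G))
    (hk : ∀ x, pair k x = l (D.JG x)) (hf : D.IsFixed k) {j : ℤ}
    (hj : l (D.X (Fin.last d)) = j) : Continuous (chi l : G → Circle) := by
  have h : (chi l : G → Circle) = fun g =>
      Circle.exp (2 * Real.pi * ((D.e.symm g).1 * j)) * chr k (D.e.symm g).2 := by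
    funext g
    obtain ⟨⟨t, x⟩, rfl⟩ := D.e.surjective g
    rw [D.chi_e_eq hnil hk hf hj, Homeomorph.symm_apply_apply]
  have h1 := continuous_chr k
  have h2 := D.e.symm.continuous
  rw [h]
  fun_prop

theorem covariant_top_iff (hnil : LieRing.IsNilpotent (GroupLieAlgebra (𝓡 (d + 1)) G))
    (hk : ∀ x, pair k x = l (D.JG x)) (hf : D.IsFixed k) {j : ℤ}
    (hj : l (D.X (Fin.last d)) = j) {F : G → ℂ} :
    Covariant ⊤ (chi l) F ↔ ∃ c : ℂ, F = fun g => ((chi l g)⁻¹ : Circle) * c := by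
  constructor
  · intro h
    refine ⟨F 1, funext fun g => ?_⟩
    have := h 1 g trivial
    rwa [one_mul] at this
  · rintro ⟨c, rfl⟩ g h -
    simp only
    rw [D.chi_mul hnil hk hf hj, mul_inv, Circle.coe_mul]
    ring

variable [MeasurableSpace G] [BorelSpace G]

theorem lintegral_muGM {F : G → ℂ} {χ : G → Circle} (hF : Measurable F) (hc : Covariant D.M χ F) :
    ∫⁻ q : G ⧸ D.M, ‖F q.out‖ₑ ^ 2 ∂D.muGM = ∫⁻ t : ℝ, ‖F (D.e (t, 0))‖ₑ ^ 2 := by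
  have h : (fun q : G ⧸ D.M => ‖F q.out‖ₑ ^ 2) = fun q => ENNReal.ofReal ‖F q.out‖ ^ 2 := by
    funext q; rw [ofReal_norm]
  rw [muGM_eq, h, lintegral_map ((hc.measurable_norm hF).ennreal_ofReal.pow_const 2)
    D.measurable_mk_e_M]
  simp only [hc.norm_out, ofReal_norm]

theorem mem_l2Sections_iff {F : G → ℂ} {χ : G → Circle} :
    F ∈ l2Sections D.M χ D.muGM ↔ Measurable F ∧ Covariant D.M χ F ∧
      MemLp (fun t => F (D.e (t, 0))) 2 volume := by
  refine and_congr_right fun hF => and_congr_right fun hc => ?_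
  have hm : Measurable fun t : ℝ => F (D.e (t, 0)) :=
    hF.comp (D.e.continuous.measurable.comp (by fun_prop))
  rw [memLp_two_iff_integrable_sq_norm hm.aestronglyMeasurable, muGM_eq, integrable_map_measure
    ((hc.measurable_norm hF).pow_const 2).aestronglyMeasurable D.measurable_mk_e_M.aemeasurable]
  simp only [Function.comp_def, hc.norm_out]

end Data

/-! ### Fourier coefficients on the tori, and the operator U in terms of them -/

namespace Data

variable {d : ℕ} {G : Type*} [TopologicalSpace G]
    [ChartedSpace (EuclideanSpace ℝ (Fin (d + 1))) G] [Group G]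
    [LieGroup (𝓡 (d + 1)) ∞ G] (D : Data d G) [T2Space G] [SimplyConnectedSpace G]

/-- The Fourier coefficients of a function along the fibres of `G/Γ → ℝ/ℤ`. -/
def coef (ξ : G ⧸ D.Γ → ℂ) (k : Fin d → ℤ) (t : ℝ) : ℂ :=
  ∫ y, ξ (D.e (t, y) : G) * chr k y ∂cubeMeasure d

section Coef

variable {D}

theorem continuous_comp_e (ξ : C(G ⧸ D.Γ, ℂ)) :
    Continuous fun a => ξ (D.e a : G) :=
  ξ.continuous.comp (continuous_quotient_mk'.comp D.e.continuous)

theorem continuous_coef [CompactSpace (G ⧸ D.Γ)] (ξ : C(G ⧸ D.Γ, ℂ)) (k : Fin d → ℤ) :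
    Continuous (D.coef ξ k) := by
  have h1 := continuous_comp_e ξ
  have h2 := continuous_chr k
  refine continuous_of_dominated (bound := fun _ => ‖ξ‖) (fun t => ?_) (fun t => ?_)
    (integrable_const _) ?_
  · exact Continuous.aestronglyMeasurable (by fun_prop)
  · refine ae_of_all _ fun y => ?_
    rw [norm_mul, Circle.norm_coe, mul_one]
    exact ξ.norm_coe_le_norm _
  · exact ae_of_all _ fun y => by fun_prop

theorem norm_coef_le [CompactSpace (G ⧸ D.Γ)] (ξ : C(G ⧸ D.Γ, ℂ)) (k : Fin d → ℤ) (t : ℝ) :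
    ‖D.coef ξ k t‖ ≤ ‖ξ‖ := by
  refine (norm_integral_le_of_norm_le_const (C := ‖ξ‖) (ae_of_all _ fun y => ?_)).trans ?_
  · rw [norm_mul, Circle.norm_coe, mul_one]
    exact ξ.norm_coe_le_norm _
  · simp

/-- Going from t to j + t replaces x by e^{jA} x in ξ; substituting this in the integral, which is
allowed for a lattice map, moves e^{-jA} to the covector. -/
theorem coef_int_add (hnil : LieRing.IsNilpotent (GroupLieAlgebra (𝓡 (d + 1)) G))
    (ξ : G ⧸ D.Γ → ℂ) {k k' : Fin d → ℤ} {j : ℤ}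
    (h : ∀ x, pair k' x = pair k (flow D.A (-j) x)) (t : ℝ) :
    D.coef ξ k (j + t) = D.coef ξ k' t := by
  have h1 := (D.isLatticeMap_flow hnil j).integral_comp 0
    (F := fun x => ξ (D.e (t, x) : G) * chr k' x) fun m x => by
      rw [mk_e_add_intVec, chr_add, chr_intVec, one_mul]
  refine Eq.trans ?_ h1
  refine integral_congr_ae (ae_of_all _ fun x => ?_)
  have h2 : chr k' (flow D.A j x) = chr k x := by
    rw [chr, h, flow_neg_apply]; rfl
  change ξ (D.e (j + t, x) : G) * (chr k x : ℂ) =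
    ξ (D.e (t, flow D.A j x + 0) : G) * (chr k' (flow D.A j x + 0) : ℂ)
  rw [mk_e_int_add, add_zero, h2]

theorem tsum_enorm_sq_coef [CompactSpace (G ⧸ D.Γ)] (ξ : C(G ⧸ D.Γ, ℂ)) (t : ℝ) :
    ∑' k, ‖D.coef ξ k t‖ₑ ^ 2 = ∫⁻ x, ‖ξ (D.e (t, x) : G)‖ₑ ^ 2 ∂cubeMeasure d :=
  tsum_enorm_sq_coeff (f := fun x => ξ (D.e (t, x) : G))
    ((continuous_comp_e ξ).comp (by fun_prop : Continuous fun x : Fin d → ℝ => (t, x))).measurable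
    fun _ => ξ.norm_coe_le_norm _

end Coef

variable [MeasurableSpace G] [BorelSpace G]

theorem integral_nuM {F : D.M → ℂ} (hF : Continuous F)
    (hinv : ∀ m, ∀ n ∈ D.Γ.subgroupOf D.M, F (m * n) = F m) :
    ∫ q : D.M ⧸ D.Γ.subgroupOf D.M, F q.out ∂D.nuM = ∫ y, F (D.coordMapM y) ∂cubeMeasure d := by
  have h1 : Measurable fun q : D.M ⧸ D.Γ.subgroupOf D.M => F q.out := by
    refine measurable_from_quotient.2 ?_
    have : ((fun q : D.M ⧸ D.Γ.subgroupOf D.M => F q.out) ∘ Quotient.mk'') = F :=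
      funext fun m => apply_out_of_invariant hinv m
    rw [this]
    exact hF.measurable
  rw [nuM, ← cubeMeasure, integral_map D.measurable_mk_coordMapM.aemeasurable
    h1.aestronglyMeasurable]
  exact integral_congr_ae (ae_of_all _ fun y => apply_out_of_invariant hinv _)

theorem integral_nu {F : G → ℂ} (hF : Continuous F) {C : ℝ} (hC : ∀ g, ‖F g‖ ≤ C)
    (hinv : ∀ m, ∀ n ∈ D.Γ, F (m * n) = F m) :
    ∫ q : G ⧸ D.Γ, F q.out ∂D.nu = ∫ t, ∫ x, F (D.e (t, x)) ∂cubeMeasure d ∂unitMeasure := by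
  have h1 : Measurable fun q : G ⧸ D.Γ => F q.out := by
    refine measurable_from_quotient.2 ?_
    have : ((fun q : G ⧸ D.Γ => F q.out) ∘ Quotient.mk'') = F :=
      funext fun m => apply_out_of_invariant hinv m
    rw [this]
    exact hF.measurable
  rw [nu_eq, integral_map D.measurable_mk_e.aemeasurable h1.aestronglyMeasurable]
  simp only [apply_out_of_invariant hinv]
  refine integral_prod (fun a => F (D.e a)) ?_
  exact Integrable.of_bound (hF.comp D.e.continuous).aestronglyMeasurable C
    (ae_of_all _ fun a => hC _)

variable {l : Module.Dual ℝ (GroupLieAlgebra (𝓡 (d + 1)) G)} {k : Fin d → ℤ}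

/-- At e(t, x) the integral over M/(M ∩ Γ) is that of ξ(t, x + y) χ_k(y) over the torus; the shift y
↦ y - x pulls out χ_k(x)⁻¹ and leaves the Fourier coefficient. -/
theorem opU_inl (hnil : LieRing.IsNilpotent (GroupLieAlgebra (𝓡 (d + 1)) G))
    {S : Set (Module.Dual ℝ (GroupLieAlgebra (𝓡 (d + 1)) G))} (l : S)
    (hk : ∀ x, pair k x = l.1 (D.JG x)) (ξ : C(G ⧸ D.Γ, ℂ)) :
    D.opU S ξ (Sum.inl l) = D.sec k (D.coef ξ k) := by
  have := topologicalGroup_of_lieGroup (G := G) (𝓡 (d + 1)) ∞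
  funext g
  have h1 : ∀ m : D.M, (chi l.1 (m : G) : Circle) = chr k (D.e.symm m).2 := by
    intro m
    obtain ⟨y, rfl⟩ := D.coordMapM_surjective m
    rw [coordMapM_eq, D.chi_e_zero_eq hnil hk, Homeomorph.symm_apply_apply]
  have h2 : Continuous fun m : D.M =>
      ξ ((g * m : G) : G ⧸ D.Γ) * (chi l.1 (m : G) : ℂ) := by
    simp only [h1]
    have h3 := D.e.symm.continuous
    have h4 := continuous_chr k
    have h5 : Continuous fun m : D.M => ξ ((g * m : G) : G ⧸ D.Γ) :=
      ξ.continuous.comp (continuous_quotient_mk'.comp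
        (continuous_const.mul continuous_subtype_val))
    fun_prop
  have h3 : ∀ m : D.M, ∀ n ∈ D.Γ.subgroupOf D.M,
      ξ ((g * (m * n : D.M) : G) : G ⧸ D.Γ) * (chi l.1 ((m * n : D.M) : G) : ℂ) =
        ξ ((g * m : G) : G ⧸ D.Γ) * (chi l.1 (m : G) : ℂ) := by
    intro m n hn
    have e1 : ((g * (m * n : D.M) : G) : G ⧸ D.Γ) = (g * m : G) := by
      rw [Subgroup.coe_mul, ← mul_assoc]
      exact QuotientGroup.mk_mul_of_mem _ hn
    obtain ⟨y, rfl⟩ := D.coordMapM_surjective m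
    obtain ⟨z, rfl⟩ := D.coordMapM_surjective n
    rw [Subgroup.mem_subgroupOf, coordMapM_eq] at hn
    obtain ⟨j, m', hjm⟩ := D.mem_Γ.1 hn
    rw [e1, ← coordMapM_mul, coordMapM_eq, coordMapM_eq, D.chi_e_zero_eq hnil hk,
      D.chi_e_zero_eq hnil hk, chr_add, show z = intVec m' from congrArg Prod.snd hjm, chr_intVec,
      mul_one]
  refine (D.integral_nuM h2 h3).trans ?_
  obtain ⟨⟨t, x⟩, rfl⟩ := D.e.surjective g
  have h4 := isLatticeMap_refl.integral_comp x
    (F := fun y => ((chr k x)⁻¹ : Circle) * (ξ (D.e (t, y) : G) * chr k y)) fun m y => by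
      rw [mk_e_add_intVec, chr_add, chr_intVec, one_mul]
  rw [sec_e, coef, ← integral_const_mul, ← h4]
  refine integral_congr_ae (ae_of_all _ fun y => ?_)
  change ξ (((D.e (t, x) * D.coordMapM y : G)) : G ⧸ D.Γ) * (chi l.1 (D.coordMapM y : G) : ℂ) =
    ((chr k x)⁻¹ : Circle) * (ξ (D.e (t, y + x) : G) * chr k (y + x))
  rw [coordMapM_eq, e_mul_zero, D.chi_e_zero_eq hnil hk, add_comm x, chr_add, Circle.coe_mul,
    Circle.coe_inv]
  field_simp

/-- As `chi l` is multiplicative and the measure is invariant, the translation by g only produces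
the factor χ_l(g)⁻¹. What remains is integrated over x first and over t afterwards. -/
theorem opU_inr [CompactSpace (G ⧸ D.Γ)]
    (hnil : LieRing.IsNilpotent (GroupLieAlgebra (𝓡 (d + 1)) G))
    {S : Set (Module.Dual ℝ (GroupLieAlgebra (𝓡 (d + 1)) G))} (l : D.Lam)
    (hk : ∀ x, pair k x = l.1 (D.JG x)) (hf : D.IsFixed k) {j : ℤ}
    (hj : l.1 (D.X (Fin.last d)) = j) (ξ : C(G ⧸ D.Γ, ℂ)) :
    D.opU S ξ (Sum.inr l) = fun g => ((chi l.1 g)⁻¹ : Circle) *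
      ∫ t, D.coef ξ k t * Circle.exp (2 * Real.pi * (t * j)) ∂unitMeasure := by
  have := topologicalGroup_of_lieGroup (G := G) (𝓡 (d + 1)) ∞
  have := D.smulInvariantMeasure_nu hnil
  funext g
  set F : G → ℂ := fun m => ξ (m : G ⧸ D.Γ) * (chi l.1 m : ℂ) with hF
  have h1 : Continuous F :=
    (ξ.continuous.comp continuous_quotient_mk').mul
      (continuous_subtype_val.comp (D.continuous_chi hnil hk hf hj))
  have h2 : ∀ m, ∀ n ∈ D.Γ, F (m * n) = F m := by
    intro m n hn
    have e2 : chi l.1 n = 1 := by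
      obtain ⟨a, rfl⟩ := D.e.surjective n
      obtain ⟨i, m, rfl⟩ := D.mem_Γ.1 hn
      rw [D.chi_e_eq hnil hk hf hj, chr_intVec, mul_one, mul_comm]
      have := Circle.exp_int_mul_two_pi (i * j)
      push_cast at this
      exact this
    simp only [hF]
    rw [QuotientGroup.mk_mul_of_mem _ hn, D.chi_mul hnil hk hf hj, e2, mul_one]
  have h3 := D.integral_nu h1 (C := ‖ξ‖) (fun m => by
    rw [hF, norm_mul, Circle.norm_coe, mul_one]
    exact ξ.norm_coe_le_norm _) h2
  have h4 : ∫ q : G ⧸ D.Γ, F (g • q).out ∂D.nu = ∫ q : G ⧸ D.Γ, F q.out ∂D.nu := by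
    have : MeasurableConstSMul G (G ⧸ D.Γ) := ⟨measurable_smul_quotient _⟩
    exact integral_smul_eq_self (fun q : G ⧸ D.Γ => F q.out)
  have h5 : ∫ t, D.coef ξ k t * Circle.exp (2 * Real.pi * (t * j)) ∂unitMeasure =
      ∫ q : G ⧸ D.Γ, F (g • q).out ∂D.nu := by
    rw [h4, h3]
    refine integral_congr_ae (ae_of_all _ fun t => ?_)
    simp only [coef]
    rw [← integral_mul_const]
    refine integral_congr_ae (ae_of_all _ fun x => ?_)
    simp only [hF]
    rw [D.chi_e_eq hnil hk hf hj, Circle.coe_mul]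
    ring
  rw [h5, ← integral_const_mul]
  refine integral_congr_ae (ae_of_all _ fun q => ?_)
  simp only
  have h6 : F (g • q).out = F (g * q.out) := by
    have : g • q = ((g * q.out : G) : G ⧸ D.Γ) := by
      conv_lhs => rw [← QuotientGroup.out_eq' q]
      rfl
    rw [this, apply_out_of_invariant h2]
  rw [h6, hF]
  simp only
  rw [D.chi_mul hnil hk hf hj, Circle.coe_mul, Circle.coe_inv]
  field_simp

end Data

theorem toInd_congr {G : Type*} [Group G] [MeasurableSpace G] {M : Subgroup G} {χ : G → Circle}
    {μ : Measure (G ⧸ M)} {F F' : G → ℂ} (h : F = F') (hF : F ∈ l2Sections M χ μ)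
    (hF' : F' ∈ l2Sections M χ μ) : toInd F hF = toInd F' hF' := by
  subst h; rfl

/-! ### Square sums with values in [0, ∞] -/

section Lp

variable {ι : Type*} {H : ι → Type*} [∀ i, NormedAddCommGroup (H i)]

theorem memℓp_two_of_tsum {f : ∀ i, H i} (h : ∑' i, ‖f i‖ₑ ^ 2 ≠ ⊤) : Memℓp f 2 := by
  refine memℓp_gen ?_
  have h1 := ENNReal.summable_toReal h
  refine h1.congr fun i => ?_
  simp [ENNReal.toReal_pow]

theorem enorm_lp_two_sq (f : lp H 2) : ‖f‖ₑ ^ 2 = ∑' i, ‖f i‖ₑ ^ 2 := by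
  have h1 := lp.hasSum_norm (p := 2) (by norm_num) f
  simp only [ENNReal.toReal_ofNat, Real.rpow_two] at h1
  rw [← ofReal_norm, ← ENNReal.ofReal_pow (norm_nonneg _), ← h1.tsum_eq,
    ENNReal.ofReal_tsum_of_nonneg (fun _ => by positivity) h1.summable]
  refine tsum_congr fun i => ?_
  rw [ENNReal.ofReal_pow (norm_nonneg _), ofReal_norm]

end Lp

section Tsum

variable {α β γ : Type*}

theorem tsum_fst_snd (E : α ≃ β × γ) (f : β → γ → ℝ≥0∞) :
    ∑' a, f (E a).1 (E a).2 = ∑' b, ∑' c, f b c := by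
  rw [← ENNReal.tsum_prod]
  exact E.tsum_eq fun q => f q.1 q.2

theorem tsum_tsum_equiv (E : α × β ≃ γ) (f : γ → ℝ≥0∞) :
    ∑' a, ∑' b, f (E (a, b)) = ∑' c, f c := by
  rw [← ENNReal.tsum_prod]
  exact E.tsum_eq f

theorem tsum_sum_type (f : α ⊕ β → ℝ≥0∞) :
    ∑' i, f i = ∑' a, f (Sum.inl a) + ∑' b, f (Sum.inr b) :=
  Summable.tsum_sum ENNReal.summable ENNReal.summable

theorem tsum_not_add_tsum (p : α → Prop) (f : α → ℝ≥0∞) :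
    (∑' a : {a // ¬ p a}, f a) + ∑' a : {a // p a}, f a = ∑' a, f a := by
  classical
  rw [← (Equiv.sumCompl p).tsum_eq, tsum_sum_type, add_comm]
  rfl

end Tsum

/-! ### The Plancherel identity, and U on continuous functions -/

namespace Data

variable {d : ℕ} {G : Type*} [TopologicalSpace G]
    [ChartedSpace (EuclideanSpace ℝ (Fin (d + 1))) G] [Group G]
    [LieGroup (𝓡 (d + 1)) ∞ G] (D : Data d G)
    (S : Set (Module.Dual ℝ (GroupLieAlgebra (𝓡 (d + 1)) G)))

/-- The integral covectors, as indices of translates of functionals in `S` and of the restrictions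
of the functionals in `Λ`. -/
structure Index where
  orb : S × ℤ ≃ {k // ¬ D.IsFixed k}
  orb_pair : ∀ (l : S) (j : ℤ) (x : Fin d → ℝ),
    pair (orb (l, j)).1 x = l.1 (D.JG (flow D.A (-j) x))
  lam : D.Lam ≃ {k // D.IsFixed k} × ℤ
  lam_pair : ∀ (l : D.Lam) (x : Fin d → ℝ), pair (lam l).1.1 x = l.1 (D.JG x)
  lam_last : ∀ l : D.Lam, l.1 (D.X (Fin.last d)) = (lam l).2

variable {D S}

theorem nonempty_index [T2Space G] [SimplyConnectedSpace G]
    (hnil : LieRing.IsNilpotent (GroupLieAlgebra (𝓡 (d + 1)) G)) (hS : D.IsCrossSection S) :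
    Nonempty (D.Index S) := by
  obtain ⟨E, hE⟩ := D.exists_orbitEquiv hnil hS
  obtain ⟨E', hE'⟩ := D.exists_lamEquiv
  exact ⟨⟨E, hE, E', fun l => (hE' l).1, fun l => (hE' l).2⟩⟩

section Coef

variable [T2Space G] [SimplyConnectedSpace G]

theorem coef_add [CompactSpace (G ⧸ D.Γ)] (ξ η : C(G ⧸ D.Γ, ℂ)) (k : Fin d → ℤ) (t : ℝ) :
    D.coef (ξ + η : C(G ⧸ D.Γ, ℂ)) k t = D.coef ξ k t + D.coef η k t := by
  have h (ξ : C(G ⧸ D.Γ, ℂ)) :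
      Integrable (fun y => ξ (D.e (t, y) : G) * chr k y) (cubeMeasure d) := by
    have h1 := continuous_comp_e ξ
    have h2 := continuous_chr k
    refine Integrable.of_bound (Continuous.aestronglyMeasurable (by fun_prop)) ‖ξ‖
      (ae_of_all _ fun y => ?_)
    rw [norm_mul, Circle.norm_coe, mul_one]
    exact ξ.norm_coe_le_norm _
  rw [coef, coef, coef, ← integral_add (h ξ) (h η)]
  simp only [ContinuousMap.add_apply, add_mul]

theorem coef_smul (c : ℂ) (ξ : C(G ⧸ D.Γ, ℂ)) (k : Fin d → ℤ) (t : ℝ) :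
    D.coef (c • ξ : C(G ⧸ D.Γ, ℂ)) k t = c * D.coef ξ k t := by
  rw [coef, coef, ← integral_const_mul]
  simp only [ContinuousMap.smul_apply, smul_eq_mul, mul_assoc]

theorem integrable_coef_mul [CompactSpace (G ⧸ D.Γ)] (ξ : C(G ⧸ D.Γ, ℂ)) (k : Fin d → ℤ) (j : ℤ) :
    Integrable (fun t => D.coef ξ k t * Circle.exp (2 * Real.pi * (t * j))) unitMeasure := by
  have h1 := continuous_coef ξ k
  refine Integrable.of_bound (Continuous.aestronglyMeasurable (by fun_prop)) ‖ξ‖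
    (ae_of_all _ fun t => ?_)
  rw [norm_mul, Circle.norm_coe, mul_one]
  exact norm_coef_le ξ k t

end Coef

namespace Index

variable (I : D.Index S)

/-- The restriction of the functional `l` to the abelian ideal. -/
def cov : S ⊕ D.Lam → Fin d → ℤ
  | Sum.inl l => (I.orb (l, 0)).1
  | Sum.inr l => (I.lam l).1.1

theorem pair_cov (i : S ⊕ D.Lam) (x : Fin d → ℝ) : pair (I.cov i) x = D.fnl S i (D.JG x) := by
  cases i with
  | inl l =>
    refine (I.orb_pair l 0 x).trans ?_
    rw [Int.cast_zero, neg_zero, flow_zero]; rfl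
  | inr l => exact I.lam_pair l x

theorem orb_pair_cov (l : S) (j : ℤ) (x : Fin d → ℝ) :
    pair (I.orb (l, j)).1 x = pair (I.cov (Sum.inl l)) (flow D.A (-j) x) := by
  rw [I.orb_pair, I.pair_cov]; rfl

variable [T2Space G] [SimplyConnectedSpace G]

/-- Cut the line at the integers; by `coef_int_add`, the coefficient on the j-th interval is that of
the j-th covector of the orbit on the unit interval. -/
theorem lintegral_coef (hnil : LieRing.IsNilpotent (GroupLieAlgebra (𝓡 (d + 1)) G))
    (ξ : G ⧸ D.Γ → ℂ) (l : S) :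
    ∫⁻ t, ‖D.coef ξ (I.cov (Sum.inl l)) t‖ₑ ^ 2 =
      ∑' j : ℤ, ∫⁻ t, ‖D.coef ξ (I.orb (l, j)).1 t‖ₑ ^ 2 ∂unitMeasure := by
  rw [lintegral_eq_tsum_unit]
  refine tsum_congr fun j => lintegral_congr fun t => ?_
  rw [add_comm t (j : ℝ), coef_int_add hnil ξ (I.orb_pair_cov l j)]

/-- For each fixed covector, Parseval in t sums over the values of the functionals on X_n. -/
theorem tsum_lam [CompactSpace (G ⧸ D.Γ)] (ξ : C(G ⧸ D.Γ, ℂ)) :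
    ∑' l : D.Lam, ‖∫ t, D.coef ξ (I.lam l).1.1 t *
      Circle.exp (2 * Real.pi * (t * (I.lam l).2)) ∂unitMeasure‖ₑ ^ 2 =
      ∑' k : {k // D.IsFixed k}, ∫⁻ t, ‖D.coef ξ k.1 t‖ₑ ^ 2 ∂unitMeasure := by
  refine (tsum_fst_snd I.lam fun (k : {k // D.IsFixed k}) (j : ℤ) => ‖∫ t, D.coef ξ k.1 t *
      Circle.exp (2 * Real.pi * (t * j)) ∂unitMeasure‖ₑ ^ 2).trans ?_
  exact tsum_congr fun k => tsum_enorm_sq_coeff_unit (continuous_coef ξ k.1).measurable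
    (norm_coef_le ξ k.1)

variable [MeasurableSpace G] [BorelSpace G]

/-- By `lintegral_coef` and `tsum_lam`, the two sums together contain every integral covector
exactly once, integrated over one period in t; Parseval on each torus then gives the norm on G/Γ. -/
theorem tsum_energy [CompactSpace (G ⧸ D.Γ)]
    (hnil : LieRing.IsNilpotent (GroupLieAlgebra (𝓡 (d + 1)) G)) (ξ : C(G ⧸ D.Γ, ℂ)) :
    (∑' l : S, ∫⁻ t, ‖D.coef ξ (I.cov (Sum.inl l)) t‖ₑ ^ 2) +
      ∑' l : D.Lam, ‖∫ t, D.coef ξ (I.lam l).1.1 t *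
        Circle.exp (2 * Real.pi * (t * (I.lam l).2)) ∂unitMeasure‖ₑ ^ 2 =
      ∫⁻ q, ‖ξ q‖ₑ ^ 2 ∂D.nu := by
  have hm : Measurable fun q => ‖ξ q‖ₑ ^ 2 := by
    refine measurable_from_quotient.2 ?_
    exact ((ξ.continuous.comp continuous_quotient_mk').enorm.measurable).pow_const 2
  refine (congrArg₂ (· + ·) ((tsum_congr (I.lintegral_coef hnil ξ)).trans (tsum_tsum_equiv I.orb
    fun k => ∫⁻ t, ‖D.coef ξ k.1 t‖ₑ ^ 2 ∂unitMeasure)) (I.tsum_lam ξ)).trans ?_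
  refine (tsum_not_add_tsum D.IsFixed
    fun k => ∫⁻ t, ‖D.coef ξ k t‖ₑ ^ 2 ∂unitMeasure).trans ?_
  rw [D.lintegral_nu hm]
  rw [← lintegral_tsum fun k => ((continuous_coef ξ k).enorm.measurable.pow_const 2).aemeasurable]
  exact lintegral_congr fun t => tsum_enorm_sq_coef ξ t

theorem opU_inl (hnil : LieRing.IsNilpotent (GroupLieAlgebra (𝓡 (d + 1)) G)) (ξ : C(G ⧸ D.Γ, ℂ))
    (l : S) : D.opU S ξ (Sum.inl l) =
      D.sec (I.cov (Sum.inl l)) (D.coef ξ (I.cov (Sum.inl l))) :=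
  D.opU_inl hnil l (I.pair_cov (Sum.inl l)) ξ

theorem opU_inr [CompactSpace (G ⧸ D.Γ)]
    (hnil : LieRing.IsNilpotent (GroupLieAlgebra (𝓡 (d + 1)) G)) (ξ : C(G ⧸ D.Γ, ℂ))
    (l : D.Lam) : D.opU S ξ (Sum.inr l) = fun g => ((chi l.1 g)⁻¹ : Circle) *
      ∫ t, D.coef ξ (I.lam l).1.1 t * Circle.exp (2 * Real.pi * (t * (I.lam l).2)) ∂unitMeasure :=
  D.opU_inr hnil l (I.lam_pair l) (I.lam l).1.2 (I.lam_last l) ξ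

theorem lintegral_nu_lt_top [CompactSpace (G ⧸ D.Γ)] (ξ : C(G ⧸ D.Γ, ℂ)) :
    ∫⁻ q, ‖ξ q‖ₑ ^ 2 ∂D.nu < ⊤ := by
  have := D.isProbabilityMeasure_nu
  refine (lintegral_mono (g := fun _ => ‖ξ‖ₑ ^ 2) fun q => ?_).trans_lt ?_
  · simp only
    gcongr
    rw [← ofReal_norm, ← ofReal_norm]
    exact ENNReal.ofReal_le_ofReal (ξ.norm_coe_le_norm q)
  · simp

/-- For l in Σ, square integrability over the line holds because a single term is bounded by the
finite total in `tsum_energy`. -/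
theorem opU_mem (I : D.Index S) [CompactSpace (G ⧸ D.Γ)]
    (hnil : LieRing.IsNilpotent (GroupLieAlgebra (𝓡 (d + 1)) G)) (ξ : C(G ⧸ D.Γ, ℂ))
    (i : S ⊕ D.Lam) :
    D.opU S ξ i ∈ l2Sections (D.subgp S i) (chi (D.fnl S i)) (D.meas S i) := by
  cases i with
  | inl l =>
    refine D.mem_l2Sections_iff.2 ?_
    rw [I.opU_inl hnil]
    refine ⟨(D.continuous_sec _ (continuous_coef ξ _)).measurable,
      (D.covariant_iff hnil (I.pair_cov (Sum.inl l))).2 ⟨_, rfl⟩, ?_⟩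
    simp only [sec_e, chr_zero, inv_one, Circle.coe_one, one_mul]
    refine ⟨(continuous_coef ξ _).aestronglyMeasurable, ?_⟩
    rw [eLpNorm_lt_top_iff_lintegral_rpow_enorm_lt_top two_ne_zero ENNReal.ofNat_ne_top]
    simp only [ENNReal.toReal_ofNat, ENNReal.rpow_two]
    refine lt_of_le_of_lt ?_ (lintegral_nu_lt_top ξ)
    rw [← I.tsum_energy hnil ξ]
    exact (ENNReal.le_tsum l).trans le_self_add
  | inr l =>
    refine mem_l2Sections_top.2 ?_
    rw [I.opU_inr hnil]
    refine ⟨?_, (D.covariant_top_iff hnil (I.lam_pair l) (I.lam l).1.2 (I.lam_last l)).2 ⟨_, rfl⟩⟩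
    have h := (D.continuous_chi hnil (I.lam_pair l) (I.lam l).1.2 (I.lam_last l)).inv
    exact ((continuous_subtype_val.comp h).mul continuous_const).measurable

theorem tsum_enorm_opU (I : D.Index S) [CompactSpace (G ⧸ D.Γ)]
    (hnil : LieRing.IsNilpotent (GroupLieAlgebra (𝓡 (d + 1)) G)) (ξ : C(G ⧸ D.Γ, ℂ)) :
    ∑' i, ‖toInd (D.opU S ξ i) (I.opU_mem hnil ξ i)‖ₑ ^ 2 = ∫⁻ q, ‖ξ q‖ₑ ^ 2 ∂D.nu := by
  rw [← I.tsum_energy hnil ξ, tsum_sum_type]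
  congr 1
  · refine tsum_congr fun l => ?_
    rw [enorm_toInd_sq]
    have h := D.mem_l2Sections_iff.1 (I.opU_mem hnil ξ (Sum.inl l))
    refine (D.lintegral_muGM h.1 h.2.1).trans (lintegral_congr fun t => ?_)
    rw [I.opU_inl hnil, sec_e, chr_zero, inv_one, Circle.coe_one, one_mul]
  · refine tsum_congr fun l => ?_
    rw [enorm_toInd_sq]
    have h := mem_l2Sections_top.1 (I.opU_mem hnil ξ (Sum.inr l))
    refine (lintegral_dirac_top h.2).trans ?_
    rw [I.opU_inr hnil]
    change ‖(((chi (n := d + 1) l.1 1)⁻¹ : Circle) : ℂ) * _‖ₑ ^ 2 = _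
    rw [D.chi_one hnil (I.lam_pair l), inv_one, Circle.coe_one, one_mul]

theorem opU_add [CompactSpace (G ⧸ D.Γ)] (I : D.Index S)
    (hnil : LieRing.IsNilpotent (GroupLieAlgebra (𝓡 (d + 1)) G)) (ξ η : C(G ⧸ D.Γ, ℂ))
    (i : S ⊕ D.Lam) : D.opU S (ξ + η : C(G ⧸ D.Γ, ℂ)) i = D.opU S ξ i + D.opU S η i := by
  cases i with
  | inl l =>
    rw [I.opU_inl hnil, I.opU_inl hnil, I.opU_inl hnil]
    funext g
    simp only [sec, coef_add, Pi.add_apply, mul_add]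
  | inr l =>
    rw [I.opU_inr hnil, I.opU_inr hnil, I.opU_inr hnil]
    funext g
    simp only [coef_add, Pi.add_apply, add_mul]
    rw [integral_add (integrable_coef_mul ξ _ _) (integrable_coef_mul η _ _), mul_add]

theorem opU_smul [CompactSpace (G ⧸ D.Γ)] (I : D.Index S)
    (hnil : LieRing.IsNilpotent (GroupLieAlgebra (𝓡 (d + 1)) G)) (c : ℂ) (ξ : C(G ⧸ D.Γ, ℂ))
    (i : S ⊕ D.Lam) : D.opU S (c • ξ : C(G ⧸ D.Γ, ℂ)) i = c • D.opU S ξ i := by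
  cases i with
  | inl l =>
    rw [I.opU_inl hnil, I.opU_inl hnil]
    funext g
    simp only [sec, coef_smul, Pi.smul_apply, smul_eq_mul]
    ring
  | inr l =>
    rw [I.opU_inr hnil, I.opU_inr hnil]
    funext g
    simp only [coef_smul, Pi.smul_apply, smul_eq_mul, mul_assoc]
    rw [integral_const_mul]
    ring

/-- The operator `U` on continuous functions. -/
def opUL (I : D.Index S) [CompactSpace (G ⧸ D.Γ)]
    (hnil : LieRing.IsNilpotent (GroupLieAlgebra (𝓡 (d + 1)) G)) :
    C(G ⧸ D.Γ, ℂ) →ₗ[ℂ] D.HRho S where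
  toFun ξ := ⟨fun i => toInd (D.opU S ξ i) (I.opU_mem hnil ξ i), memℓp_two_of_tsum (by
    rw [I.tsum_enorm_opU hnil]; exact (lintegral_nu_lt_top ξ).ne)⟩
  map_add' ξ η := by
    refine lp.ext (funext fun i => ?_)
    refine Eq.trans ?_ ((toIndL (D.subgp S i) (chi (D.fnl S i)) (D.meas S i)).map_add
      ⟨_, I.opU_mem hnil ξ i⟩ ⟨_, I.opU_mem hnil η i⟩)
    exact toInd_congr (I.opU_add hnil ξ η i) _ _
  map_smul' c ξ := by
    refine lp.ext (funext fun i => ?_)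
    refine Eq.trans ?_ ((toIndL (D.subgp S i) (chi (D.fnl S i)) (D.meas S i)).map_smul c
      ⟨_, I.opU_mem hnil ξ i⟩)
    exact toInd_congr (I.opU_smul hnil c ξ i) _ _

end Index

end Data

/-! ### The sum over Γ/(Γ ∩ M) and its Fourier coefficients -/

theorem finite_int_abs_add_le (t R : ℝ) : {j : ℤ | |t + j| ≤ R}.Finite := by
  refine (Set.finite_Icc ⌈-R - t⌉ ⌊R - t⌋).subset fun j hj => ?_
  have h : -R ≤ t + j ∧ t + j ≤ R := abs_le.1 hj
  exact ⟨Int.ceil_le.2 (by linarith), Int.le_floor.2 (by linarith)⟩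

/-- Near t, a nonzero value forces t + j into a fixed bounded interval. The finiteness and the
continuity of the coset sums rest on this. -/
theorem locallyFinite_support_add_int {a : ℝ → ℂ} (ha : HasCompactSupport a) :
    LocallyFinite fun j : ℤ => Function.support fun t => a (t + j) := by
  obtain ⟨R, hR⟩ := ha.isCompact.isBounded.subset_closedBall 0
  intro t
  refine ⟨Metric.ball t 1, Metric.ball_mem_nhds t one_pos,
    (finite_int_abs_add_le t (R + 1)).subset ?_⟩
  rintro j ⟨s, hs, hs'⟩
  have h1 := hR (subset_tsupport _ hs)
  rw [mem_closedBall_zero_iff, Real.norm_eq_abs] at h1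
  rw [Metric.mem_ball, Real.dist_eq, abs_sub_comm] at hs'
  have h2 := abs_add_le (t - s) (s + j)
  rw [show t - s + (s + j) = t + j by ring] at h2
  exact (show |t + j| ≤ R + 1 by linarith)

theorem finite_support_add_int {a : ℝ → ℂ} (ha : HasCompactSupport a) (t : ℝ) :
    {j : ℤ | a (t + j) ≠ 0}.Finite :=
  (locallyFinite_support_add_int ha).point_finite t

namespace Data

variable {d : ℕ} {G : Type*} [TopologicalSpace G]
    [ChartedSpace (EuclideanSpace ℝ (Fin (d + 1))) G] [Group G]
    [LieGroup (𝓡 (d + 1)) ∞ G] (D : Data d G)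

/-- The sum of the right translates of a function by the cosets in `Γ/(Γ ∩ M)`. -/
def per (F : G → ℂ) (g : G) : ℂ :=
  ∑ᶠ q : D.Γ ⧸ D.M.subgroupOf D.Γ, F (g * ((q.out : D.Γ) : G))

theorem opV_eq (S : Set (Module.Dual ℝ (GroupLieAlgebra (𝓡 (d + 1)) G)))
    (K : S ⊕ D.Lam → G → ℂ) (g : G) :
    D.opV S K g = ∑ᶠ l, D.per (K (Sum.inl l)) g + ∑ᶠ l, K (Sum.inr l) g := rfl

section Per

variable {D}

theorem apply_mul_out {F : G → ℂ} (hF : ∀ g, ∀ h ∈ D.M, h ∈ D.Γ → F (g * h) = F g)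
    (g : G) (γ : D.Γ) :
    F (g * (((γ : D.Γ ⧸ D.M.subgroupOf D.Γ).out : D.Γ) : G)) = F (g * (γ : G)) :=
  apply_out_of_invariant (N := D.M.subgroupOf D.Γ) (f := fun γ : D.Γ => F (g * (γ : G)))
    (fun γ n hn => by rw [Subgroup.coe_mul, ← mul_assoc]; exact hF _ _ hn n.2) γ

/-- Left multiplication by γ permutes the cosets, and the terms do not depend on the
representatives. -/
theorem per_mul {F : G → ℂ} (hF : ∀ g, ∀ h ∈ D.M, h ∈ D.Γ → F (g * h) = F g) (g : G) (γ : D.Γ) :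
    D.per F (g * γ) = D.per F g := by
  refine Eq.trans (finsum_congr fun q => ?_) (finsum_comp_equiv (MulAction.toPerm γ))
  obtain ⟨δ, rfl⟩ := QuotientGroup.mk_surjective q
  have h : MulAction.toPerm γ (δ : D.Γ ⧸ D.M.subgroupOf D.Γ) = (γ * δ : D.Γ) := rfl
  rw [h, apply_mul_out hF, apply_mul_out hF, Subgroup.coe_mul, mul_assoc]

theorem exists_continuousMap_eq {F : G → ℂ} (hF : Continuous F)
    (h : ∀ g, ∀ γ ∈ D.Γ, F (g * γ) = F g) :
    ∃ ξ : C(G ⧸ D.Γ, ℂ), ∀ g : G, ξ (g : G ⧸ D.Γ) = F g := by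
  refine ⟨⟨Quotient.lift F fun a b hab => ?_, hF.quotient_lift _⟩, fun g => rfl⟩
  have h1 := h a (a⁻¹ * b) (QuotientGroup.leftRel_apply.1 hab)
  rw [mul_inv_cancel_left] at h1
  exact h1.symm

end Per

variable [T2Space G] [SimplyConnectedSpace G]

/-- The cosets in `Γ/(Γ ∩ M)` are those of `exp(j X_n)` for integral `j`. -/
def cosetEquiv : ℤ ≃ D.Γ ⧸ D.M.subgroupOf D.Γ :=
  Equiv.ofBijective
    (fun j => ((⟨D.e (j, 0), intVec_zero (d := d) ▸ D.e_int_mem j 0⟩ : D.Γ) :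
      D.Γ ⧸ D.M.subgroupOf D.Γ)) <| by
    constructor
    · intro i j h
      have h1 : (D.e (i, 0))⁻¹ * D.e (j, 0) ∈ D.M :=
        (QuotientGroup.eq (s := D.M.subgroupOf D.Γ)).1 h
      rw [e_inv, e_mul, e_mem_M] at h1
      have h2 : (j : ℝ) = i := by simpa [neg_add_eq_zero, eq_comm] using h1
      exact_mod_cast h2.symm
    · intro q
      obtain ⟨⟨g, hg⟩, rfl⟩ := QuotientGroup.mk_surjective q
      obtain ⟨a, rfl⟩ := D.e.surjective g
      obtain ⟨j, m, rfl⟩ := D.mem_Γ.1 hg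
      refine ⟨j, QuotientGroup.eq.2 ?_⟩
      change (D.e (j, 0))⁻¹ * D.e (j, intVec m) ∈ D.M
      rw [e_inv, e_mul, e_mem_M]
      simp

variable {D}

/-- An element of M ∩ Γ shifts x by an integral vector, on which the character is 1. -/
theorem sec_mul_of_mem {k : Fin d → ℤ} {a : ℝ → ℂ} (g h : G) (hM : h ∈ D.M) (hΓ : h ∈ D.Γ) :
    D.sec k a (g * h) = D.sec k a g := by
  obtain ⟨⟨t, x⟩, rfl⟩ := D.e.surjective g
  obtain ⟨b, rfl⟩ := D.e.surjective h
  obtain ⟨j, m, rfl⟩ := D.mem_Γ.1 hΓ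
  have hj : (j : ℝ) = 0 := D.e_mem_M.1 hM
  rw [hj, e_mul_zero, sec_e, sec_e, chr_add, chr_intVec, mul_one]

theorem sec_mul_cosetEquiv_out (k : Fin d → ℤ) (a : ℝ → ℂ) (t : ℝ) (x : Fin d → ℝ) (j : ℤ) :
    D.sec k a (D.e (t, x) * (((D.cosetEquiv j).out : D.Γ) : G)) =
      ((chr k (flow D.A (-j) x))⁻¹ : Circle) * a (t + j) := by
  refine (apply_mul_out sec_mul_of_mem _ _).trans ?_
  rw [e_mul, sec_e, add_zero]

theorem per_sec_e (k : Fin d → ℤ) (a : ℝ → ℂ) (t : ℝ) (x : Fin d → ℝ) :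
    D.per (D.sec k a) (D.e (t, x)) =
      ∑ᶠ j : ℤ, ((chr k (flow D.A (-j) x))⁻¹ : Circle) * a (t + j) := by
  rw [per, ← finsum_comp_equiv D.cosetEquiv]
  exact finsum_congr fun j => sec_mul_cosetEquiv_out k a t x j

theorem continuous_per_sec (k : Fin d → ℤ) {a : ℝ → ℂ} (ha : Continuous a)
    (hc : HasCompactSupport a) : Continuous (D.per (D.sec k a)) := by
  have h : D.per (D.sec k a) = (fun b : ℝ × (Fin d → ℝ) =>
      ∑ᶠ j : ℤ, ((chr k (flow D.A (-j) b.2))⁻¹ : Circle) * a (b.1 + j)) ∘ D.e.symm := by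
    funext g
    obtain ⟨⟨t, x⟩, rfl⟩ := D.e.surjective g
    rw [per_sec_e, Function.comp_apply, Homeomorph.symm_apply_apply]
  rw [h]
  refine Continuous.comp (continuous_finsum (fun j => ?_) ?_) D.e.symm.continuous
  · have h1 := continuous_chr k
    fun_prop
  · refine ((locallyFinite_support_add_int hc).preimage_continuous
      (continuous_fst (X := ℝ) (Y := Fin d → ℝ))).subset fun j b hb => ?_
    exact right_ne_zero_of_mul hb

/-- Orthogonality of the characters, applied to a trigonometric polynomial in which frequencies may
be repeated. -/
theorem coef_eq_sum {ι : Type*} {ξ : G ⧸ D.Γ → ℂ} {t : ℝ} {s : Finset ι} {κ : ι → Fin d → ℤ}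
    {c : ι → ℂ} (h : ∀ x, ξ (D.e (t, x) : G) = ∑ i ∈ s, ((chr (κ i) x)⁻¹ : Circle) * c i)
    (k : Fin d → ℤ) : D.coef ξ k t = ∑ i ∈ s, if k = κ i then c i else 0 := by
  have h1 : D.coef ξ k t = ∫ y, ∑ i ∈ s, c i * (chr (k - κ i) y : ℂ) ∂cubeMeasure d := by
    refine integral_congr_ae (ae_of_all _ fun y => ?_)
    simp only
    rw [h, Finset.sum_mul]
    refine Finset.sum_congr rfl fun i _ => ?_
    rw [chr_sub_left, Circle.coe_mul]
    ring
  rw [h1, integral_finsetSum]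
  · refine Finset.sum_congr rfl fun i _ => ?_
    rw [integral_const_mul, integral_chr]
    simp only [sub_eq_zero, mul_ite, mul_one, mul_zero]
  · intro i _
    have h2 := continuous_chr (k - κ i)
    refine Integrable.of_bound (Continuous.aestronglyMeasurable (by fun_prop)) ‖c i‖
      (ae_of_all _ fun y => ?_)
    rw [norm_mul, Circle.norm_coe, mul_one]

namespace Index

variable {S : Set (Module.Dual ℝ (GroupLieAlgebra (𝓡 (d + 1)) G))} (I : D.Index S)

/-- On the torus over t, the coset of exp(j X_n) contributes the character of k ∘ e^{-jA}, the j-th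
covector of the orbit of l, with coefficient a(t + j). -/
theorem coef_per {ξ : G ⧸ D.Γ → ℂ} {l : S} {a : ℝ → ℂ} (hc : HasCompactSupport a)
    (h : ∀ g : G, ξ (g : G ⧸ D.Γ) = D.per (D.sec (I.cov (Sum.inl l)) a) g) (k : Fin d → ℤ) (t : ℝ) :
    D.coef ξ k t = ∑ j ∈ (finite_support_add_int hc t).toFinset,
      if k = (I.orb (l, j)).1 then a (t + j) else 0 := by
  refine coef_eq_sum (fun x => ?_) k
  rw [h, per_sec_e, finsum_eq_sum_of_support_subset _
    (s := (finite_support_add_int hc t).toFinset) fun j hj => ?_]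
  · refine Finset.sum_congr rfl fun j _ => ?_
    rw [chr, ← I.orb_pair_cov l j x]
    rfl
  · rw [Set.Finite.coe_toFinset]
    exact right_ne_zero_of_mul hj

theorem coef_per_cov {ξ : G ⧸ D.Γ → ℂ} {l : S} {a : ℝ → ℂ} (hc : HasCompactSupport a)
    (h : ∀ g : G, ξ (g : G ⧸ D.Γ) = D.per (D.sec (I.cov (Sum.inl l)) a) g) (l' : S) (t : ℝ)
    [Decidable (l' = l)] :
    D.coef ξ (I.cov (Sum.inl l')) t = if l' = l then a t else 0 := by
  rw [I.coef_per hc h]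
  -- The covector of l' is the orbit element with index (l', 0), and the enumeration by Σ × ℤ is
  -- injective.
  have h1 : ∀ j : ℤ, I.cov (Sum.inl l') = (I.orb (l, j)).1 ↔ l' = l ∧ j = 0 := by
    intro j
    rw [cov, Subtype.coe_inj, I.orb.apply_eq_iff_eq, Prod.mk_inj, eq_comm (a := (0 : ℤ))]
  simp only [h1]
  split_ifs with hl
  · simp only [hl, true_and, Finset.sum_ite_eq', Set.Finite.mem_toFinset, Set.mem_ofPred_eq,
      Int.cast_zero, add_zero]
    -- If j = 0 is missing from the finite set of summands, this is because a t = 0.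
    split_ifs with h2
    · rfl
    · exact (not_not.1 h2).symm
  · simp [hl]

theorem coef_per_fixed {ξ : G ⧸ D.Γ → ℂ} {l : S} {a : ℝ → ℂ} (hc : HasCompactSupport a)
    (h : ∀ g : G, ξ (g : G ⧸ D.Γ) = D.per (D.sec (I.cov (Sum.inl l)) a) g) {k : Fin d → ℤ}
    (hk : D.IsFixed k) (t : ℝ) : D.coef ξ k t = 0 := by
  rw [I.coef_per hc h]
  refine Finset.sum_eq_zero fun j _ => if_neg ?_
  rintro rfl
  exact (I.orb (l, j)).2 hk

end Index

end Data

theorem finsum_add_finsum_eq_sum {α β M : Type*} [AddCommMonoid M] {f : α ⊕ β → M}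
    {s : Finset (α ⊕ β)} (h : ∀ i, f i ≠ 0 → i ∈ s) :
    ∑ᶠ a, f (Sum.inl a) + ∑ᶠ b, f (Sum.inr b) = ∑ i ∈ s, f i := by
  rw [finsum_eq_sum_of_support_subset (s := s.toLeft) _ fun a ha =>
      Finset.mem_toLeft.2 (h _ ha),
    finsum_eq_sum_of_support_subset (s := s.toRight) _ fun a ha =>
      Finset.mem_toRight.2 (h _ ha), ← Finset.sum_disjSum, Finset.toLeft_disjSum_toRight]

/-! ### The identity U V = 1 on H_ρ^0 -/

namespace Data

variable {d : ℕ} {G : Type*} [TopologicalSpace G]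
    [ChartedSpace (EuclideanSpace ℝ (Fin (d + 1))) G] [Group G]
    [LieGroup (𝓡 (d + 1)) ∞ G] {D : Data d G}
    {S : Set (Module.Dual ℝ (GroupLieAlgebra (𝓡 (d + 1)) G))}
    [T2Space G] [SimplyConnectedSpace G]

namespace Index

variable (I : D.Index S)

/-- The profile is the restriction to e(t, 0); it vanishes outside the image under `tau` of the
compact set that supports the section. -/
theorem exists_eq_sec (hnil : LieRing.IsNilpotent (GroupLieAlgebra (𝓡 (d + 1)) G)) {l : S}
    {F : G → ℂ} (hF : IsCcSection D.M (chi l.1) F) :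
    ∃ a, Continuous a ∧ HasCompactSupport a ∧ F = D.sec (I.cov (Sum.inl l)) a := by
  obtain ⟨h1, h2, C, hC, h3⟩ := hF
  obtain ⟨a, rfl⟩ := (D.covariant_iff hnil (I.pair_cov (Sum.inl l))).1 h2
  have h4 : ∀ t, D.sec (I.cov (Sum.inl l)) a (D.e (t, 0)) = a t := fun t => by
    rw [sec_e, chr_zero, inv_one, Circle.coe_one, one_mul]
  refine ⟨a, ?_, ?_, rfl⟩
  · have h5 : a = fun t => D.sec (I.cov (Sum.inl l)) a (D.e (t, 0)) := funext fun t => (h4 t).symm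
    rw [h5]
    exact h1.comp (D.e.continuous.comp (by fun_prop))
  · refine HasCompactSupport.intro (hC.image D.continuous_tau) fun t ht => ?_
    rw [← h4 t]
    refine h3 _ fun h => ht ⟨_, h, ?_⟩
    rw [tau_mk, Homeomorph.symm_apply_apply]

theorem isCcSection_sec (hnil : LieRing.IsNilpotent (GroupLieAlgebra (𝓡 (d + 1)) G)) (l : S)
    {a : ℝ → ℂ} (ha : Continuous a) (hc : HasCompactSupport a) :
    IsCcSection D.M (chi l.1) (D.sec (I.cov (Sum.inl l)) a) := by
  refine ⟨D.continuous_sec _ ha, (D.covariant_iff hnil (I.pair_cov (Sum.inl l))).2 ⟨a, rfl⟩,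
    (fun t => (D.e (t, 0) : G ⧸ D.M)) '' tsupport a, hc.isCompact.image
      (continuous_quotient_mk'.comp (D.e.continuous.comp (by fun_prop))), fun g hg => ?_⟩
  obtain ⟨⟨t, x⟩, rfl⟩ := D.e.surjective g
  rw [mk_e] at hg
  have : a t = 0 := by
    by_contra h
    exact hg ⟨t, subset_tsupport _ h, rfl⟩
  rw [sec_e, this, mul_zero]

theorem isCcSection_top (I : D.Index S)
    (hnil : LieRing.IsNilpotent (GroupLieAlgebra (𝓡 (d + 1)) G)) {l : D.Lam}
    {F : G → ℂ} (hF : Covariant ⊤ (chi l.1) F) : IsCcSection ⊤ (chi l.1) F := by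
  refine ⟨?_, hF, Set.univ, ?_, fun g hg => (hg trivial).elim⟩
  · obtain ⟨c, rfl⟩ :=
      (D.covariant_top_iff hnil (I.lam_pair l) (I.lam l).1.2 (I.lam_last l)).1 hF
    have h := (D.continuous_chi hnil (I.lam_pair l) (I.lam l).1.2 (I.lam_last l)).inv
    exact (continuous_subtype_val.comp h).mul continuous_const
  · have : (Set.univ : Set (G ⧸ (⊤ : Subgroup G))) = {((1 : G) : G ⧸ (⊤ : Subgroup G))} :=
      Set.eq_singleton_iff_unique_mem.2 ⟨trivial, fun q _ => mk_top_eq q⟩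
    rw [this]
    exact isCompact_singleton

/-- Only finitely many l have a nonzero section; for each of them the compact support of the profile
leaves finitely many integers j, that is, cosets. -/
theorem finite_per (I : D.Index S)
    (hnil : LieRing.IsNilpotent (GroupLieAlgebra (𝓡 (d + 1)) G))
    {K : S ⊕ D.Lam → G → ℂ} (hK : D.IsH0 S K) (g : G) :
    {x : S × (D.Γ ⧸ D.M.subgroupOf D.Γ) |
        K (Sum.inl x.1) (g * ((x.2.out : D.Γ) : G)) ≠ 0}.Finite := by
  have h1 : ∀ l : S, {q : D.Γ ⧸ D.M.subgroupOf D.Γ |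
      K (Sum.inl l) (g * ((q.out : D.Γ) : G)) ≠ 0}.Finite := by
    intro l
    obtain ⟨a, -, hc, h⟩ := I.exists_eq_sec hnil (hK.1 (Sum.inl l))
    obtain ⟨⟨t, x⟩, rfl⟩ := D.e.surjective g
    refine ((finite_support_add_int hc t).image D.cosetEquiv).subset fun q hq => ?_
    obtain ⟨j, rfl⟩ := D.cosetEquiv.surjective q
    refine ⟨j, ?_, rfl⟩
    rw [Set.mem_ofPred_eq, h, sec_mul_cosetEquiv_out] at hq
    exact right_ne_zero_of_mul hq
  have h2 : {l : S | K (Sum.inl l) ≠ 0}.Finite := hK.2.preimage Sum.inl_injective.injOn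
  refine (h2.biUnion fun l _ => (h1 l).image (Prod.mk l)).subset ?_
  rintro ⟨l, q⟩ hx
  refine Set.mem_biUnion (x := l) (fun h => hx ?_) ⟨q, hx, rfl⟩
  simp only [h, Pi.zero_apply]

theorem apply_out (I : D.Index S)
    (hnil : LieRing.IsNilpotent (GroupLieAlgebra (𝓡 (d + 1)) G))
    {K : S ⊕ D.Lam → G → ℂ} (hK : D.IsH0 S K) (g : G) (l : S) (γ : D.Γ) :
    K (Sum.inl l) (g * (((γ : D.Γ ⧸ D.M.subgroupOf D.Γ).out : D.Γ) : G)) =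
      K (Sum.inl l) (g * (γ : G)) := by
  obtain ⟨a, -, -, h⟩ := I.exists_eq_sec hnil (hK.1 (Sum.inl l))
  rw [h]
  exact apply_mul_out sec_mul_of_mem g γ

variable [MeasurableSpace G] [BorelSpace G] [CompactSpace (G ⧸ D.Γ)]

open scoped Classical in
-- The only frequencies present are those in the orbit of l: no fixed covector occurs among them, so
-- the components in Λ vanish, and the only covector of an element of Σ that occurs is that of l.
theorem opU_per (hnil : LieRing.IsNilpotent (GroupLieAlgebra (𝓡 (d + 1)) G))
    {ξ : C(G ⧸ D.Γ, ℂ)} {l : S} {a : ℝ → ℂ} (hc : HasCompactSupport a)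
    (h : ∀ g : G, ξ (g : G ⧸ D.Γ) = D.per (D.sec (I.cov (Sum.inl l)) a) g) :
    D.opU S ξ = Pi.single (Sum.inl l) (D.sec (I.cov (Sum.inl l)) a) := by
  funext i
  cases i with
  | inl l' =>
    rw [I.opU_inl hnil]
    by_cases hl : l' = l
    · subst hl
      rw [Pi.single_eq_same]
      congr 1
      funext t
      rw [I.coef_per_cov hc h, if_pos rfl]
    · rw [Pi.single_eq_of_ne (fun e => hl (Sum.inl_injective e))]
      funext g
      rw [sec, I.coef_per_cov hc h, if_neg hl, mul_zero]
      rfl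
  | inr l' =>
    rw [I.opU_inr hnil, Pi.single_eq_of_ne Sum.inr_ne_inl]
    funext g
    simp only [I.coef_per_fixed hc h (I.lam l').1.2, zero_mul, integral_zero, mul_zero]
    rfl

open scoped Classical in
-- The function has a single frequency in x and a single one in t; the frequency in x is a fixed
-- covector, so it contributes to no component in Σ, and orthogonality in both variables isolates l.
theorem opU_chi (I : D.Index S)
    (hnil : LieRing.IsNilpotent (GroupLieAlgebra (𝓡 (d + 1)) G))
    {ξ : C(G ⧸ D.Γ, ℂ)} {l : D.Lam} {c : ℂ}
    (h : ∀ g : G, ξ (g : G ⧸ D.Γ) = ((chi l.1 g)⁻¹ : Circle) * c) :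
    D.opU S ξ = Pi.single (Sum.inr l) fun g => ((chi l.1 g)⁻¹ : Circle) * c := by
  have h1 : ∀ k t, D.coef ξ k t = if k = (I.lam l).1.1 then
      ((Circle.exp (2 * Real.pi * (t * (I.lam l).2)))⁻¹ : Circle) * c else 0 := by
    intro k t
    refine (coef_eq_sum (s := (Finset.univ : Finset Unit)) (κ := fun _ => (I.lam l).1.1)
      (c := fun _ => ((Circle.exp (2 * Real.pi * (t * (I.lam l).2)))⁻¹ : Circle) * c)
      (fun x => ?_) k).trans (by simp)
    rw [h, D.chi_e_eq hnil (I.lam_pair l) (I.lam l).1.2 (I.lam_last l)]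
    simp only [Finset.univ_unique, Finset.sum_const, Finset.card_singleton, one_smul, mul_inv,
      Circle.coe_mul]
    ring
  funext i
  cases i with
  | inl l' =>
    rw [I.opU_inl hnil, Pi.single_eq_of_ne Sum.inl_ne_inr]
    funext g
    have h2 : I.cov (Sum.inl l') ≠ (I.lam l).1.1 := fun e =>
      (I.orb (l', 0)).2 (e ▸ (I.lam l).1.2 : D.IsFixed (I.cov (Sum.inl l')))
    rw [sec, h1, if_neg h2, mul_zero]
    rfl
  | inr l' =>
    rw [I.opU_inr hnil]
    by_cases hk : (I.lam l').1 = (I.lam l).1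
    · have h2 : ∫ t, D.coef ξ (I.lam l').1.1 t *
          Circle.exp (2 * Real.pi * (t * (I.lam l').2)) ∂unitMeasure =
          if l' = l then c else 0 := by
        have h3 : ∀ t : ℝ, D.coef ξ (I.lam l').1.1 t *
            Circle.exp (2 * Real.pi * (t * (I.lam l').2)) = c *
              -- The two phases in t combine to the difference of the values on X_n, which is 0
              -- exactly for l' = l, as the covectors already agree.
              Circle.exp (2 * Real.pi * (t * ((I.lam l').2 - (I.lam l).2 : ℤ))) := by
          intro t
          have h4 : 2 * Real.pi * (t * ((I.lam l').2 - (I.lam l).2 : ℤ)) =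
              2 * Real.pi * (t * (I.lam l').2) - 2 * Real.pi * (t * (I.lam l).2) := by
            push_cast; ring
          rw [h1, if_pos (congrArg Subtype.val hk), h4, Circle.exp_sub, div_eq_mul_inv,
            Circle.coe_mul]
          ring
        simp only [h3]
        rw [integral_const_mul, integral_exp_unit]
        have h5 : (I.lam l').2 - (I.lam l).2 = 0 ↔ l' = l := by
          rw [sub_eq_zero]
          exact ⟨fun e => I.lam.injective (Prod.ext hk e), fun e => by rw [e]⟩
        simp only [h5, mul_ite, mul_one, mul_zero]
      rw [h2]
      by_cases hl : l' = l
      · subst hl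
        rw [Pi.single_eq_same, if_pos rfl]
      · rw [Pi.single_eq_of_ne (fun e => hl (Sum.inr_injective e)), if_neg hl]
        simp only [mul_zero]
        rfl
    · have hl : l' ≠ l := fun e => hk (by rw [e])
      rw [Pi.single_eq_of_ne (fun e => hl (Sum.inr_injective e))]
      funext g
      simp only [h1, if_neg (fun e => hk (Subtype.ext e)), zero_mul, integral_zero, mul_zero]
      rfl

open scoped Classical in
-- The case of a family with a single nonzero member, to which `exists_opU_eq` reduces by
-- additivity: the coset sum for Σ, or the section itself for Λ, descends to G/Γ.
theorem exists_opU_eq_single (I : D.Index S)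
    (hnil : LieRing.IsNilpotent (GroupLieAlgebra (𝓡 (d + 1)) G))
    (i : S ⊕ D.Lam) {F : G → ℂ} (hF : IsCcSection (D.subgp S i) (chi (D.fnl S i)) F) :
    ∃ ξ : C(G ⧸ D.Γ, ℂ), (∀ g : G, ξ (g : G ⧸ D.Γ) = i.elim (fun _ => D.per F g) fun _ => F g) ∧
      D.opU S ξ = Pi.single i F := by
  cases i with
  | inl l =>
    obtain ⟨a, ha, hc, rfl⟩ := I.exists_eq_sec hnil hF
    obtain ⟨ξ, hξ⟩ := exists_continuousMap_eq (D := D)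
      (continuous_per_sec (I.cov (Sum.inl l)) ha hc) fun g γ hγ =>
        per_mul sec_mul_of_mem g ⟨γ, hγ⟩
    exact ⟨ξ, hξ, I.opU_per hnil hc hξ⟩
  | inr l =>
    have hj := I.lam_last l
    have hk := I.lam_pair l
    obtain ⟨c, rfl⟩ := (D.covariant_top_iff hnil hk (I.lam l).1.2 hj).1 hF.2.1
    obtain ⟨ξ, hξ⟩ := exists_continuousMap_eq (D := D) hF.1 fun g γ hγ => by
      have e2 : chi l.1 γ = 1 := by
        obtain ⟨a, rfl⟩ := D.e.surjective γ
        obtain ⟨i, m, rfl⟩ := D.mem_Γ.1 hγ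
        rw [D.chi_e_eq hnil hk (I.lam l).1.2 hj, chr_intVec, mul_one, mul_comm]
        have := Circle.exp_int_mul_two_pi (i * (I.lam l).2)
        push_cast at this
        exact this
      simp only [D.chi_mul hnil hk (I.lam l).1.2 hj, e2, mul_one]
    exact ⟨ξ, hξ, I.opU_chi hnil hξ⟩

theorem exists_opU_eq (I : D.Index S)
    (hnil : LieRing.IsNilpotent (GroupLieAlgebra (𝓡 (d + 1)) G))
    {K : S ⊕ D.Lam → G → ℂ} (hK : D.IsH0 S K) :
    ∃ ξ : C(G ⧸ D.Γ, ℂ), (∀ g : G, ξ (g : G ⧸ D.Γ) = D.opV S K g) ∧ D.opU S ξ = K := by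
  classical
  choose ξ hξ hU using fun i => I.exists_opU_eq_single hnil i (hK.1 i)
  refine ⟨∑ i ∈ hK.2.toFinset, ξ i, fun g => ?_, ?_⟩
  · rw [opV_eq, ContinuousMap.sum_apply]
    simp only [hξ]
    refine (finsum_add_finsum_eq_sum (f := fun i : S ⊕ D.Lam =>
      i.elim (fun _ => D.per (K i) g) fun _ => K i g) fun i hi => ?_).symm
    refine hK.2.mem_toFinset.2 fun h0 => hi ?_
    cases i <;> simp [h0, per]
  · have h1 := map_sum (AddMonoidHom.mk' (fun ξ : C(G ⧸ D.Γ, ℂ) => D.opU S ξ) fun ξ η =>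
      funext (I.opU_add hnil ξ η)) ξ hK.2.toFinset
    refine h1.trans ?_
    simp only [AddMonoidHom.mk'_apply, hU]
    funext i
    rw [Finset.sum_apply, Finset.sum_pi_single]
    split_ifs with h
    · rfl
    · exact (not_not.1 fun h0 => h (hK.2.mem_toFinset.2 h0)).symm

end Index

end Data

/-- An additive submonoid of a Hilbert sum is dense if it contains elements whose components in each
summand are dense. -/
theorem dense_lp_two {ι : Type*} [DecidableEq ι] {H : ι → Type*} [∀ i, NormedAddCommGroup (H i)]
    (A : AddSubmonoid (lp H 2)) {B : ∀ i, Set (H i)} (hB : ∀ i, Dense (B i))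
    (h : ∀ i, ∀ v ∈ B i, lp.single 2 i v ∈ A) : Dense (A : Set (lp H 2)) := by
  intro f
  have h1 : ∀ i (v : H i), lp.single 2 i v ∈ A.topologicalClosure := by
    intro i v
    exact map_mem_closure (lp.isometry_single i).continuous (hB i v) (h i)
  exact A.isClosed_topologicalClosure.mem_of_tendsto
    (lp.hasSum_single (p := 2) (by norm_num) f) (Filter.Eventually.of_forall fun s =>
      sum_mem fun i _ => h1 i (f i))

/-- The space is a completion, so it suffices to approximate genuine square integrable sections. -/
theorem dense_toInd {G : Type*} [Group G] [MeasurableSpace G] {M : Subgroup G} {χ : G → Circle}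
    {μ : Measure (G ⧸ M)} {P : (G → ℂ) → Prop}
    (h : ∀ F ∈ l2Sections M χ μ, ∀ ε : ℝ≥0∞, ε ≠ 0 → ∃ F', P F' ∧ ∃ hF : F - F' ∈ l2Sections M χ μ,
      F' ∈ l2Sections M χ μ ∧ ‖toInd (F - F') hF‖ₑ ≤ ε) :
    Dense {v : IndSpace M χ μ | ∃ F, P F ∧ ∃ hF, v = toInd F hF} := by
  refine dense_closure.1 (UniformSpace.Completion.denseRange_coe.mono ?_)
  rintro _ ⟨⟨F, hF⟩, rfl⟩
  refine EMetric.mem_closure_iff.2 fun ε hε => ?_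
  obtain ⟨δ, hδ, hδε⟩ := exists_between hε
  obtain ⟨F', hP, h1, h2, h3⟩ := h F hF δ hδ.ne'
  refine ⟨_, ⟨F', hP, h2, rfl⟩, lt_of_le_of_lt ?_ hδε⟩
  rw [edist_eq_enorm_sub]
  refine le_of_eq_of_le ?_ h3
  exact congrArg _ ((toIndL M χ μ).map_sub ⟨F, hF⟩ ⟨F', h2⟩).symm

theorem eLpNorm_two_sq {α E : Type*} [MeasurableSpace α] [NormedAddCommGroup E]
    {μ : Measure α} (f : α → E) : eLpNorm f 2 μ ^ 2 = ∫⁻ x, ‖f x‖ₑ ^ 2 ∂μ := by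
  rw [eLpNorm_eq_lintegral_rpow_enorm_toReal two_ne_zero ENNReal.ofNat_ne_top, ← ENNReal.rpow_two,
    ← ENNReal.rpow_mul]
  simp

/-! ### Density of H_ρ^0 -/

namespace Data

variable {d : ℕ} {G : Type*} [TopologicalSpace G]
    [ChartedSpace (EuclideanSpace ℝ (Fin (d + 1))) G] [Group G]
    [LieGroup (𝓡 (d + 1)) ∞ G] {D : Data d G}
    {S : Set (Module.Dual ℝ (GroupLieAlgebra (𝓡 (d + 1)) G))}

section Represents

variable [MeasurableSpace G]

theorem Represents.eq {h h' : D.HRho S} {K : S ⊕ D.Lam → G → ℂ} (hh : D.Represents S h K)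
    (hh' : D.Represents S h' K) : h = h' := by
  refine lp.ext (funext fun i => ?_)
  obtain ⟨hK, e⟩ := hh i
  obtain ⟨hK', e'⟩ := hh' i
  rw [e, e']

theorem Represents.add {h h' : D.HRho S} {K K' : S ⊕ D.Lam → G → ℂ} (hh : D.Represents S h K)
    (hh' : D.Represents S h' K') : D.Represents S (h + h') (K + K') := by
  intro i
  obtain ⟨hK, e⟩ := hh i
  obtain ⟨hK', e'⟩ := hh' i
  refine ⟨Submodule.add_mem _ hK hK', ?_⟩
  rw [lp.coeFn_add, Pi.add_apply, e, e']
  exact ((toIndL (D.subgp S i) (chi (D.fnl S i)) (D.meas S i)).map_add ⟨_, hK⟩ ⟨_, hK'⟩).symm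

theorem represents_zero : D.Represents S (0 : D.HRho S) 0 := fun i =>
  ⟨Submodule.zero_mem _,
    ((toIndL (D.subgp S i) (chi (D.fnl S i)) (D.meas S i)).map_zero).symm⟩

open scoped Classical in
theorem represents_single {i : S ⊕ D.Lam} {F : G → ℂ}
    (hF : F ∈ l2Sections (D.subgp S i) (chi (D.fnl S i)) (D.meas S i)) :
    D.Represents S (lp.single 2 i (toInd F hF)) (Pi.single i F) := by
  intro j
  by_cases h : j = i
  · subst h
    rw [Pi.single_eq_same, lp.single_apply_self]
    exact ⟨hF, rfl⟩
  · rw [Pi.single_eq_of_ne h, lp.single_apply_ne _ _ _ h]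
    exact represents_zero j

end Represents

theorem isCcSection_zero (M : Subgroup G) (χ : G → Circle) : IsCcSection M χ 0 :=
  ⟨continuous_const, fun _ _ _ => (mul_zero _).symm, ∅, isCompact_empty, fun _ _ => rfl⟩

theorem isH0_zero : D.IsH0 S 0 :=
  ⟨fun _ => isCcSection_zero _ _, by simp⟩

theorem _root_.Nilmanifold.IsCcSection.add {M : Subgroup G} {χ : G → Circle} {F F' : G → ℂ}
    (h : IsCcSection M χ F) (h' : IsCcSection M χ F') : IsCcSection M χ (F + F') := by
  obtain ⟨h1, h2, C, hC, h3⟩ := h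
  obtain ⟨h1', h2', C', hC', h3'⟩ := h'
  refine ⟨h1.add h1', fun g m hm => ?_, C ∪ C', hC.union hC', fun g hg => ?_⟩
  · rw [Pi.add_apply, Pi.add_apply, h2 g m hm, h2' g m hm, mul_add]
  · rw [Pi.add_apply, h3 g fun h => hg (Or.inl h), h3' g fun h => hg (Or.inr h), add_zero]

theorem IsH0.add {K K' : S ⊕ D.Lam → G → ℂ} (h : D.IsH0 S K) (h' : D.IsH0 S K') :
    D.IsH0 S (K + K') := by
  refine ⟨fun i => (h.1 i).add (h'.1 i), (h.2.union h'.2).subset fun i hi => ?_⟩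
  by_contra h0
  simp only [Set.mem_union, Set.mem_ofPred_eq, not_or, not_not] at h0
  exact hi (by rw [Pi.add_apply, h0.1, h0.2, add_zero])

open scoped Classical in
theorem isH0_single {i : S ⊕ D.Lam} {F : G → ℂ}
    (hF : IsCcSection (D.subgp S i) (chi (D.fnl S i)) F) : D.IsH0 S (Pi.single i F) := by
  refine ⟨fun j => ?_, (Set.finite_singleton i).subset fun j hj => ?_⟩
  · by_cases h : j = i
    · subst h
      rwa [Pi.single_eq_same]
    · rw [Pi.single_eq_of_ne h]
      exact isCcSection_zero _ _
  · by_contra h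
    exact hj (Pi.single_eq_of_ne h _)

namespace Index

variable [T2Space G] [SimplyConnectedSpace G] [MeasurableSpace G] [BorelSpace G]

theorem mem_l2Sections_sec (I : D.Index S)
    (hnil : LieRing.IsNilpotent (GroupLieAlgebra (𝓡 (d + 1)) G)) (l : S)
    {a : ℝ → ℂ} (ha : Continuous a) (hc : HasCompactSupport a) :
    D.sec (I.cov (Sum.inl l)) a ∈ l2Sections D.M (chi l.1) D.muGM := by
  refine D.mem_l2Sections_iff.2 ⟨(D.continuous_sec _ ha).measurable,
    (D.covariant_iff hnil (I.pair_cov (Sum.inl l))).2 ⟨_, rfl⟩, ?_⟩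
  simp only [sec_e, chr_zero, inv_one, Circle.coe_one, one_mul]
  exact ha.memLp_of_hasCompactSupport hc

/-- For l in Σ, passing to the profile is isometric to L²(ℝ), where compactly supported continuous
functions are dense. For l in Λ every covariant function already qualifies. -/
theorem dense_isCcSection (I : D.Index S)
    (hnil : LieRing.IsNilpotent (GroupLieAlgebra (𝓡 (d + 1)) G)) (i : S ⊕ D.Lam) :
    Dense {v : IndSpace (D.subgp S i) (chi (D.fnl S i)) (D.meas S i) | ∃ F,
      IsCcSection (D.subgp S i) (chi (D.fnl S i)) F ∧ ∃ hF, v = toInd F hF} := by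
  refine dense_toInd fun F hF ε hε => ?_
  cases i with
  | inl l =>
    obtain ⟨h1, h2, h3⟩ := D.mem_l2Sections_iff.1 hF
    obtain ⟨a, rfl⟩ := (D.covariant_iff hnil (I.pair_cov (Sum.inl l))).1 h2
    simp only [sec_e, chr_zero, inv_one, Circle.coe_one, one_mul] at h3
    obtain ⟨b, hc, hb, hb', -⟩ :=
      h3.exists_hasCompactSupport_eLpNorm_sub_le ENNReal.ofNat_ne_top hε
    have h4 := I.mem_l2Sections_sec hnil l hb' hc
    have h5 := Submodule.sub_mem _ hF h4
    refine ⟨_, I.isCcSection_sec hnil l hb' hc, h5, h4, ?_⟩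
    refine (ENNReal.pow_le_pow_left_iff two_ne_zero).1 ?_
    rw [enorm_toInd_sq]
    refine (D.lintegral_muGM h5.1 h5.2.1).trans_le ?_
    have h6 : eLpNorm (a - b) 2 volume ^ 2 = ∫⁻ t, ‖(a - b) t‖ₑ ^ 2 := eLpNorm_two_sq _
    refine (le_of_eq ?_).trans (pow_le_pow_left₀ zero_le hb 2)
    rw [h6]
    refine lintegral_congr fun t => ?_
    simp only [Pi.sub_apply, sec_e, chr_zero, inv_one, Circle.coe_one, one_mul]
  | inr l =>
    have h0 : F - F ∈ l2Sections (D.subgp S (Sum.inr l)) (chi (D.fnl S (Sum.inr l)))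
      (D.meas S (Sum.inr l)) := Submodule.sub_mem _ hF hF
    refine ⟨F, I.isCcSection_top hnil hF.2.1, h0, hF, ?_⟩
    have h1 : toInd (F - F) h0 = 0 :=
      (toInd_congr (sub_self F) h0 (Submodule.zero_mem _)).trans (map_zero (toIndL _ _ _))
    rw [h1, enorm_zero]
    exact zero_le

theorem dense_isH0 (I : D.Index S)
    (hnil : LieRing.IsNilpotent (GroupLieAlgebra (𝓡 (d + 1)) G)) :
    Dense {h : D.HRho S | ∃ K, D.IsH0 S K ∧ D.Represents S h K} := by
  classical
  let A : AddSubmonoid (D.HRho S) :=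
    { carrier := {h | ∃ K, D.IsH0 S K ∧ D.Represents S h K}
      zero_mem' := ⟨0, isH0_zero, represents_zero⟩
      add_mem' := by
        rintro h h' ⟨K, hK, hr⟩ ⟨K', hK', hr'⟩
        exact ⟨K + K', hK.add hK', hr.add hr'⟩ }
  refine dense_lp_two A (I.dense_isCcSection hnil) ?_
  rintro i _ ⟨F, hF, hm, rfl⟩
  exact ⟨_, isH0_single hF, represents_single hm⟩

end Index

end Data

/-! ### The unitary extension of U -/

namespace Data

namespace Index

variable {d : ℕ} {G : Type*} [TopologicalSpace G]
    [ChartedSpace (EuclideanSpace ℝ (Fin (d + 1))) G] [Group G]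
    [LieGroup (𝓡 (d + 1)) ∞ G] {D : Data d G}
    {S : Set (Module.Dual ℝ (GroupLieAlgebra (𝓡 (d + 1)) G))}
    [T2Space G] [SimplyConnectedSpace G] [MeasurableSpace G] [BorelSpace G]
    [CompactSpace (G ⧸ D.Γ)]

theorem enorm_opUL_sq (I : D.Index S)
    (hnil : LieRing.IsNilpotent (GroupLieAlgebra (𝓡 (d + 1)) G)) (ξ : C(G ⧸ D.Γ, ℂ)) :
    ‖I.opUL hnil ξ‖ₑ ^ 2 = ∫⁻ q, ‖ξ q‖ₑ ^ 2 ∂D.nu :=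
  (enorm_lp_two_sq _).trans (I.tsum_enorm_opU hnil ξ)

theorem represents_opUL (I : D.Index S)
    (hnil : LieRing.IsNilpotent (GroupLieAlgebra (𝓡 (d + 1)) G)) (ξ : C(G ⧸ D.Γ, ℂ)) :
    D.Represents S (I.opUL hnil ξ) (D.opU S ξ) := fun i => ⟨I.opU_mem hnil ξ i, rfl⟩

/-- Continuous functions are dense in `L²(G/Γ)`, and `U` preserves their norms. -/
theorem exists_denseRange_toLp [SecondCountableTopology G] (I : D.Index S)
    (hnil : LieRing.IsNilpotent (GroupLieAlgebra (𝓡 (d + 1)) G)) :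
    ∃ e : C(G ⧸ D.Γ, ℂ) →ₗ[ℂ] Lp ℂ 2 D.nu, DenseRange e ∧ (∀ ξ, ‖I.opUL hnil ξ‖ = ‖e ξ‖) ∧
      ∀ ξ : C(G ⧸ D.Γ, ℂ), ∃ hξ : MemLp ξ 2 D.nu, hξ.toLp ξ = e ξ := by
  have := topologicalGroup_of_lieGroup (G := G) (𝓡 (d + 1)) ∞
  have := D.isProbabilityMeasure_nu
  have := D.t2Space_quotient
  have := D.borelSpace_quotient
  refine ⟨(ContinuousMap.toLp 2 D.nu ℂ).toLinearMap,
    ContinuousMap.toLp_denseRange ℂ D.nu ℂ ENNReal.ofNat_ne_top, fun ξ => ?_, fun ξ => ?_⟩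
  · refine (enorm_eq_iff_norm_eq (E := D.HRho S) (F := Lp ℂ 2 D.nu)).1 ?_
    refine (ENNReal.pow_right_strictMono two_ne_zero).injective ?_
    rw [I.enorm_opUL_sq hnil]
    refine Eq.trans ?_ (congrArg (· ^ 2) (Lp.enorm_def _).symm)
    refine Eq.symm ((congrArg (· ^ 2) (eLpNorm_congr_ae (ContinuousMap.coeFn_toLp (p := 2)
      (𝕜 := ℂ) D.nu ξ))).trans (eLpNorm_two_sq _))
  · have h : (ContinuousMap.toLp 2 D.nu ℂ ξ : G ⧸ D.Γ → ℂ) =ᵐ[D.nu] ξ :=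
      ContinuousMap.coeFn_toLp (p := 2) (𝕜 := ℂ) D.nu ξ
    have h2 : MemLp ξ 2 D.nu := (memLp_congr_ae h).1 (Lp.memLp _)
    exact ⟨h2, Lp.ext (h2.coeFn_toLp.trans h.symm)⟩

/-- U is isometric on a dense subspace, so it extends to an isometry, whose range is closed; the
range contains the dense space H_ρ^0, since each of its elements K is U of the continuous function V
K. -/
theorem exists_unitary [SecondCountableTopology G] (I : D.Index S)
    (hnil : LieRing.IsNilpotent (GroupLieAlgebra (𝓡 (d + 1)) G)) :
    ∃ T : Lp ℂ 2 D.nu ≃ₗᵢ[ℂ] D.HRho S,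
      (∀ ξ : C(G ⧸ D.Γ, ℂ), ∃ hξ : MemLp ξ 2 D.nu,
        D.Represents S (T (hξ.toLp ξ)) (D.opU S ξ)) ∧
      (∀ T' : Lp ℂ 2 D.nu →L[ℂ] D.HRho S,
        (∀ (ξ : C(G ⧸ D.Γ, ℂ)) (hξ : MemLp ξ 2 D.nu),
          D.Represents S (T' (hξ.toLp ξ)) (D.opU S ξ)) → ∀ f, T' f = T f) ∧
      (∀ f : Lp ℂ 2 D.nu, ∀ K, D.IsH0 S K → D.Represents S (T f) K →
        ∀ᵐ x ∂D.nu, ∀ g : G, (g : G ⧸ D.Γ) = x → f x = D.opV S K g) ∧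
      Dense {h : D.HRho S | ∃ ξ : C(G ⧸ D.Γ, ℂ), D.Represents S h (D.opU S ξ)} := by
  obtain ⟨e, he, hn, hm⟩ := I.exists_denseRange_toLp hnil
  set T₀ := (I.opUL hnil).extendOfNorm e with hT₀
  have h1 : ∀ ξ, T₀ (e ξ) = I.opUL hnil ξ := fun ξ =>
    LinearMap.extendOfNorm_eq he ⟨1, fun ξ => by rw [one_mul, hn]⟩ ξ
  have h2 : ∀ f, ‖T₀ f‖ = ‖f‖ := fun f =>
    he.induction_on f (isClosed_eq T₀.continuous.norm continuous_norm) fun ξ => by rw [h1, hn]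
  have h3 : ∀ ξ, D.Represents S (T₀ (e ξ)) (D.opU S ξ) := fun ξ => by
    rw [h1]; exact I.represents_opUL hnil ξ
  have h4 : ∀ {h : D.HRho S} {K}, D.IsH0 S K → D.Represents S h K →
      -- The continuous function that realizes V K, together with the fact that its class is a
      -- preimage of the given element.
      ∃ ξ : C(G ⧸ D.Γ, ℂ), (∀ g : G, ξ (g : G ⧸ D.Γ) = D.opV S K g) ∧ D.opU S ξ = K ∧
        h = T₀ (e ξ) := by
    intro h K hK hr
    obtain ⟨ξ, hξ, hU⟩ := I.exists_opU_eq hnil hK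
    exact ⟨ξ, hξ, hU, hr.eq (hU ▸ h3 ξ)⟩
  let T₁ : Lp ℂ 2 D.nu →ₗᵢ[ℂ] D.HRho S := ⟨T₀.toLinearMap, h2⟩
  have h5 : Function.Surjective T₁ := by
    rw [← Set.range_eq_univ, ← T₁.isometry.isClosedEmbedding.isClosed_range.closure_eq]
    refine Dense.closure_eq ((I.dense_isH0 hnil).mono ?_)
    rintro h ⟨K, hK, hr⟩
    obtain ⟨ξ, -, -, h6⟩ := h4 hK hr
    exact ⟨e ξ, h6.symm⟩
  refine ⟨LinearIsometryEquiv.ofSurjective T₁ h5, fun ξ => ?_, fun T' hT' f => ?_, ?_, ?_⟩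
  · obtain ⟨hξ, h6⟩ := hm ξ
    exact ⟨hξ, h6 ▸ h3 ξ⟩
  · refine congrFun (he.equalizer T'.continuous T₀.continuous (funext fun ξ => ?_)) f
    obtain ⟨hξ, h6⟩ := hm ξ
    have h7 := hT' ξ hξ
    rw [h6] at h7
    exact h7.eq (h3 ξ)
  · intro f K hK hr
    obtain ⟨ξ, hξ, -, h6⟩ := h4 hK hr
    -- Both f and V K are mapped to K, so injectivity identifies them; this is the only source of V
    -- U f = f.
    have h7 : f = e ξ := T₁.injective h6
    obtain ⟨hm', h8⟩ := hm ξ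
    have h9 := hm'.coeFn_toLp
    rw [h8, ← h7] at h9
    filter_upwards [h9] with x hx g hg
    rw [hx, ← hg, hξ]
  · refine (I.dense_isH0 hnil).mono ?_
    rintro h ⟨K, hK, hr⟩
    obtain ⟨ξ, -, hU, h6⟩ := h4 hK hr
    exact ⟨ξ, hU ▸ hr⟩

end Index

end Data

end Nilmanifold

end

theorem mainTheorem2 {d : ℕ} {G : Type*} [TopologicalSpace G]
    [ChartedSpace (EuclideanSpace ℝ (Fin (d + 1))) G] [Group G] [LieGroup (𝓡 (d + 1)) ∞ G]
    [T2Space G] [SecondCountableTopology G] [SimplyConnectedSpace G]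
    [MeasurableSpace G] [BorelSpace G]
    (hnil : LieRing.IsNilpotent (GroupLieAlgebra (𝓡 (d + 1)) G))
    (hnonab : ¬ IsLieAbelian (GroupLieAlgebra (𝓡 (d + 1)) G))
    (D : Nilmanifold.Data d G)
    (S : Set (Module.Dual ℝ (GroupLieAlgebra (𝓡 (d + 1)) G))) (hS : D.IsCrossSection S) :
    -- the three measures are the invariant ones
    (IsProbabilityMeasure D.nu ∧ SMulInvariantMeasure G (G ⧸ D.Γ) D.nu) ∧
    (IsProbabilityMeasure D.nuM ∧
      SMulInvariantMeasure D.M (D.M ⧸ D.Γ.subgroupOf D.M) D.nuM) ∧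
    (IsFiniteMeasureOnCompacts D.muGM ∧ SMulInvariantMeasure G (G ⧸ D.M) D.muGM) ∧
    -- the subspace on which `V` is defined is dense
    Dense {h : D.HRho S | ∃ K, D.IsH0 S K ∧ D.Represents S h K} ∧
    -- the sum that defines `V` is finite, and does not depend on the representatives of cosets
    (∀ K, D.IsH0 S K → ∀ g : G,
      {x : S × (D.Γ ⧸ D.M.subgroupOf D.Γ) |
        K (Sum.inl x.1) (g * ((x.2.out : D.Γ) : G)) ≠ 0}.Finite ∧
      {l : D.Lam | K (Sum.inr l) g ≠ 0}.Finite ∧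
      ∀ (l : S) (γ : D.Γ),
        K (Sum.inl l) (g * (((γ : D.Γ ⧸ D.M.subgroupOf D.Γ).out : D.Γ) : G)) =
          K (Sum.inl l) (g * (γ : G))) ∧
    -- `V K` is a continuous function on `G/Γ`, and `U (V K) = K`
    (∀ K, D.IsH0 S K → ∃ ξ : C(G ⧸ D.Γ, ℂ),
      (∀ g : G, ξ (g : G ⧸ D.Γ) = D.opV S K g) ∧
      ∀ i, ∀ g : G, D.opU S ξ i g = K i g) ∧
    -- `U` extends (uniquely) to a unitary isomorphism `T`, for which `V` is a left inverse as well
    ∃ T : Lp ℂ 2 D.nu ≃ₗᵢ[ℂ] D.HRho S,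
      (∀ ξ : C(G ⧸ D.Γ, ℂ), ∃ hξ : MemLp ξ 2 D.nu,
        D.Represents S (T (hξ.toLp ξ)) (D.opU S ξ)) ∧
      (∀ T' : Lp ℂ 2 D.nu →L[ℂ] D.HRho S,
        (∀ (ξ : C(G ⧸ D.Γ, ℂ)) (hξ : MemLp ξ 2 D.nu),
          D.Represents S (T' (hξ.toLp ξ)) (D.opU S ξ)) → ∀ f, T' f = T f) ∧
      (∀ f : Lp ℂ 2 D.nu, ∀ K, D.IsH0 S K → D.Represents S (T f) K →
        ∀ᵐ x ∂D.nu, ∀ g : G, (g : G ⧸ D.Γ) = x → f x = D.opV S K g) ∧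
      Dense {h : D.HRho S | ∃ ξ : C(G ⧸ D.Γ, ℂ), D.Represents S h (D.opU S ξ)} := by
  have := D.uniform
  obtain ⟨I⟩ := Nilmanifold.Data.nonempty_index hnil hS
  refine ⟨⟨D.isProbabilityMeasure_nu, D.smulInvariantMeasure_nu hnil⟩,
    ⟨D.isProbabilityMeasure_nuM, D.smulInvariantMeasure_nuM⟩,
    ⟨D.isFiniteMeasureOnCompacts_muGM, D.smulInvariantMeasure_muGM⟩, I.dense_isH0 hnil,
    fun K hK g => ⟨I.finite_per hnil hK g, ?_, fun l γ => I.apply_out hnil hK g l γ⟩,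
    fun K hK => ?_, I.exists_unitary hnil⟩
  · refine (hK.2.preimage Sum.inr_injective.injOn).subset fun l hl h => hl ?_
    rw [h, Pi.zero_apply]
  · obtain ⟨ξ, hξ, hU⟩ := I.exists_opU_eq hnil hK
    exact ⟨ξ, hξ, fun i g => by rw [hU]⟩
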